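/- **Setting.** Let $N_{\rm lat}\cong\mathbb Z^n$ be a lattice with dual lattice $M_{\rm lat}$, and let $\sigma\subseteq N_{\mathbb R}$ be a pointed rational polyhedral cone with primitive fundamental generators $a^1,\dots,a^r$ (one on each ray) such that every two-dimensional face $\langle a^j,a^k\rangle$ of $\sigma$ is smooth, i.e. $\{a^j,a^k\}$ extends to a $\mathbb Z$-basis of $N_{\rm lat}$. Let $R\in\sigma^\vee\cap M_{\rm lat}$ be primitive, $Q=\sigma\cap[R=1]$, $Q^\infty=\sigma\cap[R=0]$. Assume that some fundamental generator has $\langle a^j,R\rangle=1$, fix such a lattice vertex of $Q$ as the origin $0$ of $[R=1]$, and let $\mathbb L=[R=1]\cap N_{\rm lat}$, so $M_{\rm lat}=\mathbb L^*\oplus\mathbb Z R$, where $[c,k]$ denotes $c+kR$. Let $d^1,\dots,d^N$ be the compact edges of $Q$, each with a fixed orientation, and assume $N\ge 1$. For a compact 2-face $\varepsilon$ of $Q$ let $(\varepsilon_i)\in\{0,\pm1\}^N$ be a sign vector such that $\varepsilon_i\neq 0$ iff $d^i$ is an edge of $\varepsilon$ and the edges $\varepsilon_id^i$ form a cycle along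 $\partial\varepsilon$. Put $$V=\{t\in\mathbb R^N\mid \textstyle\sum_i t_i\varepsilon_id^i=0\ \text{for all compact 2-faces }\varepsilon,\ t_i=t_j\text{ if }d^i,d^j\text{ share a non-lattice vertex of }Q\},$$ $C(Q)=V\cap\mathbb R^N_{\ge0}$, and let $V_{\mathbb Z}^*\subseteq V^*$ be the dual lattice of $V\cap\mathbb Z^N$. For $t\in C(Q)$ and a vertex $v$ of $Q$, let $v_t=\sum_i t_i\lambda_id^i$, where $\lambda\in\mathbb Z^N$ counts with direction the edges of a walk from $0$ to $v$ along compact edges; put $Q_t=\operatorname{conv}\{v_t\}+Q^\infty$ and $\tilde C(Q)=\{(v,t)\mid t\in C(Q),\,v\in Q_t\}$. Let $$Y=\operatorname{Spec}\mathbb C[\sigma^\vee\cap M_{\rm lat}],\quad X=\operatorname{Spec}\mathbb C[\tilde C(Q)^\vee\cap(\mathbb L^*\times V_{\mathbb Z}^*)],\quad S=\operatorname{Spec}\mathbb C[C(Q)^\vee\cap V_{\mathbb Z}^*].$$ For $c\in\mathbb L^*\cap(Q^\infty)^\vee$ let $v(c)$ be a vertex of $Q$ at which $c$ is minimal on $Q$,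 $\eta_0(c)=-\langle v(c),c\rangle$, $\eta_0^*(c)=\lceil\eta_0(c)\rceil$ and $$\eta^*(c)=\Big(t\mapsto-\sum_i\lambda_i\langle d^i,c\rangle t_i+(\eta_0^*(c)-\eta_0(c))\,e[v(c)](t)\Big)\in V^*,$$ where $\lambda$ counts a walk from $0$ to $v(c)$ along compact edges, and $e[v](t)=t_i$ for a compact edge $d^i$ containing $v$ if $v$ is not a lattice point (the last term is absent if $v(c)$ is a lattice point). Let $\Gamma=\{[c,\eta]\in(\mathbb L^*\cap(Q^\infty)^\vee)\times V_{\mathbb Z}^*\mid\eta-\eta^*(c)\in C(Q)^\vee\}$, $X'=\operatorname{Spec}\mathbb C[\Gamma]$, and let $\pi:X'\to S$ be given by $\eta\mapsto[0,\eta]$. Fix $c^1,\dots,c^w\in\mathbb L^*\cap(Q^\infty)^\vee$ such that $R,[c^1,\eta_0^*(c^1)],\dots,[c^w,\eta_0^*(c^w)]$ generate the semigroup $\sigma^\vee\cap M_{\rm lat}$. Finally let $\mathcal J\subseteq\mathbb C[t_1,\dots,t_N]$ be the ideal generated by the coordinates of $\sum_i t_i^k\varepsilon_id^i$ ($\varepsilon$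 a compact 2-face, $k\ge1$) and by $t_i-t_j$ for $d^i,d^j$ sharing a non-lattice vertex, let $\mathcal M\subseteq\mathbb C^N$ be defined by $\mathcal J$ and $\bar{\mathcal M}\subseteq\mathbb C^N/\mathbb C\cdot(1,\dots,1)$ by $\mathcal J\cap\mathbb C[t_i-t_j]$, and let $\ell:\mathcal M\to\bar{\mathcal M}$ be the projection. **Theorem.** The elements $\eta^*(c)\in V^*$ are well defined (for every $c\in\mathbb L^*\cap(Q^\infty)^\vee$ they exist and do not depend on the choices), and $[c^\nu,\eta^*(c^\nu)]\in\tilde C(Q)^\vee\cap(\mathbb L^*\times V_{\mathbb Z}^*)$ for $\nu=1,\dots,w$. Let $\bar X$ and $\bar S$ be the scheme-theoretic images of the maps $X\to\mathbb C^w\times\mathbb C^N$ and $S\to\mathbb C^N$ whose coordinate functions are the monomials with exponents $[c^\nu,\eta^*(c^\nu)]$, $[0,t_i]$ and $t_i$, respectively. Then: 1. $X\to\bar X$ and $S\to\bar S$ are the normalization maps. 2. $\pi:X'\to S$ induces a map $\bar\pi:\bar X\to\bar S$, compatible with the projection $\mathbb C^w\times\mathbb C^N\to\mathbb C^N$, where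 $X'\to\bar X$ is given by the same monomials as $X\to\bar X$; and $\pi$ is the base change of $\bar\pi$ via $S\to\bar S$. 3. $\mathcal M\subseteq\mathbb C^N$ is contained in $\bar S$, and the composition $\bar X\times_{\bar S}\mathcal M\to\mathcal M\xrightarrow{\ \ell\ }\bar{\mathcal M}$ is flat in $0\in\bar{\mathcal M}$ (after base change to $\operatorname{Spec}\mathcal O_{\bar{\mathcal M},0}$ it is flat), with scheme-theoretic fiber over $0$ equal to $Y$, embedded by $Z_\nu\mapsto x^{[c^\nu,\eta_0^*(c^\nu)]}$, $t_i\mapsto x^{R}$. -/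

import Mathlib

open CategoryTheory CategoryTheory.Limits AlgebraicGeometry

noncomputable section

namespace ToricFlat

/-! ### Morphisms of schemes -/

/-- `f : X ⟶ Y` is the normalization of the integral scheme `Y`: `X` is integral and normal,
`f` is integral, and `f` is birational (it maps the generic point to the generic point and
induces an isomorphism of the local rings there, i.e. of the function fields). -/
structure IsNormalization {X Y : Scheme.{0}} (f : X ⟶ Y) : Prop where
  source_integral : IsIntegral X
  target_integral : IsIntegral Y
  normal : ∀ x : X, IsIntegrallyClosed (X.presheaf.stalk x)
  integral : IsIntegralHom f
  birational : ∀ x : X, IsGenericPoint x Set.univ →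
    IsGenericPoint (f x) Set.univ ∧ IsIso (f.stalkMap x)

/-- `f : X ⟶ Y` is flat in the point `y` of the base: the base change of `f` to the
local scheme `Spec 𝒪_{Y,y}` is flat. (For affine `f` this says that the stalk at `y` of
`f_* 𝒪_X` is a flat `𝒪_{Y,y}`-module.) -/
def FlatInBasePoint {X Y : Scheme.{0}} (f : X ⟶ Y) (y : Y) : Prop :=
  Flat (pullback.snd f (Y.fromSpecStalk y))

/-! ### Cones and lattices. The lattice is `N = ℤⁿ`, its dual `M = ℤⁿ` via the dot product. -/

/-- The inclusion of the lattice `ℤⁿ` into `ℝⁿ`. -/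
def toR {n : ℕ} (x : Fin n → ℤ) : Fin n → ℝ := fun i => (x i : ℝ)

/-- The real pairing `⟨x, m⟩` of `x ∈ N_ℝ` with `m ∈ M`. -/
def pair {n : ℕ} (x : Fin n → ℝ) (m : Fin n → ℤ) : ℝ := ∑ i, x i * (m i : ℝ)

/-- A lattice vector is primitive if it is not a proper multiple of a lattice vector. -/
def IsPrimitive {n : ℕ} (x : Fin n → ℤ) : Prop :=
  ∀ (k : ℤ) (y : Fin n → ℤ), x = k • y → IsUnit k

/-- The cone in `N_ℝ` generated by `a¹, …, aʳ ∈ N`. -/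
def genCone {n r : ℕ} (a : Fin r → Fin n → ℤ) : Set (Fin n → ℝ) :=
  {x | ∃ μ : Fin r → ℝ, (∀ j, 0 ≤ μ j) ∧ x = ∑ j, μ j • toR (a j)}

/-- The slice `σ ∩ [R = 1]`. -/
def slice {n : ℕ} (σ : Set (Fin n → ℝ)) (R : Fin n → ℤ) : Set (Fin n → ℝ) :=
  {x ∈ σ | pair x R = 1}

/-- `F` is a compact edge of `Q`: a face which is a segment of positive length. -/
def IsCompactEdge {n : ℕ} (Q F : Set (Fin n → ℝ)) : Prop :=
  IsExposed ℝ Q F ∧ ∃ u v, u ≠ v ∧ F = segment ℝ u v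

/-- `F` is a compact two-dimensional face of `Q`. -/
def IsCompactTwoFace {n : ℕ} (Q F : Set (Fin n → ℝ)) : Prop :=
  IsExposed ℝ Q F ∧ F.Nonempty ∧ IsCompact F ∧ Module.finrank ℝ (vectorSpan ℝ F) = 2

/-- The data: a rational polyhedral cone `σ ⊆ ℝⁿ` with fundamental generators `a¹, …, aʳ`
whose two-dimensional faces are smooth, a primitive `R ∈ σ^∨ ∩ M`, a fundamental generator
of height one (a lattice vertex of `Q = σ ∩ [R = 1]`, taken as the origin), and the compact
edges `d¹, …, d^N` of `Q`, each with an orientation (from `src i` to `tgt i`). -/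
structure Setting (n r N : ℕ) where
  /-- the fundamental generators of `σ` -/
  a : Fin r → Fin n → ℤ
  a_injective : Function.Injective a
  a_primitive : ∀ j, IsPrimitive (a j)
  /-- each `aʲ` spans a one-dimensional face of `σ` (in particular, `σ` is pointed) -/
  a_ray : ∀ j, IsExposed ℝ (genCone a) (genCone ![a j])
  /-- the two-dimensional faces of `σ` are smooth -/
  smooth : ∀ j k, j ≠ k → IsExposed ℝ (genCone a) (genCone ![a j, a k]) →
    ∃ (b : Module.Basis (Fin n) ℤ (Fin n → ℤ)) (p q : Fin n), b p = a j ∧ b q = a k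
  /-- the degree -/
  R : Fin n → ℤ
  R_nonneg : ∀ x ∈ genCone a, 0 ≤ pair x R
  R_primitive : IsPrimitive R
  /-- index of the lattice vertex of `Q` that serves as origin -/
  origin : Fin r
  origin_height : pair (toR (a origin)) R = 1
  /-- starting point of the `i`-th compact edge -/
  src : Fin N → Fin n → ℝ
  /-- end point of the `i`-th compact edge -/
  tgt : Fin N → Fin n → ℝ
  src_ne_tgt : ∀ i, src i ≠ tgt i
  edge_injective : Function.Injective fun i => segment ℝ (src i) (tgt i)
  edge_iff : ∀ F, IsCompactEdge (slice (genCone a) R) F ↔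
    ∃ i, F = segment ℝ (src i) (tgt i)

namespace Setting

variable {n r N : ℕ} (D : Setting n r N)

/-- The cone `σ`. -/
def sigma : Set (Fin n → ℝ) := genCone D.a

/-- The polyhedron `Q = σ ∩ [R = 1]`. -/
def Q : Set (Fin n → ℝ) := slice D.sigma D.R

/-- The tail cone `Q^∞ = σ ∩ [R = 0]`. -/
def tail : Set (Fin n → ℝ) := {x ∈ D.sigma | pair x D.R = 0}

/-- The lattice vertex of `Q` chosen as origin of the affine space `𝔸 = [R = 1]`. The
vector space `𝔸` obtained in this way is identified with `[R = 0]` by `v ↦ v - o`. -/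
def o : Fin n → ℝ := toR (D.a D.origin)

/-- A point is a lattice point. -/
def IsLattice (v : Fin n → ℝ) : Prop := ∃ x : Fin n → ℤ, v = toR x

/-- The compact edge `dⁱ` as a vector. -/
def d (i : Fin N) : Fin n → ℝ := D.tgt i - D.src i

/-- The compact edge `dⁱ` as a face of `Q`. -/
def edge (i : Fin N) : Set (Fin n → ℝ) := segment ℝ (D.src i) (D.tgt i)

/-- `v` is an end point of the `i`-th compact edge. -/
def IsEnd (i : Fin N) (v : Fin n → ℝ) : Prop := v = D.src i ∨ v = D.tgt i

/-- `dⁱ` and `dʲ` contain a common non-lattice vertex of `Q`. -/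
def ShareNonLattice (i j : Fin N) : Prop :=
  ∃ v, D.IsEnd i v ∧ D.IsEnd j v ∧ ¬ IsLattice v

open Classical in
/-- `ε` is a sign vector of the compact 2-face `F`: `ε_i = ± 1` if `dⁱ` is an edge of `F`,
`ε_i = 0` otherwise, and the oriented edges `ε_i dⁱ` fit into a cycle along the boundary
of `F`, i.e. at every point as many of them end as start. -/
def IsSignVector (F : Set (Fin n → ℝ)) (ε : Fin N → ℤ) : Prop :=
  IsCompactTwoFace D.Q F ∧
  (∀ i, D.edge i ⊆ F → ε i = 1 ∨ ε i = -1) ∧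
  (∀ i, ¬ D.edge i ⊆ F → ε i = 0) ∧
  ∀ v, ∑ i, ε i * ((if D.tgt i = v then 1 else 0) - (if D.src i = v then 1 else 0)) = 0

/-- The vector space `V = V(Q) ⊆ ℝ^N`. -/
def V : Submodule ℝ (Fin N → ℝ) where
  carrier := {t | (∀ F ε, D.IsSignVector F ε → ∑ i, (t i * (ε i : ℝ)) • D.d i = 0) ∧
    ∀ i j, D.ShareNonLattice i j → t i = t j}
  zero_mem' := by simp
  add_mem' := by
    rintro s t ⟨hs, hs'⟩ ⟨ht, ht'⟩
    refine ⟨fun F ε h => ?_, fun i j h => ?_⟩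
    · have := congrArg₂ (· + ·) (hs F ε h) (ht F ε h)
      simpa [add_mul, add_smul, Finset.sum_add_distrib] using this
    · simp [hs' i j h, ht' i j h]
  smul_mem' := by
    rintro x t ⟨ht, ht'⟩
    refine ⟨fun F ε h => ?_, fun i j h => ?_⟩
    · have := congrArg (x • ·) (ht F ε h)
      simpa [Finset.smul_sum, smul_smul, mul_assoc] using this
    · simp [ht' i j h]

/-- The cone `C(Q) = V ∩ ℝ^N_{≥ 0}`. -/
def C : Set D.V := {t | ∀ i, 0 ≤ t.1 i}

/-- The lattice `V_ℤ^* ⊆ V^*` dual to `V_ℤ = V ∩ ℤ^N`. -/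
def VZdual : AddSubgroup (Module.Dual ℝ D.V) where
  carrier := {η | ∀ t : D.V, (∃ z : Fin N → ℤ, ∀ i, t.1 i = (z i : ℝ)) →
    ∃ k : ℤ, η t = (k : ℝ)}
  zero_mem' := fun _ _ => ⟨0, by simp⟩
  add_mem' := by
    intro η θ h h' t ht
    obtain ⟨k, hk⟩ := h t ht
    obtain ⟨l, hl⟩ := h' t ht
    exact ⟨k + l, by simp [hk, hl]⟩
  neg_mem' := by
    intro η h t ht
    obtain ⟨k, hk⟩ := h t ht
    exact ⟨-k, by simp [hk]⟩

/-- The dual cone `C(Q)^∨ ⊆ V^*`. -/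
def Cdual : AddSubmonoid (Module.Dual ℝ D.V) where
  carrier := {η | ∀ t ∈ D.C, 0 ≤ η t}
  zero_mem' := by simp
  add_mem' := by
    intro η θ h h' t ht
    simpa using add_nonneg (h t ht) (h' t ht)

/-- The `i`-th coordinate function `t_i`, as an element of `V^*`. -/
def coord (i : Fin N) : Module.Dual ℝ D.V := (LinearMap.proj i).comp D.V.subtype

/-- The semigroup `C(Q)^∨ ∩ V_ℤ^*`. -/
def monS : AddSubmonoid (Module.Dual ℝ D.V) := D.Cdual ⊓ D.VZdual.toAddSubmonoid

/-- `D.Walk v lam`: there is a walk from the origin `o` to `v` along compact edges of `Q`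
that passes through the edge `dⁱ` altogether `lam i` times (counted with direction). -/
inductive Walk : (Fin n → ℝ) → (Fin N → ℤ) → Prop
  | nil : Walk D.o 0
  | forward (i : Fin N) (lam : Fin N → ℤ) : Walk (D.src i) lam →
      Walk (D.tgt i) (lam + Pi.single i 1)
  | backward (i : Fin N) (lam : Fin N → ℤ) : Walk (D.tgt i) lam →
      Walk (D.src i) (lam - Pi.single i 1)

/-- The set of the vertices `v_t = ∑ t_i λ_i dⁱ` (`v` a vertex of `Q`, `λ` a walk from the
origin to `v`), as points of the vector space `[R = 0]`. -/
def vertexSet (t : D.V) : Set (Fin n → ℝ) :=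
  {x | ∃ v lam, v ∈ D.Q.extremePoints ℝ ∧ D.Walk v lam ∧
    x = ∑ i, (t.1 i * (lam i : ℝ)) • D.d i}

/-- The Minkowski summand `Q_t = conv {v_t} + Q^∞`. -/
def Qt (t : D.V) : Set (Fin n → ℝ) :=
  {x | ∃ y ∈ convexHull ℝ (D.vertexSet t), ∃ z ∈ D.tail, x = y + z}

/-- The tautological cone `C̃(Q) ⊆ 𝔸 × V`. -/
def Ctilde : Set ((Fin n → ℝ) × D.V) := {p | p.2 ∈ D.C ∧ p.1 ∈ D.Qt p.2}

/-- The lattice `𝕃^*` dual to `𝕃 = 𝔸 ∩ N` (with origin `o`). As `N = (N ∩ [R = 0]) ⊕ ℤ o`,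
it is identified with the set of those `c ∈ M` that vanish on `o`, and `M = 𝕃^* ⊕ ℤ R`:
the pair `[c, k]` is the element `c + k R` of `M`. -/
def Lstar : AddSubgroup (Fin n → ℤ) where
  carrier := {c | pair D.o c = 0}
  zero_mem' := by simp [pair]
  add_mem' := by
    intro c c' h h'
    have := congrArg₂ (· + ·) h h'
    simpa [pair, mul_add, Finset.sum_add_distrib] using this
  neg_mem' := by
    intro c h
    simpa [pair] using h

/-- `(Q^∞)^∨ ∩ 𝕃^*`. -/
def dualTail : AddSubmonoid (Fin n → ℤ) where
  carrier := {c | c ∈ D.Lstar ∧ ∀ x ∈ D.tail, 0 ≤ pair x c}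
  zero_mem' := ⟨D.Lstar.zero_mem, by simp [pair]⟩
  add_mem' := by
    rintro c c' ⟨h, h'⟩ ⟨k, k'⟩
    refine ⟨D.Lstar.add_mem h k, fun x hx => ?_⟩
    have := add_nonneg (h' x hx) (k' x hx)
    simpa [pair, mul_add, Finset.sum_add_distrib] using this

/-- `M̃ ∩ C̃(Q)^∨` with `M̃ = 𝕃^* × V_ℤ^*`. -/
def monX : AddSubmonoid ((Fin n → ℤ) × Module.Dual ℝ D.V) where
  carrier := {p | p.1 ∈ D.Lstar ∧ p.2 ∈ D.VZdual ∧
    ∀ q ∈ D.Ctilde, 0 ≤ pair q.1 p.1 + p.2 q.2}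
  zero_mem' := ⟨D.Lstar.zero_mem, D.VZdual.zero_mem, by simp [pair]⟩
  add_mem' := by
    rintro p p' ⟨h1, h2, h3⟩ ⟨k1, k2, k3⟩
    refine ⟨D.Lstar.add_mem h1 k1, D.VZdual.add_mem h2 k2, fun q hq => ?_⟩
    have := add_nonneg (h3 q hq) (k3 q hq)
    have e : pair q.1 (p + p').1 = pair q.1 p.1 + pair q.1 p'.1 := by
      simp [pair, mul_add, Finset.sum_add_distrib]
    have e' : (p + p').2 q.2 = p.2 q.2 + p'.2 q.2 := by simp
    rw [e, e']
    linarith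

/-- `σ^∨ ∩ M`. -/
def monY : AddSubmonoid (Fin n → ℤ) where
  carrier := {m | ∀ x ∈ D.sigma, 0 ≤ pair x m}
  zero_mem' := by simp [pair]
  add_mem' := by
    intro c c' h h' x hx
    have := add_nonneg (h x hx) (h' x hx)
    simpa [pair, mul_add, Finset.sum_add_distrib] using this

/-- `η₀(c) = - min ⟨Q, c⟩`. -/
def eta0 (c : Fin n → ℤ) : ℝ := - sInf ((fun x => pair x c) '' D.Q)

/-- `η₀^*(c) = ⌈η₀(c)⌉`. -/
def eta0Star (c : Fin n → ℤ) : ℤ := ⌈D.eta0 c⌉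

/-- `v` is a possible choice of `v(c)`: a vertex of `Q` in which `c` is minimal on `Q`. -/
def IsMinVertex (c : Fin n → ℤ) (v : Fin n → ℝ) : Prop :=
  v ∈ D.Q.extremePoints ℝ ∧ ∀ x ∈ D.Q, pair v c ≤ pair x c

/-- The functional `η(c) = [-λ_1 ⟨d¹, c⟩, …, -λ_N ⟨d^N, c⟩] ∈ V^*` computed from the
walk `lam`. -/
def etaOf (c : Fin n → ℤ) (lam : Fin N → ℤ) : Module.Dual ℝ D.V :=
  ∑ i, (-((lam i : ℝ) * pair (D.d i) c)) • D.coord i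

/-- `η` is the element `η^*(c) = η(c) + (η₀^*(c) - η₀(c)) e[v(c)]` of `V^*`, for some choice
of `v(c)`, of a walk from the origin to `v(c)` and, if `v(c)` is not a lattice point, of a
compact edge containing `v(c)`. -/
def IsEtaStar (c : Fin n → ℤ) (η : Module.Dual ℝ D.V) : Prop :=
  ∃ v lam, D.IsMinVertex c v ∧ D.Walk v lam ∧
    ((IsLattice v ∧ η = D.etaOf c lam) ∨
     (¬ IsLattice v ∧ ∃ i, D.IsEnd i v ∧
       η = D.etaOf c lam + ((D.eta0Star c : ℝ) - D.eta0 c) • D.coord i))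

/-- The semigroup `Γ` of all `[c, η] ∈ ((Q^∞)^∨ ∩ 𝕃^*) × V_ℤ^*` with
`η - η^*(c) ∈ C(Q)^∨`. -/
def Gamma : AddSubmonoid ((Fin n → ℤ) × Module.Dual ℝ D.V) :=
  AddSubmonoid.closure {p | p.1 ∈ D.dualTail ∧ p.2 ∈ D.VZdual ∧
    ∃ η, D.IsEtaStar p.1 η ∧ p.2 - η ∈ D.Cdual}

/-- `R, c¹ + η₀^*(c¹) R, …, c^w + η₀^*(c^w) R` is a generating set of `σ^∨ ∩ M`. -/
structure IsGenerating {w : ℕ} (c : Fin w → Fin n → ℤ) : Prop where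
  mem : ∀ ν, c ν ∈ D.dualTail
  closure_eq : AddSubmonoid.closure
    (insert D.R (Set.range fun ν => c ν + D.eta0Star (c ν) • D.R)) = D.monY

/-! ### Membership facts needed for the maps -/

lemma coord_mem_monS (i : Fin N) : D.coord i ∈ D.monS := by
  refine ⟨fun t ht => ?_, fun t ht => ?_⟩
  · exact ht i
  · obtain ⟨z, hz⟩ := ht
    exact ⟨z i, hz i⟩

lemma o_mem_Q : D.o ∈ D.Q := by
  refine ⟨⟨Pi.single D.origin 1, fun j => ?_, ?_⟩, D.origin_height⟩
  · by_cases h : j = D.origin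
    · subst h; simp
    · simp [h]
  · rw [Finset.sum_eq_single D.origin]
    · simp [o]
    · intro b _ hb; simp [hb]
    · simp

/-- Elements of `C(Q)^∨ ∩ V_ℤ^*` embed as `[0, η]` into `C̃(Q)^∨ ∩ M̃`. -/
lemma zero_mem_monX {η : Module.Dual ℝ D.V} (h : η ∈ D.monS) :
    ((0, η) : (Fin n → ℤ) × Module.Dual ℝ D.V) ∈ D.monX :=
  ⟨D.Lstar.zero_mem, h.2, fun q hq => by simpa [pair] using h.1 q.2 hq.1⟩

lemma R_mem_monY : D.R ∈ D.monY := D.R_nonneg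

lemma o_extreme : D.o ∈ D.Q.extremePoints ℝ := by
  refine ⟨D.o_mem_Q, fun x hx y hy h => ?_⟩
  have hmem : D.o ∈ genCone ![D.a D.origin] :=
    ⟨fun _ => 1, fun _ => zero_le_one, by simp [o]⟩
  have hx' := (D.a_ray D.origin).isExtreme.left_mem_of_mem_openSegment hx.1 hy.1 hmem h
  obtain ⟨μ, -, e⟩ := hx'
  have e2 : x = μ 0 • D.o := by simpa [o] using e
  have e3 : pair (μ 0 • D.o) D.R = μ 0 * pair D.o D.R := by
    simp [pair, Finset.mul_sum, mul_assoc]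
  have h1 : pair x D.R = 1 := hx.2
  have h2 : pair D.o D.R = 1 := D.origin_height
  rw [e2, e3, h2, mul_one] at h1
  rw [e2, h1, one_smul]

lemma isEtaStar_zero : D.IsEtaStar 0 0 :=
  ⟨D.o, 0, ⟨D.o_extreme, fun x _ => by simp [pair]⟩, Walk.nil,
    Or.inl ⟨⟨_, rfl⟩, by simp [etaOf]⟩⟩

/-- Elements of `C(Q)^∨ ∩ V_ℤ^*` embed as `[0, η]` into `Γ`. -/
lemma zero_mem_Gamma {η : Module.Dual ℝ D.V} (h : η ∈ D.monS) :
    ((0, η) : (Fin n → ℤ) × Module.Dual ℝ D.V) ∈ D.Gamma :=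
  AddSubmonoid.subset_closure
    ⟨D.dualTail.zero_mem, h.2, 0, D.isEtaStar_zero, by simpa using h.1⟩

variable {w : ℕ} {c : Fin w → Fin n → ℤ}

lemma mem_Gamma (hc : D.IsGenerating c) {η : Fin w → Module.Dual ℝ D.V}
    (hη : ∀ ν, D.IsEtaStar (c ν) (η ν)) (hX : ∀ ν, (c ν, η ν) ∈ D.monX) (ν : Fin w) :
    (c ν, η ν) ∈ D.Gamma :=
  AddSubmonoid.subset_closure
    ⟨hc.mem ν, (hX ν).2.1, η ν, hη ν, by simp⟩

lemma mem_monY (hc : D.IsGenerating c) (ν : Fin w) :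
    c ν + D.eta0Star (c ν) • D.R ∈ D.monY := by
  rw [← hc.closure_eq]
  exact AddSubmonoid.subset_closure (Or.inr ⟨ν, rfl⟩)

/-! ### The toric schemes and the maps between them -/

/-- The spectrum of the semigroup algebra `ℂ[P]`. -/
def toricSpec {G : Type} [AddCommMonoid G] (P : AddSubmonoid G) : Scheme.{0} :=
  Spec (CommRingCat.of (AddMonoidAlgebra ℂ P))

/-- The monomial `x^p` in the semigroup algebra `ℂ[P]`. -/
def mono {G : Type} [AddCommMonoid G] (P : AddSubmonoid G) (p : G) (h : p ∈ P) :
    AddMonoidAlgebra ℂ P := AddMonoidAlgebra.single ⟨p, h⟩ 1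

/-- The affine space over `ℂ` with coordinates indexed by `ι`. -/
def affineSpace (ι : Type) : Scheme.{0} := Spec (CommRingCat.of (MvPolynomial ι ℂ))

/-- The morphism `Spec A ⟶ ℂ^ι` with the given coordinate functions. -/
def toAffine {ι A : Type} [CommRing A] [Algebra ℂ A] (f : ι → A) :
    Spec (CommRingCat.of A) ⟶ affineSpace ι :=
  Spec.map (CommRingCat.ofHom (MvPolynomial.aeval f : MvPolynomial ι ℂ →ₐ[ℂ] A).toRingHom)

/-- The toric variety `Y` of the cone `σ`. -/
def Y : Scheme.{0} := toricSpec D.monY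

/-- The toric variety `X` of the cone `C̃(Q)`. -/
def X : Scheme.{0} := toricSpec D.monX

/-- The toric variety `S` of the cone `C(Q)`. -/
def S : Scheme.{0} := toricSpec D.monS

/-- `X' = Spec ℂ[Γ]`. -/
def X' : Scheme.{0} := toricSpec D.Gamma

/-- The map `S ⟶ ℂ^N`. -/
def mapS : D.S ⟶ affineSpace (Fin N) :=
  toAffine fun i => mono D.monS (D.coord i) (D.coord_mem_monS i)

/-- The map `X ⟶ ℂ^w × ℂ^N`; its coordinates are the monomials with exponents
`[c^ν, η^*(c^ν)]` and `[0, t_i]`. -/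
def mapX (c : Fin w → Fin n → ℤ) (η : Fin w → Module.Dual ℝ D.V)
    (hX : ∀ ν, (c ν, η ν) ∈ D.monX) : D.X ⟶ affineSpace (Fin w ⊕ Fin N) :=
  toAffine (Sum.elim (fun ν => mono D.monX (c ν, η ν) (hX ν))
    (fun i => mono D.monX (0, D.coord i) (D.zero_mem_monX (D.coord_mem_monS i))))

/-- The map `X' ⟶ ℂ^w × ℂ^N` given by the same monomials. -/
def mapX' (c : Fin w → Fin n → ℤ) (η : Fin w → Module.Dual ℝ D.V)
    (hΓ : ∀ ν, (c ν, η ν) ∈ D.Gamma) : D.X' ⟶ affineSpace (Fin w ⊕ Fin N) :=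
  toAffine (Sum.elim (fun ν => mono D.Gamma (c ν, η ν) (hΓ ν))
    (fun i => mono D.Gamma (0, D.coord i) (D.zero_mem_Gamma (D.coord_mem_monS i))))

/-- The closed embedding `Y ⟶ ℂ^w × ℂ ⟶ ℂ^w × ℂ^N`, where `ℂ ⟶ ℂ^N` is the diagonal: the
coordinates are the monomials with exponents `[c^ν, η₀^*(c^ν)]` and `[0, 1] = R`. -/
def mapY (c : Fin w → Fin n → ℤ) (hc : D.IsGenerating c) :
    D.Y ⟶ affineSpace (Fin w ⊕ Fin N) :=
  toAffine (Sum.elim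
    (fun ν => mono D.monY (c ν + D.eta0Star (c ν) • D.R) (D.mem_monY hc ν))
    (fun _ => mono D.monY D.R D.R_mem_monY))

/-- The projection `ℂ^w × ℂ^N ⟶ ℂ^N`. -/
def proj (w N : ℕ) : affineSpace (Fin w ⊕ Fin N) ⟶ affineSpace (Fin N) :=
  toAffine fun i => MvPolynomial.X (Sum.inr i)

/-- The semigroup homomorphism `C(Q)^∨ ∩ V_ℤ^* → Γ`, `η ↦ [0, η]`. -/
def inclGamma : D.monS →+ D.Gamma where
  toFun η := ⟨(0, η.1), D.zero_mem_Gamma η.2⟩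
  map_zero' := rfl
  map_add' η θ := by ext <;> simp

/-- The projection `π : X' ⟶ S`. -/
def piMap : D.X' ⟶ D.S :=
  Spec.map (CommRingCat.ofHom (AddMonoidAlgebra.mapDomainRingHom ℂ D.inclGamma))

/-- The structure morphism `Y ⟶ Spec ℂ`. -/
def Ystr : D.Y ⟶ Spec (CommRingCat.of ℂ) :=
  Spec.map (CommRingCat.ofHom (algebraMap ℂ (AddMonoidAlgebra ℂ D.monY)))

/-- The ideal `𝒥 ⊆ ℂ[t_1, …, t_N]` generated by the coordinates of the vector valued
polynomials `g_{ε,k} = ∑ t_i^k ε_i dⁱ` (`k ≥ 1`) and by the differences `t_i - t_j` for all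
`dⁱ, dʲ` with a common non-lattice vertex. -/
def J : Ideal (MvPolynomial (Fin N) ℂ) :=
  Ideal.span
    ({g | ∃ F ε, D.IsSignVector F ε ∧ ∃ (k : ℕ) (m : Fin n), 1 ≤ k ∧
        g = ∑ i, MvPolynomial.C (((ε i : ℝ) * D.d i m : ℝ) : ℂ) * MvPolynomial.X i ^ k} ∪
     {g | ∃ i j, D.ShareNonLattice i j ∧ g = MvPolynomial.X i - MvPolynomial.X j})

/-- The subring `ℂ[t_i - t_j] ⊆ ℂ[t_1, …, t_N]` of regular functions on
`ℂ^N / ℂ (1, …, 1)`. -/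
def diffRing (N : ℕ) : Subalgebra ℂ (MvPolynomial (Fin N) ℂ) :=
  Algebra.adjoin ℂ {g | ∃ i j : Fin N, g = MvPolynomial.X i - MvPolynomial.X j}

/-- The ideal `𝒥 ∩ ℂ[t_i - t_j]`. -/
def Jbar : Ideal (diffRing N) := D.J.comap (diffRing N).val

/-- The closed subscheme `ℳ ⊆ ℂ^N` defined by `𝒥`. -/
def M : Scheme.{0} := Spec (CommRingCat.of (MvPolynomial (Fin N) ℂ ⧸ D.J))

/-- The inclusion `ℳ ⟶ ℂ^N`. -/
def mapM : D.M ⟶ affineSpace (Fin N) :=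
  Spec.map (CommRingCat.ofHom (Ideal.Quotient.mk D.J))

/-- The closed subscheme `ℳ̄ ⊆ ℂ^N / ℂ (1, …, 1)` defined by `𝒥 ∩ ℂ[t_i - t_j]`. -/
def Mbar : Scheme.{0} := Spec (CommRingCat.of (diffRing N ⧸ D.Jbar))

/-- The projection `ℓ : ℳ ⟶ ℳ̄`. -/
def ell : D.M ⟶ D.Mbar :=
  Spec.map (CommRingCat.ofHom
    (Ideal.quotientMap D.J (diffRing N).val.toRingHom (le_refl D.Jbar)))

/-- Evaluation of polynomials in the origin of `ℂ^N`. -/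
def evalZero (N : ℕ) : MvPolynomial (Fin N) ℂ →+* ℂ :=
  MvPolynomial.eval fun _ => 0

lemma evalZero_J {g : MvPolynomial (Fin N) ℂ} (hg : g ∈ D.J) : evalZero N g = 0 := by
  have : D.J ≤ RingHom.ker (evalZero N) := by
    refine Ideal.span_le.2 ?_
    rintro g (⟨F, ε, -, k, m, hk, rfl⟩ | ⟨i, j, -, rfl⟩)
    · have : k ≠ 0 := by omega
      simp [evalZero, RingHom.mem_ker, this]
    · simp [evalZero, RingHom.mem_ker]
  exact this hg

/-- The point `0 ∈ ℳ̄`, as a morphism `Spec ℂ ⟶ ℳ̄`. -/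
def zeroMap : Spec (CommRingCat.of ℂ) ⟶ D.Mbar :=
  Spec.map (CommRingCat.ofHom
    (Ideal.Quotient.lift D.Jbar ((evalZero N).comp (diffRing N).val.toRingHom)
      fun _ hg => D.evalZero_J hg))

/-- The point `0 ∈ ℳ̄`. -/
def zeroPoint : D.Mbar := D.zeroMap (IsLocalRing.closedPoint ℂ)

end Setting

end ToricFlat

end

/-! Let A_S (`AS`) be the semigroup generated by the coordinate functions t_i in V_ℤ^*, and let A_X
(`AX`) consist of all [c, η] with c ∈ 𝕃^* ∩ (Q^∞)^∨ and η - η^*(c) ∈ A_S. Their algebras are the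
coordinate rings of S̄ and X̄. Every element of A_X is uniquely [c, η^*(c)] + [0, τ] with τ ∈ A_S; Γ
decomposes in the same way with C(Q)^∨ ∩ V_ℤ^* in place of A_S, and σ^∨ ∩ M with [c, η₀^*(c)] and
ℕR. So ℂ[A_X] is free over ℂ[A_S] on a basis indexed by c, which is carried to bases of ℂ[Γ] and
ℂ[σ^∨ ∩ M] (`isPushout_semigroup`). Hence X̄ → S̄ is flat, its pullback to S is X', and its
restriction to the diagonal line is Y.

The combinatorial heart is η^*. That v_t does not depend on the walk means that the cochain t_i dⁱ,
which is closed on compact 2-faces, is a coboundary; this is proved by sweeping the vertices with a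
generic functional (`exists_potential`, `exists_vertex_map`). Define a candidate for η^*(c) at every
vertex. Along an edge dⁱ it changes by an integral multiple of t_i (`etaAt_edge`), and along a path
on which c descends by a nonnegative one, so the value at a minimal vertex exceeds every other value
by an element of A_S (`etaAt_min_sub_mem`). As A_S is pointed, the value at a minimal vertex is
unique. Integrality, the subadditivity of η^* modulo A_S and membership in the dual of C̃(Q) follow
as well. Evaluation at (1, …, 1) turns η^*(c) into η₀^*(c), which lifts generation of σ^∨ ∩ M to
generation of A_X (`AX_eq_closure`).

For normality, the semigroups of S and X are cut out by half spaces in lattices, so their algebras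
are integrally closed. The lattice V ∩ ℤ^N is saturated, so A_S generates V_ℤ^* as a group; by
Farkas' lemma over ℚ each element of the semigroup of S has a multiple in A_S. Rounding errors
disappear for suitable multiples of c, which gives the same for X and A_X. Thus both maps to the
images are integral and birational.

For ℳ ⊆ S̄, two words in the t_i with the same class in A_S differ by a linear relation on V. The
ideal 𝒥 contains the power sums of all degrees of such a relation, so by Newton's identities the two
monomials agree modulo 𝒥 (`prod_pow_eq`). Finally the power sum equations are invariant under
translation by (1, …, 1). Hence the coordinate ring of ℳ is a polynomial ring in one variable over
that of ℳ̄, and ℓ is flat with the diagonal line as fiber over 0. -/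

noncomputable section

namespace ToricFlat

/-! ### Semigroup algebras -/

/-! ### Nonnegative combinations of functionals -/

section Farkas

/-- Farkas' lemma over an ordered field. -/
lemma farkas {k W : Type*} [Field k] [LinearOrder k] [IsStrictOrderedRing k] [AddCommGroup W]
    [Module k W] : ∀ (m : ℕ) (x : Fin m → Module.Dual k W) (η : Module.Dual k W),
      (∀ w, (∀ i, 0 ≤ x i w) → 0 ≤ η w) → ∃ μ : Fin m → k, (∀ i, 0 ≤ μ i) ∧ η = ∑ i, μ i • x i := by
  intro m
  induction m with
  | zero =>
    intro x η h
    refine ⟨0, fun i => i.elim0, ?_⟩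
    ext w
    have h1 := h w (fun i => i.elim0)
    have h2 := h (-w) (fun i => i.elim0)
    simp only [map_neg] at h2
    simp only [Finset.univ_eq_empty, Finset.sum_empty, LinearMap.zero_apply]
    linarith
  | succ m ih =>
    intro x η h
    by_cases hc : ∀ w, (∀ i : Fin m, 0 ≤ x i.castSucc w) → 0 ≤ η w
    · obtain ⟨μ, hμ, e⟩ := ih _ η hc
      refine ⟨Fin.snoc μ 0, fun i => ?_, ?_⟩
      · refine Fin.lastCases ?_ (fun j => ?_) i <;> simp [hμ]
      · simp [Fin.sum_univ_castSucc, e]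
    · push Not at hc
      obtain ⟨w₀, hw₀, hη⟩ := hc
      have hlast : x (Fin.last m) w₀ < 0 := by
        by_contra hcon
        push Not at hcon
        have := h w₀ (fun i => Fin.lastCases hcon hw₀ i)
        linarith
      obtain ⟨w, hw, hηw, hl⟩ : ∃ w, (∀ i : Fin m, 0 ≤ x i.castSucc w) ∧ η w < 0 ∧
          x (Fin.last m) w = -1 := by
        refine ⟨(-x (Fin.last m) w₀)⁻¹ • w₀, fun i => ?_, ?_, ?_⟩
        · simp only [map_smul, smul_eq_mul]
          exact mul_nonneg (inv_nonneg.2 (by linarith)) (hw₀ i)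
        · simp only [map_smul, smul_eq_mul]
          exact mul_neg_of_pos_of_neg (inv_pos.2 (by linarith)) hη
        · simp only [map_smul, smul_eq_mul]
          field_simp [hlast.ne]
      -- Since the last functional is -1 at `w`, the map `u ↦ u + x (Fin.last m) u • w` projects
      -- onto its kernel. The induction hypothesis is applied to the pullbacks of the other
      -- functionals and of `η` along this projection.
      obtain ⟨μ, hμ, e⟩ := ih (fun i => x i.castSucc + x i.castSucc w • x (Fin.last m))
        (η + η w • x (Fin.last m)) (fun u hu => by
          have := h (u + x (Fin.last m) u • w) (fun i => by
            refine Fin.lastCases ?_ (fun j => ?_) i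
            · simp [hl]
            · have := hu j
              simp only [LinearMap.add_apply, LinearMap.smul_apply, smul_eq_mul, map_add,
                map_smul] at this ⊢
              linarith)
          simp only [LinearMap.add_apply, LinearMap.smul_apply, smul_eq_mul, map_add,
                map_smul] at this ⊢
          linarith)
      refine ⟨Fin.snoc μ (∑ i, μ i * x i.castSucc w - η w), fun i => ?_, ?_⟩
      · refine Fin.lastCases ?_ (fun j => ?_) i
        · have : 0 ≤ ∑ i, μ i * x i.castSucc w :=
            Finset.sum_nonneg fun i _ => mul_nonneg (hμ i) (hw i)
          simp only [Fin.snoc_last]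
          linarith
        · simp [hμ]
      · ext u
        have := LinearMap.congr_fun e u
        simp only [LinearMap.add_apply, LinearMap.smul_apply, smul_eq_mul, LinearMap.sum_apply,
          mul_add, Finset.sum_add_distrib, ← mul_assoc, ← Finset.sum_mul] at this
        simp only [LinearMap.sum_apply, Fin.sum_univ_castSucc, Fin.snoc_castSucc, Fin.snoc_last,
          LinearMap.smul_apply, smul_eq_mul, sub_mul, LinearMap.add_apply]
        linarith

end Farkas

/-! ### Free semigroup algebras and cocartesian squares -/

section Basis

/-- A commutative square of algebras is cocartesian if it maps a basis to a basis. -/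
lemma isPushout_of_basis {R S R' S' ι : Type*} [CommRing R] [CommRing S] [CommRing R']
    [CommRing S'] [Algebra R S] [Algebra R R'] [Algebra R S'] [Algebra S S'] [Algebra R' S']
    [IsScalarTower R S S'] [IsScalarTower R R' S'] (b : Module.Basis ι R R')
    (b' : Module.Basis ι S S') (h : ∀ i, b' i = algebraMap R' S' (b i)) :
    Algebra.IsPushout R S R' S' := by
  constructor
  refine IsBaseChange.of_equiv ((b.baseChange S).equiv b' (Equiv.refl ι)) fun x => ?_
  have : (((b.baseChange S).equiv b' (Equiv.refl ι)).toLinearMap.restrictScalars R) ∘ₗ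
      (TensorProduct.mk R S R' 1) = (IsScalarTower.toAlgHom R R' S').toLinearMap := by
    refine b.ext fun i => ?_
    have := (b.baseChange S).equiv_apply i b' (Equiv.refl ι)
    simp only [Module.Basis.baseChange_apply, Equiv.refl_apply] at this
    simpa [h] using this
  exact LinearMap.congr_fun this x

/-- The semigroup algebra of `P` is free over that of `T`, if every element of `P` is uniquely
of the form `e k + ι τ`. -/
lemma exists_basis_single {P T K : Type*} [AddCommMonoid P] [AddCommMonoid T] (ι : T →+ P)
    (e : K → P) (h : Function.Bijective fun x : K × T => e x.1 + ι x.2) :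
    letI := (AddMonoidAlgebra.mapDomainRingHom ℂ ι).toAlgebra
    ∃ b : Module.Basis K (AddMonoidAlgebra ℂ T) (AddMonoidAlgebra ℂ P),
      ∀ k, b k = AddMonoidAlgebra.single (e k) 1 := by
  classical
  let := (AddMonoidAlgebra.mapDomainRingHom ℂ ι).toAlgebra
  have hsmul : ∀ (x : AddMonoidAlgebra ℂ T) (y : AddMonoidAlgebra ℂ P),
      x • y = AddMonoidAlgebra.mapDomain ι x * y := fun x y => rfl
  -- By unique decomposition, the coefficient at `e k + ι τ` sees only the multiple of the `k`-th
  -- monomial, and there it recovers the coefficient at `τ`. This yields linear independence.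
  have hcoeff : ∀ (x : AddMonoidAlgebra ℂ T) (k k' : K) (τ : T), k' ≠ k →
      (x • (AddMonoidAlgebra.single (e k') 1 : AddMonoidAlgebra ℂ P)).coeff (e k + ι τ) = 0 := by
    intro x k k' τ hk
    induction x using AddMonoidAlgebra.induction_linear with
    | zero => simp
    | add x y hx hy => rw [add_smul]; simp [hx, hy]
    | single a r =>
      rw [hsmul, AddMonoidAlgebra.mapDomain_single, AddMonoidAlgebra.single_mul_single,
        AddMonoidAlgebra.coeff_single, Finsupp.single_apply, if_neg]
      intro heq
      have := @h.1 (k', a) (k, τ) (by simpa [add_comm] using heq)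
      simp [Prod.ext_iff] at this
      exact hk this.1
  have hcoeff' : ∀ (x : AddMonoidAlgebra ℂ T) (k : K) (τ : T),
      (x • (AddMonoidAlgebra.single (e k) 1 : AddMonoidAlgebra ℂ P)).coeff (e k + ι τ)
        = x.coeff τ := by
    intro x k τ
    induction x using AddMonoidAlgebra.induction_linear with
    | zero => simp
    | add x y hx hy => rw [add_smul]; simp [hx, hy]
    | single a r =>
      rw [hsmul, AddMonoidAlgebra.mapDomain_single, AddMonoidAlgebra.single_mul_single,
        AddMonoidAlgebra.coeff_single, AddMonoidAlgebra.coeff_single, Finsupp.single_apply,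
        Finsupp.single_apply, mul_one]
      congr 1
      refine propext ⟨fun heq => ?_, fun heq => by rw [heq, add_comm]⟩
      have := @h.1 (k, a) (k, τ) (by simpa [add_comm] using heq)
      simpa using this
  refine ⟨Module.Basis.mk (v := fun k => AddMonoidAlgebra.single (e k) 1) ?_ ?_, fun k => by
    rw [Module.Basis.mk_apply]⟩
  · rw [linearIndependent_iff']
    intro s g hs k hk
    ext τ
    have := congrArg (fun y : AddMonoidAlgebra ℂ P => y.coeff (e k + ι τ)) hs
    simp only [AddMonoidAlgebra.coeff_sum, Finsupp.coe_finsetSum, Finset.sum_apply] at this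
    rw [Finset.sum_eq_single k (fun k' _ hk' => hcoeff _ _ _ _ hk') (fun h' => (h' hk).elim),
      hcoeff'] at this
    simpa using this
  · intro y _
    induction y using AddMonoidAlgebra.induction_linear with
    | zero => exact Submodule.zero_mem _
    | add x y hx hy => exact Submodule.add_mem _ (hx trivial) (hy trivial)
    | single p r =>
      obtain ⟨⟨k, τ⟩, rfl⟩ := h.2 p
      have : (AddMonoidAlgebra.single (e k + ι τ) r : AddMonoidAlgebra ℂ P) =
          (AddMonoidAlgebra.single τ r : AddMonoidAlgebra ℂ T) •
            (AddMonoidAlgebra.single (e k) 1 : AddMonoidAlgebra ℂ P) := by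
        rw [hsmul, AddMonoidAlgebra.mapDomain_single, AddMonoidAlgebra.single_mul_single,
          mul_one, add_comm]
      simp only [this]
      exact Submodule.smul_mem _ _ (Submodule.subset_span ⟨k, rfl⟩)

/-- A homomorphism of semigroups `T ⟶ T'` induces a cocartesian square of semigroup algebras,
if `P` and `P'` decompose in the same way over `T` and `T'`. -/
lemma isPushout_semigroup {P T P' T' K : Type} [AddCommMonoid P] [AddCommMonoid T]
    [AddCommMonoid P'] [AddCommMonoid T'] (ι : T →+ P) (ι' : T' →+ P') (f : P →+ P') (g : T →+ T')
    (hfg : f.comp ι = ι'.comp g) (e : K → P)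
    (h : Function.Bijective fun x : K × T => e x.1 + ι x.2)
    (h' : Function.Bijective fun x : K × T' => f (e x.1) + ι' x.2) :
    IsPushout (CommRingCat.ofHom (AddMonoidAlgebra.mapDomainRingHom ℂ ι))
      (CommRingCat.ofHom (AddMonoidAlgebra.mapDomainRingHom ℂ g))
      (CommRingCat.ofHom (AddMonoidAlgebra.mapDomainRingHom ℂ f))
      (CommRingCat.ofHom (AddMonoidAlgebra.mapDomainRingHom ℂ ι')) := by
  let a1 := (AddMonoidAlgebra.mapDomainRingHom ℂ ι).toAlgebra
  let a2 := (AddMonoidAlgebra.mapDomainRingHom ℂ ι').toAlgebra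
  let a3 := (AddMonoidAlgebra.mapDomainRingHom ℂ f).toAlgebra
  let a4 := (AddMonoidAlgebra.mapDomainRingHom ℂ g).toAlgebra
  let a5 := ((AddMonoidAlgebra.mapDomainRingHom ℂ f).comp
    (AddMonoidAlgebra.mapDomainRingHom ℂ ι)).toAlgebra
  have : IsScalarTower (AddMonoidAlgebra ℂ T) (AddMonoidAlgebra ℂ P) (AddMonoidAlgebra ℂ P') :=
    IsScalarTower.of_algebraMap_eq fun x => rfl
  have hc : (AddMonoidAlgebra.mapDomainRingHom ℂ f).comp
    (AddMonoidAlgebra.mapDomainRingHom ℂ ι) = (AddMonoidAlgebra.mapDomainRingHom ℂ ι').comp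
    (AddMonoidAlgebra.mapDomainRingHom ℂ g) := by
    rw [← AddMonoidAlgebra.mapDomainRingHom_comp, ← AddMonoidAlgebra.mapDomainRingHom_comp, hfg]
  have : IsScalarTower (AddMonoidAlgebra ℂ T) (AddMonoidAlgebra ℂ T') (AddMonoidAlgebra ℂ P') :=
    IsScalarTower.of_algebraMap_eq fun x => RingHom.congr_fun hc x
  obtain ⟨b, hb⟩ := exists_basis_single ι e h
  obtain ⟨b', hb'⟩ := exists_basis_single ι' (fun k => f (e k)) h'
  have : Algebra.IsPushout (AddMonoidAlgebra ℂ T) (AddMonoidAlgebra ℂ T') (AddMonoidAlgebra ℂ P)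
      (AddMonoidAlgebra ℂ P') := isPushout_of_basis b b' fun i => by
    rw [hb, hb']
    exact (AddMonoidAlgebra.mapDomain_single ..).symm
  exact (CommRingCat.isPushout_of_isPushout (AddMonoidAlgebra ℂ T) (AddMonoidAlgebra ℂ T')
    (AddMonoidAlgebra ℂ P) (AddMonoidAlgebra ℂ P')).flip

end Basis

/-! ### Normality of semigroup algebras cut out by half spaces -/

section Normal

open scoped HahnSeries

/-- The algebra of Laurent polynomials is integrally closed. -/
lemma isIntegrallyClosed_laurent (k : ℕ) :
    IsIntegrallyClosed (AddMonoidAlgebra ℂ (Fin k →₀ ℤ)) := by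
  classical
  let j : (Fin k →₀ ℕ) →+ (Fin k →₀ ℤ) := Finsupp.mapRange.addMonoidHom (Nat.castAddMonoidHom ℤ)
  have hj : Function.Injective j := Finsupp.mapRange_injective _ (map_zero _) Nat.cast_injective
  have hjapp : ∀ a i, j a i = (a i : ℤ) := fun a i => rfl
  have : IsIntegrallyClosed (AddMonoidAlgebra ℂ (Fin k →₀ ℕ)) :=
    inferInstanceAs (IsIntegrallyClosed (MvPolynomial (Fin k) ℂ))
  have : IsDomain (AddMonoidAlgebra ℂ (Fin k →₀ ℕ)) :=
    inferInstanceAs (IsDomain (MvPolynomial (Fin k) ℂ))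
  let alg := (AddMonoidAlgebra.mapDomainRingHom ℂ j).toAlgebra
  have halg : ∀ x, algebraMap (AddMonoidAlgebra ℂ (Fin k →₀ ℕ))
      (AddMonoidAlgebra ℂ (Fin k →₀ ℤ)) x = AddMonoidAlgebra.mapDomain j x := fun x => rfl
  -- Laurent polynomials are the localization of the polynomial ring at the monomials, and
  -- localization preserves normality.
  let S : Submonoid (AddMonoidAlgebra ℂ (Fin k →₀ ℕ)) :=
    MonoidHom.mrange (AddMonoidAlgebra.of ℂ (Fin k →₀ ℕ))
  have hS : S ≤ nonZeroDivisors _ := by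
    rintro _ ⟨a, rfl⟩
    refine mem_nonZeroDivisors_of_ne_zero ?_
    simp [AddMonoidAlgebra.of_apply]
  have hinj := AddMonoidAlgebra.mapDomain_injective (R := ℂ) hj
  have : IsLocalization S (AddMonoidAlgebra ℂ (Fin k →₀ ℤ)) := by
    refine ⟨?_, ?_, ?_⟩
    · rintro ⟨_, ⟨a, rfl⟩⟩
      change IsUnit (algebraMap _ _ (AddMonoidAlgebra.of ℂ (Fin k →₀ ℕ) a))
      rw [halg, AddMonoidAlgebra.of_apply, AddMonoidAlgebra.mapDomain_single]
      refine IsUnit.of_mul_eq_one (AddMonoidAlgebra.single (-j a.toAdd) 1) ?_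
      rw [AddMonoidAlgebra.single_mul_single, add_neg_cancel, mul_one]
      rfl
    · intro z
      suffices ∃ (a : Fin k →₀ ℕ) (y : AddMonoidAlgebra ℂ (Fin k →₀ ℕ)),
          z * AddMonoidAlgebra.single (j a) (1 : ℂ) = AddMonoidAlgebra.mapDomain j y by
        obtain ⟨a, y, h⟩ := this
        refine ⟨⟨y, ⟨_, ⟨Multiplicative.ofAdd a, rfl⟩⟩⟩, ?_⟩
        change z * AddMonoidAlgebra.mapDomain j (AddMonoidAlgebra.single a 1) = _
        rw [AddMonoidAlgebra.mapDomain_single]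
        exact h
      induction z using AddMonoidAlgebra.induction_linear with
      | zero => exact ⟨0, 0, by rw [zero_mul, AddMonoidAlgebra.mapDomain_zero]⟩
      | add z z' hz hz' =>
        obtain ⟨a, y, h⟩ := hz
        obtain ⟨a', y', h'⟩ := hz'
        refine ⟨a + a', y * AddMonoidAlgebra.single a' 1 + y' * AddMonoidAlgebra.single a 1, ?_⟩
        have e1 : (AddMonoidAlgebra.single (j (a + a')) 1 : AddMonoidAlgebra ℂ (Fin k →₀ ℤ)) =
            AddMonoidAlgebra.single (j a) 1 * AddMonoidAlgebra.single (j a') 1 := by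
          rw [AddMonoidAlgebra.single_mul_single, map_add, mul_one]
        rw [e1, ← halg, map_add, map_mul, map_mul, halg, halg, halg, halg, ← h, ← h',
          AddMonoidAlgebra.mapDomain_single, AddMonoidAlgebra.mapDomain_single]
        ring
      | single p r =>
        -- Multiplication by the monomial with exponents `|p i|` clears all negative exponents, as
        -- `p i + |p i| ≥ 0`.
        refine ⟨Finsupp.mapRange Int.natAbs rfl p,
          AddMonoidAlgebra.single (Finsupp.mapRange (fun x : ℤ => (x + x.natAbs).toNat) rfl p) r, ?_⟩
        rw [AddMonoidAlgebra.single_mul_single, AddMonoidAlgebra.mapDomain_single, mul_one]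
        congr 1
        ext i
        simp only [Finsupp.add_apply, hjapp, Finsupp.mapRange_apply]
        omega
    · intro x y hxy
      exact ⟨1, by rw [hinj hxy]⟩
  exact isIntegrallyClosed_of_isLocalization _ S hS

/-- An integral equation bounds the weights of the monomials. -/
lemma weight_nonneg_of_integral {B Λ : Type*} [CommRing B] [AddCommGroup Λ]
    [IsDomain (AddMonoidAlgebra ℂ Λ)] (q : Λ →+ ℝ) (f : B →+* AddMonoidAlgebra ℂ Λ)
    (hf : ∀ b p, (f b).coeff p ≠ 0 → 0 ≤ q p) (y : AddMonoidAlgebra ℂ Λ)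
    (hy : f.IsIntegralElem y) (p : Λ) (hp : y.coeff p ≠ 0) : 0 ≤ q p := by
  classical
  -- The monomial `x^p` is sent to `x^p T^(q p)`. The order in `T` is a valuation, and its ring of
  -- integers contains every element integral over it. Since the coefficients remember `x^p`, no
  -- cancellation hides a monomial of negative weight.
  let u : AddMonoidAlgebra ℂ Λ →+* HahnSeries ℝ (AddMonoidAlgebra ℂ Λ) :=
    AddMonoidAlgebra.liftNCRingHom
      ((HahnSeries.C (Γ := ℝ)).comp (algebraMap ℂ (AddMonoidAlgebra ℂ Λ)))
      { toFun := fun p => HahnSeries.single (q p.toAdd) (AddMonoidAlgebra.single p.toAdd 1)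
        map_one' := by simp; rfl
        map_mul' := fun a b => by
          rw [HahnSeries.single_mul_single, AddMonoidAlgebra.single_mul_single]
          simp } (fun _ _ => Commute.all _ _)
  have hu : ∀ (a : Λ) (r : ℂ), u (AddMonoidAlgebra.single a r) =
      HahnSeries.single (q a) (AddMonoidAlgebra.single a r) := by
    intro a r
    refine (AddMonoidAlgebra.liftNC_single _ _ _ _).trans ?_
    change HahnSeries.single 0 (AddMonoidAlgebra.single 0 r) * HahnSeries.single _ _ = _
    rw [HahnSeries.single_mul_single, AddMonoidAlgebra.single_mul_single]
    simp
  have hcoeff : ∀ (x : AddMonoidAlgebra ℂ Λ) (s : ℝ) (a : Λ), ((u x).coeff s).coeff a =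
      if q a = s then x.coeff a else 0 := by
    intro x s a
    induction x using AddMonoidAlgebra.induction_linear with
    | zero => simp
    | add x y hx hy => 
      rw [map_add, HahnSeries.coeff_add, AddMonoidAlgebra.coeff_add, Finsupp.add_apply, hx, hy,
        AddMonoidAlgebra.coeff_add, Finsupp.add_apply]
      split_ifs <;> simp
    | single b r =>
      rw [hu, HahnSeries.coeff_single]
      by_cases hab : b = a
      · subst hab
        by_cases hs : s = q b
        · subst hs; simp
        · simp [hs, Ne.symm hs]
      · by_cases hs : s = q b
        · subst hs; simp [hab]
        · simp [hs, hab]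
  have hval : ∀ x : AddMonoidAlgebra ℂ Λ, 0 ≤ (u x).orderTop ↔ ∀ a, x.coeff a ≠ 0 → 0 ≤ q a := by
    intro x
    constructor
    · intro h a ha
      have : (u x).coeff (q a) ≠ 0 := fun h0 => ha (by
        have := hcoeff x (q a) a
        rw [h0, if_pos rfl] at this
        simpa using this.symm)
      exact_mod_cast h.trans (HahnSeries.orderTop_le_of_coeff_ne_zero this)
    · intro h
      by_contra hcon
      push Not at hcon
      by_cases hx : u x = 0
      · simp [hx] at hcon
      · have h1 := HahnSeries.coeff_order_eq_zero.not.2 hx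
        rw [← HahnSeries.order_eq_orderTop_of_ne_zero hx] at hcon
        have h2 : (u x).order < 0 := by exact_mod_cast hcon
        apply h1
        ext a
        rw [hcoeff]
        split_ifs with hs
        · by_contra h3
          have := h a h3
          linarith
        · rfl
  let v := AddValuation.toValuation (HahnSeries.addVal ℝ (AddMonoidAlgebra ℂ Λ))
  have hv : ∀ x, v x ≤ 1 ↔ 0 ≤ x.orderTop := by
    intro x
    rfl
  have hf' : ∀ b, u (f b) ∈ v.integer := fun b => (hv _).2 ((hval _).2 (hf b))
  have hint : IsIntegral v.integer (u y) := by
    obtain ⟨P, hP, he⟩ := hy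
    refine ⟨P.map ((u.comp f).codRestrict v.integer hf'), hP.map _, ?_⟩
    rw [Polynomial.eval₂_map]
    have := congrArg u he
    rw [Polynomial.hom_eval₂, map_zero] at this
    exact this
  have := (Valuation.integer.integers v).mem_of_integral hint
  exact (hval y).1 ((hv _).1 this) p hp

/-- A semigroup algebra of a semigroup cut out by half spaces in a lattice is normal. -/
lemma isIntegrallyClosed_of_halfSpaces {P Λ : Type*} [AddCommMonoid P] [AddCommGroup Λ]
    [Module.Free ℤ Λ] [Module.Finite ℤ Λ] (j : P →+ Λ) (hj : Function.Injective j)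
    (Q : Set (Λ →+ ℝ)) (hQ : ∀ x, x ∈ Set.range j ↔ ∀ q ∈ Q, 0 ≤ q x) :
    IsDomain (AddMonoidAlgebra ℂ P) ∧ IsIntegrallyClosed (AddMonoidAlgebra ℂ P) := by
  let b := Module.finBasis ℤ Λ
  let e : Λ ≃+ (Fin (Module.finrank ℤ Λ) →₀ ℤ) := b.repr.toAddEquiv
  have hΛ : IsIntegrallyClosed (AddMonoidAlgebra ℂ Λ) :=
    have := isIntegrallyClosed_laurent (Module.finrank ℤ Λ)
    IsIntegrallyClosed.of_equiv (AddMonoidAlgebra.domCongr ℂ ℂ e).symm.toRingEquiv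
  have : TwoUniqueSums Λ := TwoUniqueSums.of_injective_addHom e.toAddHom e.injective inferInstance
  have : IsDomain (AddMonoidAlgebra ℂ Λ) := inferInstance
  let φ := AddMonoidAlgebra.mapDomainRingHom ℂ j
  have hφ : Function.Injective φ := AddMonoidAlgebra.mapDomain_injective hj
  have hdom : IsDomain (AddMonoidAlgebra ℂ P) := hφ.isDomain φ
  refine ⟨hdom, ?_⟩
  -- A fraction integral over `ℂ[P]` is integral over the normal ring `ℂ[Λ]`, hence it is a Laurent
  -- polynomial `y`. By the weight bound its exponents lie in all half spaces, that is, in the image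
  -- of `P`.
  let K := FractionRing (AddMonoidAlgebra ℂ P)
  let L := FractionRing (AddMonoidAlgebra ℂ Λ)
  let alg : Algebra (AddMonoidAlgebra ℂ P) (AddMonoidAlgebra ℂ Λ) := φ.toAlgebra
  let ψ : K →+* L := IsFractionRing.map (A := AddMonoidAlgebra ℂ P)
    (B := AddMonoidAlgebra ℂ Λ) (j := φ) hφ
  have hψ : ∀ x, ψ (algebraMap _ K x) = algebraMap _ L (φ x) := fun x =>
    IsLocalization.map_eq _ x
  rw [isIntegrallyClosed_iff K]
  intro x hx
  obtain ⟨F, hF, hFx⟩ := hx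
  have hint : IsIntegral (AddMonoidAlgebra ℂ Λ) (ψ x) := by
    refine ⟨F.map φ, hF.map _, ?_⟩
    rw [Polynomial.eval₂_map]
    have := congrArg ψ hFx
    rw [Polynomial.hom_eval₂, map_zero] at this
    rw [← this]
    congr 1
    exact RingHom.ext fun y => (hψ y).symm
  obtain ⟨y, hy⟩ := (isIntegrallyClosed_iff L).1 hΛ hint
  have hyint : φ.IsIntegralElem y := by
    refine ⟨F, hF, ?_⟩
    apply IsFractionRing.injective (AddMonoidAlgebra ℂ Λ) L
    rw [Polynomial.hom_eval₂, hy, map_zero]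
    have := congrArg ψ hFx
    rw [Polynomial.hom_eval₂, map_zero] at this
    rw [← this]
    congr 1
    exact RingHom.ext fun y => (hψ y).symm
  have hw : ∀ p, y.coeff p ≠ 0 → p ∈ Set.range j := by
    intro p hp
    rw [hQ]
    intro q hq
    refine weight_nonneg_of_integral q φ (fun b a ha => ?_) y hyint p hp
    obtain ⟨a', rfl⟩ : a ∈ Set.range j := by
      by_contra hcon
      exact ha (Finsupp.mapDomain_of_notMem_range _ _ hcon)
    exact (hQ _).1 ⟨a', rfl⟩ q hq
  obtain ⟨z, hz⟩ : ∃ z, φ z = y := by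
    refine ⟨AddMonoidAlgebra.comapDomain j hj y, ?_⟩
    have : (φ (AddMonoidAlgebra.comapDomain j hj y)).coeff = y.coeff := by
      refine Finsupp.mapDomain_comapDomain j hj y.coeff fun p hp => ?_
      exact hw p (Finsupp.mem_support_iff.1 hp)
    exact AddMonoidAlgebra.ext this
  refine ⟨z, ψ.injective ?_⟩
  rw [hψ, hz, hy]

end Normal

/-! ### Integrality and denominators over a subsemigroup -/

section Subsemigroup

variable {P A : Type*} [AddCommMonoid P] [AddCommMonoid A]

/-- A semigroup algebra is integral over that of a subsemigroup that contains a multiple of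
each element. -/
lemma isIntegral_of_multiple (j : A →+ P) (h : ∀ p, ∃ m : ℕ, 0 < m ∧ m • p ∈ Set.range j) :
    (AddMonoidAlgebra.mapDomainRingHom ℂ j).IsIntegral := by
  intro x
  induction x using AddMonoidAlgebra.induction_linear with
  | zero => exact (AddMonoidAlgebra.mapDomainRingHom ℂ j).isIntegralElem_zero
  | add x y hx hy => exact RingHom.IsIntegralElem.add _ hx hy
  | single p r =>
    obtain ⟨m, hm, a, ha⟩ := h p
    refine ⟨Polynomial.X ^ m - Polynomial.C (AddMonoidAlgebra.single a (r ^ m)),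
      Polynomial.monic_X_pow_sub_C _ hm.ne', ?_⟩
    have : (AddMonoidAlgebra.mapDomainRingHom ℂ j) (AddMonoidAlgebra.single a (r ^ m)) =
        AddMonoidAlgebra.single (j a) (r ^ m) := AddMonoidAlgebra.mapDomain_single
    simp only [Polynomial.eval₂_sub, Polynomial.eval₂_pow, Polynomial.eval₂_X,
      Polynomial.eval₂_C, this, ha, AddMonoidAlgebra.single_pow, sub_self]

/-- If each element of `P` is a difference of elements of the subsemigroup `A`, then each element
of the semigroup algebra has a denominator. -/
lemma exists_mul_mem_range [IsDomain (AddMonoidAlgebra ℂ A)] (j : A →+ P)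
    (h : ∀ p, ∃ a, p + j a ∈ Set.range j)
    (x : AddMonoidAlgebra ℂ P) : ∃ s : AddMonoidAlgebra ℂ A, s ≠ 0 ∧ ∃ y,
      AddMonoidAlgebra.mapDomainRingHom ℂ j s * x = AddMonoidAlgebra.mapDomainRingHom ℂ j y := by
  induction x using AddMonoidAlgebra.induction_linear with
  | zero => exact ⟨1, one_ne_zero, 0, by simp⟩
  | add x y hx hy =>
    obtain ⟨s, hs, z, h1⟩ := hx
    obtain ⟨s', hs', z', h2⟩ := hy
    refine ⟨s * s', mul_ne_zero hs hs', s' * z + s * z', ?_⟩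
    rw [map_add, map_mul, map_mul, map_mul, ← h1, ← h2]
    ring
  | single p r =>
    obtain ⟨a, b, hb⟩ := h p
    refine ⟨AddMonoidAlgebra.single a 1, by simp, AddMonoidAlgebra.single b r, ?_⟩
    simp only [AddMonoidAlgebra.mapDomainRingHom_apply, AddMonoidAlgebra.mapDomain_single,
      AddMonoidAlgebra.single_mul_single, hb, one_mul, add_comm]

end Subsemigroup

/-! ### Scheme-theoretic images and normalizations of affine schemes -/

section Schemes

/-- Because of this, the ideal of the image of a composition with `Spec.map i` only depends on the
second factor. -/
lemma ker_SpecMap_eq_bot {B A : CommRingCat.{0}} (i : B ⟶ A) (hi : Function.Injective i) :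
    (Spec.map i).ker = ⊥ := by
  have h : Function.Injective (Spec.map i).appTop := by
    have := Scheme.ΓSpecIso_naturality i
    have e : (Spec.map i).appTop = (Scheme.ΓSpecIso B).hom ≫ i ≫ (Scheme.ΓSpecIso A).inv := by
      rw [← Category.assoc, ← this]; simp
    rw [e]
    simp only [CommRingCat.hom_comp, RingHom.coe_comp]
    exact ((ConcreteCategory.bijective_of_isIso (Scheme.ΓSpecIso A).inv).1.comp hi).comp
      (ConcreteCategory.bijective_of_isIso (Scheme.ΓSpecIso B).hom).1
  exact Scheme.IdealSheafData.ext_of_isAffine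
    (by
      rw [(Spec.map i).ker_apply ⟨⊤, isAffineOpen_top _⟩]
      exact (RingHom.injective_iff_ker_eq_bot _).1 h)

/-- The scheme theoretic image of a map of affine schemes is the spectrum of the image. -/
lemma exists_image_iso {R B A : CommRingCat.{0}} (p : R ⟶ B) (i : B ⟶ A)
    (hp : Function.Surjective p) (hi : Function.Injective i) (f : Spec A ⟶ Spec R)
    (hf : f = Spec.map i ≫ Spec.map p) :
    ∃ e : f.image ≅ Spec B, e.hom ≫ Spec.map p = f.imageι ∧ f.toImage ≫ e.hom = Spec.map i := by
  have : IsClosedImmersion (Spec.map p) := IsClosedImmersion.spec_of_surjective p hp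
  have hker : f.imageι.ker = (Spec.map p).ker := by
    rw [Scheme.IdealSheafData.ker_subschemeι, hf, ← Scheme.IdealSheafData.map_ker,
      ker_SpecMap_eq_bot i hi, Scheme.IdealSheafData.map_bot]
  have := IsClosedImmersion.isIso_lift _ _ hker.symm
  refine ⟨asIso (IsClosedImmersion.lift _ _ hker.symm.le), IsClosedImmersion.lift_fac _ _ _, ?_⟩
  rw [← cancel_mono (Spec.map p), Category.assoc, asIso_hom, IsClosedImmersion.lift_fac,
    Scheme.Hom.toImage_imageι, hf]

lemma IsNormalization.comp_isIso {X Y Z : Scheme.{0}} {f : X ⟶ Y} (h : IsNormalization f)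
    (g : Y ⟶ Z) [IsIso g] : IsNormalization (f ≫ g) where
  source_integral := h.source_integral
  target_integral := by
    have := h.target_integral
    have : Nonempty Z := ⟨g (Classical.arbitrary Y)⟩
    exact isIntegral_of_isOpenImmersion (inv g)
  normal := h.normal
  integral := by
    have := h.integral
    infer_instance
  birational x hx := by
    obtain ⟨h1, h2⟩ := h.birational x hx
    refine ⟨?_, ?_⟩
    · have := h1.image g.continuous
      rw [Set.image_univ, g.surjective.range_eq, closure_univ] at this
      exact this
    · rw [Scheme.Hom.stalkMap_comp]
      have : IsOpenImmersion g := inferInstance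
      have : IsIso (g.stalkMap (f x)) := inferInstance
      exact IsIso.comp_isIso' this h2

/-- The condition `hden` makes every element of `A` a fraction over `B`. The generic points are the
zero ideals, and the local map there is the map of fraction fields, which is then bijective. -/
lemma isNormalization_SpecMap {B A : CommRingCat.{0}} [IsDomain B] [IsDomain A]
    [IsIntegrallyClosed A] (i : B ⟶ A) (hi : Function.Injective i) (hint : i.hom.IsIntegral)
    (hden : ∀ a : A, ∃ s : B, s ≠ 0 ∧ ∃ b, i s * a = i b) : IsNormalization (Spec.map i) where
  source_integral := inferInstance
  target_integral := inferInstance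
  normal x := by
    have : x.asIdeal.IsPrime := PrimeSpectrum.isPrime x
    have e := Spec.stalkIso A x
    have : IsIntegrallyClosed (Localization.AtPrime x.asIdeal) :=
      isIntegrallyClosed_of_isLocalization _ x.asIdeal.primeCompl
        x.asIdeal.primeCompl_le_nonZeroDivisors
    exact IsIntegrallyClosed.of_equiv e.symm.commRingCatIsoToRingEquiv
  integral := IsIntegralHom.SpecMap_iff.2 hint
  birational x hx := by
    have hbot : x.asIdeal = ⊥ := by
      have h1 : (⟨⊥, Ideal.isPrime_bot⟩ : PrimeSpectrum A) ∈ closure {x} := by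
        rw [hx.def]; trivial
      have h2 := (PrimeSpectrum.le_iff_mem_closure _ _).2 h1
      exact le_bot_iff.1 h2
    have hbot' : (Spec.map i x).asIdeal = ⊥ := by
      change Ideal.comap i.hom x.asIdeal = ⊥
      rw [hbot]
      exact (RingHom.injective_iff_ker_eq_bot _).1 hi
    refine ⟨?_, ?_⟩
    · rw [IsGenericPoint, Set.eq_univ_iff_forall]
      intro y
      exact (PrimeSpectrum.le_iff_mem_closure _ _).1 (by
        change (Spec.map i x).asIdeal ≤ y.asIdeal
        rw [hbot']; exact bot_le)
    · refine ((MorphismProperty.isomorphisms CommRingCat).arrow_mk_iso_iff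
        (Scheme.arrowStalkMapSpecIso i x)).2 ?_
      have : x.asIdeal.IsPrime := PrimeSpectrum.isPrime x
      rw [MorphismProperty.isomorphisms.iff, ConcreteCategory.isIso_iff_bijective]
      change Function.Bijective (Localization.localRingHom _ x.asIdeal i.hom rfl)
      have hmem : ∀ a : A, a ≠ 0 → a ∈ x.asIdeal.primeCompl := fun a ha => by
        change a ∉ x.asIdeal
        rwa [hbot, Ideal.mem_bot]
      have hmem' : ∀ b : B, b ≠ 0 → b ∈ (Ideal.comap i.hom x.asIdeal).primeCompl :=
        fun b hb => hmem _ fun h0 => hb (hi (by rw [map_zero]; exact h0))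
      have hne : ∀ a ∈ x.asIdeal.primeCompl, a ≠ 0 := fun a ha h0 => ha (h0 ▸ zero_mem _)
      constructor
      · rw [injective_iff_map_eq_zero]
        intro z hz
        obtain ⟨b, t, rfl⟩ := IsLocalization.exists_mk'_eq
          (Ideal.comap i.hom x.asIdeal).primeCompl z
        rw [Localization.localRingHom_mk', IsLocalization.mk'_eq_zero_iff] at hz
        obtain ⟨u, hu⟩ := hz
        have h0 := (mul_eq_zero.1 hu).resolve_left (hne _ u.2)
        have : b = 0 := hi (by rw [map_zero]; exact h0)
        rw [this, IsLocalization.mk'_zero]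
      · intro z
        obtain ⟨a, t, rfl⟩ := IsLocalization.exists_mk'_eq x.asIdeal.primeCompl z
        obtain ⟨s, hs, b, hb⟩ := hden a
        obtain ⟨s', hs', b', hb'⟩ := hden t
        have hb0 : b' ≠ 0 := by
          rintro rfl
          rw [map_zero] at hb'
          rcases mul_eq_zero.1 hb' with h | h
          · exact hs' (hi (by rw [map_zero]; exact h))
          · exact hne _ t.2 h
        -- From `s a = b` and `s' t = b'` one gets `a / t = (b s') / (s b')`.
        refine ⟨IsLocalization.mk' _ (b * s')
          (⟨s * b', hmem' _ (mul_ne_zero hs hb0)⟩ :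
            (Ideal.comap i.hom x.asIdeal).primeCompl), ?_⟩
        rw [Localization.localRingHom_mk', IsLocalization.mk'_eq_iff_eq]
        congr 1
        change (t : A) * i (b * s') = i (s * b') * a
        rw [map_mul, map_mul, ← hb, ← hb']
        ring

end Schemes

/-! ### Faces of cones, described by the generators that they contain -/

section Cones

/-- This constant serves for lexicographic perturbations: `T • α + β` is decided by `α`, and `β`
only breaks ties. Terms with `α s = 0` contribute zero to the sum that defines `T`. -/
lemma exists_large {ι : Type*} [Finite ι] (α β : ι → ℝ) :
    ∃ T : ℝ, 0 < T ∧ ∀ s, 0 < α s → 0 < T * α s + β s := by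
  have := Fintype.ofFinite ι
  refine ⟨1 + ∑ s, |β s| / |α s|, ?_, fun s hs => ?_⟩
  · have : 0 ≤ ∑ s, |β s| / |α s| := Finset.sum_nonneg fun s _ => by positivity
    linarith
  · have h1 : |β s| / |α s| ≤ ∑ s, |β s| / |α s| :=
      Finset.single_le_sum (f := fun s => |β s| / |α s|) (fun s _ => by positivity)
        (Finset.mem_univ s)
    have h2 : |β s| / |α s| * α s = |β s| := by
      rw [abs_of_pos hs]; field_simp
    have h3 := mul_le_mul_of_nonneg_right h1 hs.le
    have h4 := neg_abs_le (β s)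
    nlinarith

variable {E K : Type*} [AddCommGroup E] [Module ℝ E]

/-- The functional `f` cuts out a face of the cone generated by the family `b`, and this face
contains exactly the generators `b k` with `k ∈ Z`. -/
def CutsFace (b : K → E) (f : Module.Dual ℝ E) (Z : Set K) : Prop :=
  (∀ k, 0 ≤ f (b k)) ∧ ∀ k, f (b k) = 0 ↔ k ∈ Z

lemma CutsFace.pos {b : K → E} {f : Module.Dual ℝ E} {Z : Set K} (h : CutsFace b f Z) {k : K}
    (hk : k ∉ Z) : 0 < f (b k) :=
  lt_of_le_of_ne (h.1 k) fun h' => hk ((h.2 k).1 h'.symm)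

lemma CutsFace.zero {b : K → E} {f : Module.Dual ℝ E} {Z : Set K} (h : CutsFace b f Z) {k : K}
    (hk : k ∈ Z) : f (b k) = 0 := (h.2 k).2 hk

/-- Two generators span a two-dimensional face. -/
def Adj (b : K → E) (j k : K) : Prop := j ≠ k ∧ ∃ f, CutsFace b f {j, k}

lemma Adj.symm {b : K → E} {j k : K} (h : Adj b j k) : Adj b k j :=
  ⟨h.1.symm, by rw [Set.pair_comm]; exact h.2⟩

variable [FiniteDimensional ℝ E] [Finite K]

/-- If a functional that vanishes on a face is negative somewhere on the cone, then it is
negative on some face whose dimension is larger by one. -/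
lemma exists_larger_face (b : K → E) (f₀ : Module.Dual ℝ E) (Z₀ : Set K) (h₀ : CutsFace b f₀ Z₀)
    (g : Module.Dual ℝ E) (hg : ∀ k ∈ Z₀, g (b k) = 0) (hneg : ∃ k, g (b k) < 0) :
    ∃ f Z m, CutsFace b f Z ∧ Z₀ ⊆ Z ∧ m ∈ Z ∧ m ∉ Z₀ ∧ ∀ k ∈ Z, k ∉ Z₀ →
      g (b k) < 0 ∧ ∃ s : ℝ, 0 < s ∧ b k - s • b m ∈ Submodule.span ℝ (b '' Z₀) := by
  classical
  have := Fintype.ofFinite K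
  set W := Submodule.span ℝ (b '' Z₀) with hW
  let π : E →ₗ[ℝ] (Fin (Module.finrank ℝ (E ⧸ W)) → ℝ) :=
    (Module.finBasis ℝ (E ⧸ W)).equivFun.toLinearMap ∘ₗ W.mkQ
  have hπ : ∀ x, π x = 0 ↔ x ∈ W := fun x => by simp [π]
  let sq : E → ℝ := fun x => ∑ i, π x i ^ 2
  let x : K → E := fun k => (f₀ (b k))⁻¹ • b k
  have hbx : ∀ k, k ∉ Z₀ → b k = f₀ (b k) • x k := fun k hk => by
    simp only [x, smul_smul]
    rw [mul_inv_cancel₀ (h₀.pos hk).ne', one_smul]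
  have hfx : ∀ k, k ∉ Z₀ → f₀ (x k) = 1 := fun k hk => by
    simp only [x, map_smul, smul_eq_mul]
    exact inv_mul_cancel₀ (h₀.pos hk).ne'
  -- Among the generators outside the face, normalized by `f₀ = 1`, a maximum of `sq - T g` first
  -- minimizes `g` and then has the greatest norm modulo `W`. Strict convexity of the norm makes it
  -- a vertex of the slice modulo `W`.
  obtain ⟨T, hT, hTl⟩ := exists_large (ι := K × K) (fun s => g (x s.1) - g (x s.2))
    (fun s => sq (x s.2) - sq (x s.1))
  obtain ⟨k₁, hk₁⟩ := hneg
  have hk₁' : k₁ ∉ Z₀ := fun h => by simp [hg _ h] at hk₁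
  have hne : (Finset.univ.filter fun k => k ∉ Z₀).Nonempty := ⟨k₁, by simpa⟩
  obtain ⟨m, hm, hmax⟩ := Finset.exists_max_image _ (fun k => sq (x k) - T * g (x k)) hne
  simp only [Finset.mem_filter, Finset.mem_univ, true_and] at hm hmax
  have hmin : ∀ k, k ∉ Z₀ → g (x m) ≤ g (x k) := by
    intro k hk
    by_contra hcon
    push Not at hcon
    have h1 := hTl (m, k) (by simpa using hcon)
    have h2 := hmax k hk
    simp only at h1
    linarith
  have hgm : g (x m) < 0 := by
    refine (hmin k₁ hk₁').trans_lt ?_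
    simp only [x, map_smul, smul_eq_mul]
    exact mul_neg_of_pos_of_neg (inv_pos.2 (h₀.pos hk₁')) hk₁
  -- On the slice `f₀ = 1`, this is the value of `sq - T g` at `x m` minus the linearization of `sq
  -- - T g` at `x m`. So at `x k` it equals `sq (x k - x m)` plus the nonnegative defect of `x k`
  -- from the maximum.
  let f : Module.Dual ℝ E := T • g - (2 : ℝ) • (∑ i, π (x m) i • (LinearMap.proj i ∘ₗ π)) +
    (2 * sq (x m) - T * g (x m)) • f₀
  have hf : ∀ y, f y = T * g y - 2 * ∑ i, π (x m) i * π y i +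
      (2 * sq (x m) - T * g (x m)) * f₀ y := fun y => by
    simp [f, LinearMap.sum_apply]
  have hfZ : ∀ k ∈ Z₀, f (b k) = 0 := fun k hk => by
    have : π (b k) = 0 := (hπ _).2 (Submodule.subset_span ⟨k, hk, rfl⟩)
    rw [hf, hg k hk, h₀.zero hk, this]
    simp
  have hfk : ∀ k, k ∉ Z₀ → f (x k) = sq (x k - x m) +
      ((sq (x m) - T * g (x m)) - (sq (x k) - T * g (x k))) := fun k hk => by
    rw [hf, hfx k hk]
    have : sq (x k - x m) = sq (x k) + sq (x m) - 2 * ∑ i, π (x m) i * π (x k) i := by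
      simp only [sq, map_sub, Pi.sub_apply, Finset.mul_sum]
      rw [← Finset.sum_add_distrib, ← Finset.sum_sub_distrib]
      exact Finset.sum_congr rfl fun i _ => by ring
    rw [this]; ring
  have hsq : ∀ y, 0 ≤ sq y := fun y => Finset.sum_nonneg fun i _ => sq_nonneg _
  have hsq0 : ∀ y, sq y = 0 → y ∈ W := fun y hy => by
    rw [← hπ]
    ext i
    have := (Finset.sum_eq_zero_iff_of_nonneg (fun i _ => sq_nonneg (π y i))).1 hy i
      (Finset.mem_univ _)
    simpa using this
  have hfb : ∀ k, k ∉ Z₀ → f (b k) = f₀ (b k) * f (x k) := fun k hk => by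
    conv_lhs => rw [hbx k hk]
    simp
  refine ⟨f, {k | f (b k) = 0}, m, ⟨fun k => ?_, fun k => Iff.rfl⟩, hfZ, ?_, hm, ?_⟩
  · by_cases hk : k ∈ Z₀
    · exact (hfZ k hk).ge
    · rw [hfb k hk, hfk k hk]
      have h1 := hmax k hk
      have h2 := hsq (x k - x m)
      exact mul_nonneg (h₀.1 k) (by linarith)
  · change f (b m) = 0
    rw [hfb m hm, hfk m hm]
    simp [sq]
  · intro k hk hk'
    have hk0 : f (x k) = 0 := by
      have : f (b k) = 0 := hk
      rw [hfb k hk'] at this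
      exact (mul_eq_zero.1 this).resolve_left (h₀.pos hk').ne'
    rw [hfk k hk'] at hk0
    have h1 := hmax k hk'
    have h2 := hsq (x k - x m)
    have hmem : x k - x m ∈ W := hsq0 _ (by linarith)
    have hgW : ∀ y ∈ W, g y = 0 := fun y hy => by
      have : W ≤ LinearMap.ker g := Submodule.span_le.2 (by
        rintro _ ⟨k, hk, rfl⟩; exact hg k hk)
      exact this hy
    have hgk : g (x k) = g (x m) := by
      have := hgW _ hmem
      rw [map_sub] at this
      linarith
    refine ⟨?_, f₀ (b k) * (f₀ (b m))⁻¹, mul_pos (h₀.pos hk') (inv_pos.2 (h₀.pos hm)), ?_⟩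
    · rw [hbx k hk', map_smul, hgk]
      exact mul_neg_of_pos_of_neg (h₀.pos hk') hgm
    · have : b k - (f₀ (b k) * (f₀ (b m))⁻¹) • b m = f₀ (b k) • (x k - x m) := by
        rw [smul_sub, ← hbx k hk']
        simp [x, smul_smul]
      rw [this]
      exact W.smul_mem _ hmem

variable {b : K → E} (hray : ∀ j, ∃ f, CutsFace b f {j})
include hray

/-- This is the improving edge of the simplex method. The larger face through `j` has only one
further generator: if `l` were a third one besides `m`, a relation `b l - s • b m = β • b j` would
express one of `b l`, `b m` by the other and `b j` with nonnegative coefficients, against the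
functional of its ray. -/
lemma exists_adj {j : K} (g : Module.Dual ℝ E) (hj : g (b j) = 0) (hneg : ∃ k, g (b k) < 0) :
    ∃ k, Adj b j k ∧ g (b k) < 0 := by
  obtain ⟨f₀, h₀⟩ := hray j
  obtain ⟨f, Z, m, hf, hZ, hm, hm', h⟩ := exists_larger_face b f₀ {j} h₀ g (by simpa) hneg
  have hmj : m ≠ j := hm'
  suffices Z = {j, m} from ⟨m, ⟨Ne.symm hm', f, this ▸ hf⟩, (h m hm hm').1⟩
  ext l
  refine ⟨fun hl => ?_, ?_⟩
  · by_contra hcon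
    simp only [Set.mem_insert_iff, Set.mem_singleton_iff, not_or] at hcon
    obtain ⟨s, hs, hmem⟩ := (h l hl hcon.1).2
    rw [Set.image_singleton, Submodule.mem_span_singleton] at hmem
    obtain ⟨β, hβ⟩ := hmem
    rcases le_or_gt 0 β with h0 | h0
    · obtain ⟨fl, hfl⟩ := hray l
      have e := congrArg fl hβ
      simp only [map_smul, map_sub, smul_eq_mul, hfl.zero (Set.mem_singleton l)] at e
      have h1 := hfl.pos (k := m) (by simpa using Ne.symm hcon.2)
      have h2 := hfl.1 j
      nlinarith [mul_nonneg h0 h2, mul_pos hs h1]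
    · obtain ⟨fm, hfm⟩ := hray m
      have e := congrArg fm hβ
      simp only [map_smul, map_sub, smul_eq_mul, hfm.zero (Set.mem_singleton m)] at e
      have h1 := hfm.pos (k := l) (by simpa using hcon.2)
      have h2 := hfm.1 j
      nlinarith [mul_nonneg (neg_nonneg.2 h0.le) h2]
  · rintro (rfl | rfl)
    · exact hZ rfl
    · exact hm

/-- Adding a large multiple of `f` to `g` makes generators outside the face positive, so an
improving edge must stay in the face. -/
lemma exists_adj_mem {j : K} {f : Module.Dual ℝ E} {Z : Set K} (hf : CutsFace b f Z) (hjZ : j ∈ Z)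
    (g : Module.Dual ℝ E) (hj : g (b j) = 0) (hneg : ∃ k ∈ Z, g (b k) < 0) :
    ∃ k ∈ Z, Adj b j k ∧ g (b k) < 0 := by
  obtain ⟨T, hT, hTl⟩ := exists_large (fun k => f (b k)) (fun k => g (b k))
  obtain ⟨k₀, hk₀, hneg⟩ := hneg
  obtain ⟨k, hk, hk'⟩ := exists_adj hray (j := j) (T • f + g) (by simp [hf.zero hjZ, hj])
    ⟨k₀, by simpa [hf.zero hk₀] using hneg⟩
  simp only [LinearMap.add_apply, LinearMap.smul_apply, smul_eq_mul] at hk'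
  have hkZ : k ∈ Z := by
    by_contra hcon
    have := hTl k (hf.pos hcon)
    linarith
  refine ⟨k, hkZ, hk, by simpa [hf.zero hkZ] using hk'⟩

/-- The functional of the face through `j` and `k` isolates the coefficient of `b l`; the ray
functionals of `j` and `k` then isolate the other two. -/
lemma linearIndependent_triple {j k l : K} (h : Adj b j k) (hj : l ≠ j) (hk : l ≠ k) :
    LinearIndependent ℝ ![b j, b k, b l] := by
  rw [Fintype.linearIndependent_iff]
  intro c hc
  simp only [Fin.sum_univ_three, Matrix.cons_val_zero, Matrix.cons_val_one, Matrix.cons_val] at hc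
  obtain ⟨f, hf⟩ := h.2
  obtain ⟨fj, hfj⟩ := hray j
  obtain ⟨fk, hfk⟩ := hray k
  have h2 : c 2 = 0 := by
    have := congrArg f hc
    simp only [map_add, map_smul, smul_eq_mul, hf.zero (show j ∈ ({j, k} : Set K) by simp),
      hf.zero (show k ∈ ({j, k} : Set K) by simp), map_zero, mul_zero, zero_add] at this
    exact (mul_eq_zero.1 this).resolve_right (hf.pos (by simp [hj, hk])).ne'
  have h1 : c 1 = 0 := by
    have := congrArg fj hc
    simp only [h2, map_add, map_smul, smul_eq_mul, hfj.zero (Set.mem_singleton j), map_zero,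
      mul_zero, zero_add, zero_mul, add_zero] at this
    exact (mul_eq_zero.1 this).resolve_right (hfj.pos (by simpa using h.1.symm)).ne'
  have h0 : c 0 = 0 := by
    have := congrArg fk hc
    simp only [h2, h1, map_add, map_smul, smul_eq_mul, map_zero, zero_mul, add_zero] at this
    exact (mul_eq_zero.1 this).resolve_right (hfk.pos (by simpa using h.1)).ne'
  intro i
  fin_cases i <;> assumption

/-- A functional that vanishes on a two-dimensional face and is negative somewhere is negative on
the rest of a three-dimensional face. -/
lemma exists_threeFace {j k : K} (h : Adj b j k) (g : Module.Dual ℝ E) (hj : g (b j) = 0)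
    (hk : g (b k) = 0) (hneg : ∃ l, g (b l) < 0) :
    ∃ f Z l, CutsFace b f Z ∧ j ∈ Z ∧ k ∈ Z ∧ l ∈ Z ∧ Adj b j l ∧ l ≠ k ∧ g (b l) < 0 ∧
      Module.finrank ℝ (Submodule.span ℝ (b '' Z)) = 3 := by
  obtain ⟨f₀, h₀⟩ := h.2
  obtain ⟨f, Z, m, hf, hZ, hm, hm', hZ'⟩ := exists_larger_face b f₀ {j, k} h₀ g
    (by rintro _ (rfl | rfl) <;> assumption) hneg
  obtain ⟨l, hl, hadj, hgl⟩ := exists_adj_mem hray hf (hZ (by simp : j ∈ ({j, k} : Set K))) g hj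
    ⟨m, hm, (hZ' m hm hm').1⟩
  have hlk : l ≠ k := by rintro rfl; rw [hk] at hgl; exact lt_irrefl _ hgl
  refine ⟨f, Z, l, hf, hZ (by simp), hZ (by simp), hl, hadj, hlk, hgl, ?_⟩
  have hmj : m ≠ j := fun h => hm' (by simp [h])
  have hmk : m ≠ k := fun h => hm' (by simp [h])
  have hli := linearIndependent_triple hray h hmj hmk
  have hspan : Submodule.span ℝ (b '' Z) = Submodule.span ℝ (Set.range ![b j, b k, b m]) := by
    apply le_antisymm
    · rw [Submodule.span_le]
      have h1 : b m ∈ Submodule.span ℝ (Set.range ![b j, b k, b m]) :=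
        Submodule.subset_span ⟨2, rfl⟩
      have h2 : Submodule.span ℝ (b '' {j, k}) ≤ Submodule.span ℝ (Set.range ![b j, b k, b m]) := by
        rw [Submodule.span_le]
        rintro _ ⟨x, (rfl | rfl), rfl⟩
        · exact Submodule.subset_span ⟨0, rfl⟩
        · exact Submodule.subset_span ⟨1, rfl⟩
      rintro _ ⟨p, hp, rfl⟩
      by_cases hp' : p ∈ ({j, k} : Set K)
      · exact h2 (Submodule.subset_span ⟨p, hp', rfl⟩)
      · obtain ⟨s, -, hs⟩ := (hZ' p hp hp').2
        have := Submodule.add_mem _ (h2 hs) (Submodule.smul_mem _ s h1)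
        simpa using this
    · rw [Submodule.span_le]
      rintro _ ⟨i, rfl⟩
      apply Submodule.subset_span
      fin_cases i
      · exact ⟨j, hZ (by simp), rfl⟩
      · exact ⟨k, hZ (by simp), rfl⟩
      · exact ⟨m, hm, rfl⟩
  rw [hspan, finrank_span_eq_card hli]
  simp

end Cones

/-! ### Orienting the boundary of a three-dimensional face -/

section Orientation

variable {E K : Type*} [AddCommGroup E] [Module ℝ E]

/-- A determinant on a three-dimensional subspace, extended to the whole space. -/
lemma exists_det (U : Submodule ℝ E) (hU : Module.finrank ℝ U = 3) :
    ∃ D : E → E → E → ℝ, (∀ x y z, D x y z = -D y x z) ∧ (∀ x y z, D x y z = -D x z y) ∧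
      (∀ x y z (α β γ : ℝ), D x y (α • x + β • y + γ • z) = γ * D x y z) ∧
      ∀ x y z, x ∈ U → y ∈ U → z ∈ U → LinearIndependent ℝ ![x, y, z] → D x y z ≠ 0 := by
  have : FiniteDimensional ℝ U := Module.finite_of_finrank_pos (by omega)
  obtain ⟨P, hP⟩ := LinearMap.exists_leftInverse_of_injective U.subtype
    (LinearMap.ker_eq_bot.2 U.subtype_injective)
  have hP' : ∀ x (hx : x ∈ U), P x = ⟨x, hx⟩ := fun x hx => LinearMap.congr_fun hP ⟨x, hx⟩
  let e := Module.finBasisOfFinrankEq ℝ U hU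
  let D : E → E → E → ℝ := fun x y z => e.det ![P x, P y, P z]
  have hD : ∀ x y z, D x y z = e.det ![P x, P y, P z] := fun _ _ _ => rfl
  simp only [Module.Basis.det_apply, Matrix.det_fin_three, Module.Basis.toMatrix_apply,
    Matrix.cons_val_zero, Matrix.cons_val_one, Matrix.cons_val] at hD
  refine ⟨D, fun x y z => ?_, fun x y z => ?_, fun x y z α β γ => ?_, fun x y z hx hy hz h => ?_⟩
  · rw [hD, hD]; ring
  · rw [hD, hD]; ring
  · rw [hD, hD]
    simp only [map_add, map_smul, Finsupp.add_apply, Finsupp.smul_apply, smul_eq_mul]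
    ring
  · have hcomp : (U.subtype ∘ ![P x, P y, P z]) = ![x, y, z] := by
      ext i
      fin_cases i <;> simp [hP' _ hx, hP' _ hy, hP' _ hz]
    have hli : LinearIndependent ℝ ![P x, P y, P z] := by
      apply LinearIndependent.of_comp U.subtype
      rw [hcomp]; exact h
    exact ((Module.Basis.is_basis_iff_det e).1
      ⟨hli, hli.span_eq_top_of_card_eq_finrank (by simp [hU])⟩).ne_zero

variable [FiniteDimensional ℝ E] [Finite K] {b : K → E} (hray : ∀ j, ∃ f, CutsFace b f {j})
include hray

lemma exists_combination {Z : Set K}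
    (h3 : Module.finrank ℝ (Submodule.span ℝ (b '' Z)) = 3) {j k l : K} (h : Adj b j k)
    (hjZ : j ∈ Z) (hkZ : k ∈ Z) (hlZ : l ∈ Z) (hj : l ≠ j) (hk : l ≠ k) {m : K} (hm : m ∈ Z) :
    ∃ α β γ : ℝ, b m = α • b j + β • b k + γ • b l := by
  have hli := linearIndependent_triple hray h hj hk
  have hspan : Submodule.span ℝ (Set.range ![b j, b k, b l]) = Submodule.span ℝ (b '' Z) := by
    apply Submodule.eq_of_le_of_finrank_eq
    · rw [Submodule.span_le]
      rintro _ ⟨i, rfl⟩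
      apply Submodule.subset_span
      fin_cases i
      · exact ⟨j, hjZ, rfl⟩
      · exact ⟨k, hkZ, rfl⟩
      · exact ⟨l, hlZ, rfl⟩
    · rw [h3, finrank_span_eq_card hli]
      simp
  have hmem : b m ∈ Submodule.span ℝ (b '' Z) := Submodule.subset_span ⟨m, hm, rfl⟩
  rw [← hspan, Submodule.mem_span_range_iff_exists_fun] at hmem
  obtain ⟨c, hc⟩ := hmem
  refine ⟨c 0, c 1, c 2, ?_⟩
  rw [← hc]
  simp [Fin.sum_univ_three]

/-- In a three-dimensional face, each further generator is a combination of the three generators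
of two adjacent edges; the coefficients of the outer ones are nonnegative. -/
lemma exists_combination_of_two_adj {Z : Set K}
    (h3 : Module.finrank ℝ (Submodule.span ℝ (b '' Z)) = 3) {p q q' : K} (h : Adj b p q)
    (h' : Adj b p q') (hne : q' ≠ q) (hpZ : p ∈ Z) (hqZ : q ∈ Z) (hq'Z : q' ∈ Z) {m : K}
    (hm : m ∈ Z) : ∃ α β γ : ℝ, b m = α • b p + β • b q + γ • b q' ∧ 0 ≤ β ∧ 0 ≤ γ ∧
      (m ≠ p → m ≠ q → 0 < γ) ∧ (m ≠ p → m ≠ q' → 0 < β) := by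
  obtain ⟨α, β, γ, e⟩ := exists_combination hray h3 h hpZ hqZ hq'Z h'.1.symm hne hm
  obtain ⟨f, hf⟩ := h.2
  obtain ⟨f', hf'⟩ := h'.2
  have ef := congrArg f e
  have ef' := congrArg f' e
  simp only [map_add, map_smul, smul_eq_mul, hf.zero (show p ∈ ({p, q} : Set K) by simp),
    hf.zero (show q ∈ ({p, q} : Set K) by simp), mul_zero, zero_add] at ef
  simp only [map_add, map_smul, smul_eq_mul, hf'.zero (show p ∈ ({p, q'} : Set K) by simp),
    hf'.zero (show q' ∈ ({p, q'} : Set K) by simp), mul_zero, zero_add, add_zero] at ef'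
  have hpos := hf.pos (k := q') (by simp [h'.1.symm, hne])
  have hpos' := hf'.pos (k := q) (by simp [h.1.symm, hne.symm])
  refine ⟨α, β, γ, e, ?_, ?_, fun h1 h2 => ?_, fun h1 h2 => ?_⟩
  · exact nonneg_of_mul_nonneg_left (ef' ▸ hf'.1 m) hpos'
  · exact nonneg_of_mul_nonneg_left (ef ▸ hf.1 m) hpos
  · exact pos_of_mul_pos_left (ef ▸ hf.pos (by simp [h1, h2])) hpos.le
  · exact pos_of_mul_pos_left (ef' ▸ hf'.pos (by simp [h1, h2])) hpos'.le

/-- The boundary of a three-dimensional face is a cycle, which can be oriented. -/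
lemma exists_orientation {f : Module.Dual ℝ E} {Z : Set K} (hf : CutsFace b f Z)
    (h3 : Module.finrank ℝ (Submodule.span ℝ (b '' Z)) = 3) :
    ∃ s : K → K → ℤ, (∀ p q, s p q = -s q p) ∧
      (∀ p ∈ Z, ∀ q ∈ Z, Adj b p q → s p q = 1 ∨ s p q = -1) ∧
      ∀ p ∈ Z, ∃ q ∈ Z, ∃ q' ∈ Z, Adj b p q ∧ Adj b p q' ∧ q' ≠ q ∧ s p q + s p q' = 0 ∧
        ∀ l ∈ Z, Adj b p l → l = q ∨ l = q' := by
  classical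
  have := Fintype.ofFinite K
  obtain ⟨D, hD1, hD2, hD3, hD4⟩ := exists_det _ h3
  have hmem : ∀ p ∈ Z, b p ∈ Submodule.span ℝ (b '' Z) := fun p hp =>
    Submodule.subset_span ⟨p, hp, rfl⟩
  -- For an edge `p q` the face lies on one side of it, so all determinants in this sum have the
  -- same sign or vanish. The sign of the sum is thus the orientation of the edge, defined without
  -- choosing a third generator.
  let S : K → K → ℝ := fun p q => ∑ l, if l ∈ Z then D (b p) (b q) (b l) else 0
  have hS : ∀ p q l, p ∈ Z → q ∈ Z → l ∈ Z → Adj b p q → l ≠ p → l ≠ q →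
      ∃ t, 0 < t ∧ S p q = t * D (b p) (b q) (b l) := by
    intro p q l hp hq hl h hlp hlq
    obtain ⟨f, hf⟩ := h.2
    have hfl := hf.pos (k := l) (by simp [hlp, hlq])
    have key : ∀ m ∈ Z, D (b p) (b q) (b m) = f (b m) / f (b l) * D (b p) (b q) (b l) := by
      intro m hm
      obtain ⟨α, β, γ, e⟩ := exists_combination hray h3 h hp hq hl hlp hlq hm
      have ef := congrArg f e
      simp only [map_add, map_smul, smul_eq_mul, hf.zero (show p ∈ ({p, q} : Set K) by simp),
        hf.zero (show q ∈ ({p, q} : Set K) by simp), mul_zero, zero_add] at ef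
      rw [ef, e, hD3, mul_div_assoc, div_self hfl.ne', mul_one]
    refine ⟨∑ m, if m ∈ Z then f (b m) / f (b l) else 0, ?_, ?_⟩
    · refine Finset.sum_pos' (fun m _ => ?_) ⟨l, Finset.mem_univ _, ?_⟩
      · split_ifs
        · exact div_nonneg (hf.1 m) hfl.le
        · exact le_rfl
      · rw [if_pos hl]; exact div_pos hfl hfl
    · simp only [S]
      rw [Finset.sum_mul]
      refine Finset.sum_congr rfl fun m _ => ?_
      split_ifs with hm
      · exact key m hm
      · simp
  have hthird : ∀ p ∈ Z, ∀ q ∈ Z, ∃ l ∈ Z, l ≠ p ∧ l ≠ q := by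
    intro p hp q hq
    by_contra! hcon
    have hZ : b '' Z ⊆ (({b p, b q} : Finset E) : Set E) := by
      rintro _ ⟨l, hl, rfl⟩
      by_cases hlp : l = p
      · simp [hlp]
      · simp [hcon l hl hlp]
    have h1 := Submodule.finrank_mono (Submodule.span_mono (R := ℝ) hZ)
    have h2 := finrank_span_finset_le_card (R := ℝ) ({b p, b q} : Finset E)
    have h4 : ({b p, b q} : Finset E).card ≤ 2 := Finset.card_le_two
    unfold Set.finrank at h2
    omega
  have hsgn : ∀ (t x : ℝ), 0 < t → SignType.sign (t * x) = SignType.sign x := fun t x ht => by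
    rw [sign_mul, sign_pos ht, one_mul]
  refine ⟨fun p q => (SignType.sign (S p q) : ℤ), fun p q => ?_, fun p hp q hq h => ?_,
    fun p hp => ?_⟩
  · have : S p q = -S q p := by
      simp only [S]
      rw [← Finset.sum_neg_distrib]
      refine Finset.sum_congr rfl fun l _ => ?_
      split_ifs
      · exact hD1 _ _ _
      · simp
    change (SignType.sign (S p q) : ℤ) = -(SignType.sign (S q p) : ℤ)
    rw [this, Left.sign_neg]
    simp
  · obtain ⟨l, hl, hlp, hlq⟩ := hthird p hp q hq
    obtain ⟨t, ht, e⟩ := hS p q l hp hq hl h hlp hlq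
    have hne := hD4 _ _ _ (hmem p hp) (hmem q hq) (hmem l hl)
      (linearIndependent_triple hray h hlp hlq)
    have : S p q ≠ 0 := by rw [e]; exact mul_ne_zero ht.ne' hne
    rcases lt_or_gt_of_ne this with h0 | h0
    · right; simp [sign_neg h0]
    · left; simp [sign_pos h0]
  · obtain ⟨l₀, hl₀, hl₀p, -⟩ := hthird p hp p hp
    obtain ⟨fp, hfp⟩ := hray p
    obtain ⟨q, hq, hpq, -⟩ := exists_adj_mem hray hf hp (-fp)
      (by simp [hfp.zero (Set.mem_singleton p)])
      ⟨l₀, hl₀, by simpa using hfp.pos (by simpa using hl₀p)⟩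
    obtain ⟨l₁, hl₁, hl₁p, hl₁q⟩ := hthird p hp q hq
    obtain ⟨g, hg⟩ := hpq.2
    obtain ⟨q', hq', hpq', hneg⟩ := exists_adj_mem hray hf hp (-g)
      (by simp [hg.zero (show p ∈ ({p, q} : Set K) by simp)])
      ⟨l₁, hl₁, by simpa using hg.pos (by simp [hl₁p, hl₁q])⟩
    have hqq' : q' ≠ q := by
      rintro rfl
      simp [hg.zero (show q' ∈ ({p, q'} : Set K) by simp)] at hneg
    refine ⟨q, hq, q', hq', hpq, hpq', hqq', ?_, fun l hl hpl => ?_⟩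
    -- Each of the two neighbours serves as third generator for the edge to the other one, and
    -- exchanging them changes the sign of the determinant.
    · obtain ⟨t, ht, e⟩ := hS p q q' hp hq hq' hpq hpq'.1.symm hqq'
      obtain ⟨t', ht', e'⟩ := hS p q' q hp hq' hq hpq' hpq.1.symm hqq'.symm
      change (SignType.sign (S p q) : ℤ) + (SignType.sign (S p q') : ℤ) = 0
      rw [e, e', hsgn _ _ ht, hsgn _ _ ht', hD2, Left.sign_neg]
      simp
    -- A third neighbour `l` would be strictly between `q` and `q'` modulo `p`. The functional of
    -- the edge `p l`, positive on `q` and `q'`, would be positive on `l`.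
    · by_contra! hcon
      obtain ⟨α, β, γ, e, -, -, hγ, hβ⟩ := exists_combination_of_two_adj hray h3 hpq hpq' hqq'
        hp hq hq' hl
      obtain ⟨fl, hfl⟩ := hpl.2
      have ef := congrArg fl e
      simp only [map_add, map_smul, smul_eq_mul, hfl.zero (show p ∈ ({p, l} : Set K) by simp),
        hfl.zero (show l ∈ ({p, l} : Set K) by simp), mul_zero, zero_add] at ef
      have h1 := mul_pos (hβ hpl.1.symm hcon.2) (hfl.pos (k := q) (by
        simp [hpq.1.symm, hcon.1.symm]))
      have h2 := mul_pos (hγ hpl.1.symm hcon.1) (hfl.pos (k := q') (by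
        simp [hpq'.1.symm, hcon.2.symm]))
      linarith

end Orientation

/-! ### Closed cochains on the graph of compact edges -/

section Potential

variable {E K : Type*} [AddCommGroup E] [Module ℝ E] [FiniteDimensional ℝ E] [Finite K]
  {b : K → E} (hray : ∀ j, ∃ f, CutsFace b f {j}) (hb : ∀ j, b j ≠ 0)
include hray hb

omit [FiniteDimensional ℝ E] in
/-- There is a functional which is positive on the cone and does not vanish on finitely many
given nonzero vectors. -/
lemma exists_generic_positive [Nonempty K] {ι : Type*} [Finite ι] (v : ι → E) :
    ∃ ℓ : Module.Dual ℝ E, (∀ k, 0 < ℓ (b k)) ∧ ∀ i, v i ≠ 0 → ℓ (v i) ≠ 0 := by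
  obtain ⟨p, hp⟩ : ∃ p : Module.Dual ℝ E, ∀ k, 0 < p (b k) := by
    let j := Classical.arbitrary K
    obtain ⟨f, hf⟩ := hray j
    obtain ⟨g, hg⟩ := Module.exists_dual_forall_apply_ne_zero (K := ℝ) (fun _ : Unit => b j)
      fun _ => hb j
    -- A large multiple of `f` handles all rays other than `j`; on `j`, where `f` vanishes, the
    -- second summand is the square of `g (b j)`.
    obtain ⟨T, hT, hTl⟩ := exists_large (fun k => f (b k)) (fun k => g (b j) * g (b k))
    refine ⟨T • f + g (b j) • g, fun k => ?_⟩
    simp only [LinearMap.add_apply, LinearMap.smul_apply, smul_eq_mul]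
    by_cases hk : k = j
    · rw [hk, hf.zero (Set.mem_singleton j), mul_zero, zero_add]
      exact mul_self_pos.2 (hg ())
    · exact hTl k (hf.pos (by simpa using hk))
  obtain ⟨g, hg⟩ := Module.exists_dual_forall_apply_ne_zero (K := ℝ)
    (fun i : {i // v i ≠ 0} => v i) fun i => i.2
  obtain ⟨T, hT, hTl⟩ := exists_large (ι := K ⊕ ι) (Sum.elim (fun k => p (b k)) fun i => |p (v i)|)
    (Sum.elim (fun k => g (b k)) fun i => -|g (v i)|)
  refine ⟨T • p + g, fun k => hTl (Sum.inl k) (hp k), fun i hi => ?_⟩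
  simp only [LinearMap.add_apply, LinearMap.smul_apply, smul_eq_mul]
  by_cases h0 : p (v i) = 0
  · rw [h0, mul_zero, zero_add]
    exact hg ⟨i, hi⟩
  · have := hTl (Sum.inr i) (abs_pos.2 h0)
    simp only [Sum.elim_inr] at this
    intro hcon
    have h1 : g (v i) = -(T * p (v i)) := by linarith
    rw [h1, abs_neg, abs_mul, abs_of_pos hT] at this
    linarith

/-- A one-cochain on the graph of the compact edges of the polyhedron `[R = 1]` in a pointed cone
is a coboundary, if it is compatible with the compact two-dimensional faces. -/
lemma exists_potential {A : Type*} [AddCommGroup A] [Nonempty K] (R : Module.Dual ℝ E)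
    (hR : ∀ k, 0 ≤ R (b k)) (w : K → K → A) (hw : ∀ j k, w j k = -w k j)
    (H : ∀ f Z, CutsFace b f Z → Module.finrank ℝ (Submodule.span ℝ (b '' Z)) = 3 →
      (∀ l ∈ Z, 0 < R (b l)) → ∀ (φ : K → A), ∀ j ∈ Z, ∀ k ∈ Z, ∀ l ∈ Z, Adj b j k → Adj b j l →
      l ≠ k → (∀ p ∈ Z, ∀ q ∈ Z, Adj b p q → p ≠ j → q ≠ j → φ q - φ p = w p q) →
      φ k + w k j = φ l + w l j) :
    ∃ φ : K → A, ∀ j k, 0 < R (b j) → 0 < R (b k) → Adj b j k → φ k - φ j = w j k := by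
  classical
  have := Fintype.ofFinite K
  choose p hp using hray
  -- The first family of vectors ensures that `ℓ / R` takes distinct values at distinct vertices.
  -- The second ensures that the slopes along different edges at a vertex `j`, measured relative to
  -- `p j`, are distinct.
  obtain ⟨ℓ, hℓ, hgen⟩ := exists_generic_positive (fun j => ⟨p j, hp j⟩) hb
    (ι := (K × K) ⊕ (K × K × K))
    (Sum.elim (fun x => R (b x.2) • b x.1 - R (b x.1) • b x.2)
      (fun x => p x.1 (b x.2.2) • (R (b x.1) • b x.2.1 - R (b x.2.1) • b x.1) -
        p x.1 (b x.2.1) • (R (b x.1) • b x.2.2 - R (b x.2.2) • b x.1)))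
  have hp0 : ∀ j, p j (b j) = 0 := fun j => (hp j).zero (Set.mem_singleton j)
  have hpp : ∀ j k, k ≠ j → 0 < p j (b k) := fun j k h => (hp j).pos (by simpa using h)
  have hgen1 : ∀ j k, j ≠ k → 0 < R (b j) →
      R (b k) * ℓ (b j) ≠ R (b j) * ℓ (b k) := by
    intro j k hjk hj heq
    refine hgen (Sum.inl (j, k)) (fun h0 => ?_) ?_
    · have := congrArg (p j) h0
      simp only [Sum.elim_inl, map_sub, map_smul, smul_eq_mul, hp0, map_zero, mul_zero,
        zero_sub, neg_eq_zero] at this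
      exact (mul_pos hj (hpp j k hjk.symm)).ne' this
    · simp only [Sum.elim_inl, map_sub, map_smul, smul_eq_mul]
      linarith
  have hgen2 : ∀ j k l, k ≠ j → l ≠ j → k ≠ l → 0 < R (b j) →
      p j (b l) * (R (b j) * ℓ (b k) - R (b k) * ℓ (b j)) ≠
        p j (b k) * (R (b j) * ℓ (b l) - R (b l) * ℓ (b j)) := by
    intro j k l hk hl hkl hj heq
    refine hgen (Sum.inr (j, k, l)) (fun h0 => ?_) ?_
    · simp only [Sum.elim_inr] at h0
      have hA := mul_pos (hpp j l hl) hj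
      have hB := mul_pos (hpp j k hk) hj
      have e1 := congrArg (p k) h0
      have e2 := congrArg (p l) h0
      simp only [map_sub, map_smul, smul_eq_mul, hp0, map_zero, mul_zero] at e1 e2
      have h1 := hpp k l hkl.symm
      have h2 := hpp k j hk.symm
      have h3 := hpp l k hkl
      have h4 := hpp l j hl.symm
      rcases le_total (p j (b k) * R (b l)) (p j (b l) * R (b k)) with hc | hc
      · nlinarith [mul_pos hB h1, mul_le_mul_of_nonneg_right hc h2.le]
      · nlinarith [mul_pos hA h3, mul_le_mul_of_nonneg_right hc h4.le]
    · simp only [Sum.elim_inr, map_sub, map_smul, smul_eq_mul]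
      linarith
  let ρ : K → ℝ := fun j => ℓ (b j) / R (b j)
  -- The vertices are added in the order of `ρ`. The potential on lower vertices must be extended to
  -- each new vertex `a`.
  suffices ∀ S : Finset K, (∀ x ∈ S, ∀ y, ρ y < ρ x → y ∈ S) → ∃ φ : K → A, ∀ j ∈ S, ∀ k ∈ S,
      0 < R (b j) → 0 < R (b k) → Adj b j k → φ k - φ j = w j k by
    obtain ⟨φ, hφ⟩ := this Finset.univ fun _ _ _ _ => Finset.mem_univ _
    exact ⟨φ, fun j k => hφ j (Finset.mem_univ _) k (Finset.mem_univ _)⟩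
  intro S
  induction S using Finset.induction_on_max_value ρ with
  | empty => exact fun _ => ⟨0, by simp⟩
  | insert a S ha hmax ih =>
    intro hdown
    obtain ⟨φ, hφ⟩ := ih fun x hx y hy => by
      rcases Finset.mem_insert.1 (hdown x (Finset.mem_insert_of_mem hx) y hy) with rfl | h
      · exact absurd (hmax x hx) (not_le.2 hy)
      · exact h
    by_cases hRa : R (b a) = 0
    · refine ⟨φ, fun j hj k hk hRj hRk => hφ j ?_ k ?_ hRj hRk⟩
      · exact (Finset.mem_insert.1 hj).resolve_left fun h => by
          rw [h, hRa] at hRj; exact lt_irrefl _ hRj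
      · exact (Finset.mem_insert.1 hk).resolve_left fun h => by
          rw [h, hRa] at hRk; exact lt_irrefl _ hRk
    have hRa : 0 < R (b a) := lt_of_le_of_ne (hR a) (Ne.symm hRa)
    -- This functional vanishes at `a` and is negative exactly on generators of vertices below `a`.
    -- On unbounded directions it is positive since `ℓ` is, so only compact faces lie below `a`.
    let g : Module.Dual ℝ E := R (b a) • ℓ - ℓ (b a) • R
    have hg : ∀ k, g (b k) = R (b a) * ℓ (b k) - R (b k) * ℓ (b a) := fun k => by
      simp [g, mul_comm]
    have hga : g (b a) = 0 := by rw [hg]; ring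
    have hgR : ∀ k, g (b k) < 0 → 0 < R (b k) := fun k hk => by
      refine lt_of_le_of_ne (hR k) fun h0 => ?_
      rw [hg, ← h0, zero_mul, sub_zero] at hk
      exact absurd (mul_pos hRa (hℓ k)) (not_lt.2 hk.le)
    have hgS : ∀ k, g (b k) < 0 → k ∈ S := fun k hk => by
      have hka : k ≠ a := by rintro rfl; rw [hga] at hk; exact lt_irrefl _ hk
      refine (Finset.mem_insert.1 (hdown a (Finset.mem_insert_self _ _) k ?_)).resolve_left hka
      rw [hg] at hk
      simp only [ρ]
      rw [div_lt_div_iff₀ (hgR k (by rw [hg]; exact hk)) hRa]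
      linarith
    have hSg : ∀ k ∈ S, 0 < R (b k) → g (b k) < 0 := fun k hk hRk => by
      have h1 := hmax k hk
      simp only [ρ] at h1
      rw [div_le_div_iff₀ hRk hRa] at h1
      have h2 := hgen1 a k (by rintro rfl; exact ha hk) hRa
      rw [hg]
      have h3 : ℓ (b k) * R (b a) ≠ ℓ (b a) * R (b k) := fun h => h2 (by linarith)
      have := lt_of_le_of_ne h1 h3
      linarith
    -- All lower neighbours prescribe the same value at `a`. On the vertex figure `p a = 1`, `g`
    -- becomes `θ`. From a bad lower neighbour `k` with least `θ`, a three-dimensional face through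
    -- the edge `a k` leads to a lower neighbour with smaller `θ`; that one is good, and `H` on this
    -- face carries the value over to `k`.
    obtain ⟨c, hc⟩ : ∃ c, ∀ k, Adj b a k → g (b k) < 0 → φ k + w k a = c := by
      let Nb : Finset K := Finset.univ.filter fun k => Adj b a k ∧ g (b k) < 0
      have hNb : ∀ k, k ∈ Nb ↔ Adj b a k ∧ g (b k) < 0 := fun k => by simp [Nb]
      let θ : K → ℝ := fun k => g (b k) / p a (b k)
      rcases Nb.eq_empty_or_nonempty with hN | hN
      · exact ⟨0, fun k h1 h2 => absurd ((hNb k).2 ⟨h1, h2⟩) (by simp [hN])⟩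
      obtain ⟨k₀, hk₀, hk₀min⟩ := Finset.exists_min_image Nb θ hN
      refine ⟨φ k₀ + w k₀ a, ?_⟩
      by_contra! hcon
      let Bad : Finset K := Nb.filter fun k => φ k + w k a ≠ φ k₀ + w k₀ a
      have hBad : Bad.Nonempty := by
        obtain ⟨k, h1, h2, h3⟩ := hcon
        exact ⟨k, Finset.mem_filter.2 ⟨(hNb k).2 ⟨h1, h2⟩, h3⟩⟩
      obtain ⟨k, hkB, hkmin⟩ := Finset.exists_min_image Bad θ hBad
      obtain ⟨hkN, hkne⟩ := Finset.mem_filter.1 hkB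
      obtain ⟨hak, hgk⟩ := (hNb k).1 hkN
      obtain ⟨hak₀, hgk₀⟩ := (hNb k₀).1 hk₀
      have hkk₀ : k ≠ k₀ := by rintro rfl; exact hkne rfl
      have hpk := hpp a k hak.1.symm
      have hpk₀ := hpp a k₀ hak₀.1.symm
      have hlt : p a (b k) * g (b k₀) < p a (b k₀) * g (b k) := by
        have h1 := hk₀min k hkN
        simp only [θ] at h1
        rw [div_le_div_iff₀ hpk₀ hpk] at h1
        have h2 := hgen2 a k k₀ hak.1.symm hak₀.1.symm hkk₀ hRa
        rw [← hg, ← hg] at h2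
        exact lt_of_le_of_ne (by linarith) h2.symm
      -- It compares slopes with that of `k`: for `l ≠ a`, `g' (b l) < 0` means `θ l < θ k`.
      let g' : Module.Dual ℝ E := p a (b k) • g - g (b k) • p a
      have hg' : ∀ l, g' (b l) = p a (b k) * g (b l) - g (b k) * p a (b l) := fun l => by
        simp [g']
      obtain ⟨f, Z, l, hf, haZ, hkZ, hlZ, hal, hlk, hgl, h3⟩ := exists_threeFace
        (fun j => ⟨p j, hp j⟩) hak g' (by rw [hg', hga, hp0]; ring) (by rw [hg']; ring)
        ⟨k₀, by rw [hg']; linarith⟩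
      rw [hg'] at hgl
      have hpl := hpp a l hal.1.symm
      have hgl0 : g (b l) < 0 := by
        by_contra h0
        push Not at h0
        nlinarith [mul_nonneg hpk.le h0, mul_pos (neg_pos.2 hgk) hpl]
      have hθ : θ l < θ k := by
        simp only [θ]
        rw [div_lt_div_iff₀ hpl hpk]
        linarith
      have hl : φ l + w l a = φ k₀ + w k₀ a := by
        by_contra hne
        exact absurd (hkmin l (Finset.mem_filter.2 ⟨(hNb l).2 ⟨hal, hgl0⟩, hne⟩)) (not_le.2 hθ)
      -- The face is contained in the angle spanned by its two edges at `a`, both of which descend.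
      -- So all its other vertices are below `a`, and the face is compact.
      have hZ : ∀ m ∈ Z, m ≠ a → g (b m) < 0 := by
        intro m hm hma
        obtain ⟨α, β, γ, e, hβ, hγ, h1, h2⟩ := exists_combination_of_two_adj
          (fun j => ⟨p j, hp j⟩) h3 hak hal hlk haZ hkZ hlZ hm
        by_cases hmk : m = k
        · rw [hmk]; exact hgk
        · have := congrArg g e
          simp only [map_add, map_smul, smul_eq_mul, hga, mul_zero, zero_add] at this
          rw [this]
          nlinarith [mul_pos (h1 hma hmk) (neg_pos.2 hgl0), mul_nonneg hβ (neg_pos.2 hgk).le]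
      refine hkne ((H f Z hf h3 (fun m hm => ?_) φ a haZ k hkZ l hlZ hak hal hlk
        fun x hx y hy hxy hxa hya => ?_).trans hl)
      · by_cases hma : m = a
        · rw [hma]; exact hRa
        · exact hgR m (hZ m hm hma)
      · exact hφ x (hgS x (hZ x hx hxa)) y (hgS y (hZ y hy hya)) (hgR x (hZ x hx hxa))
          (hgR y (hZ y hy hya)) hxy
    refine ⟨Function.update φ a c, fun j hj k hk hRj hRk hjk => ?_⟩
    rcases Finset.mem_insert.1 hj with rfl | hj' <;> rcases Finset.mem_insert.1 hk with rfl | hk'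
    · exact absurd rfl hjk.1
    · rw [Function.update_self, Function.update_of_ne hjk.1.symm, ← hc k hjk (hSg k hk' hRk),
        hw j k]
      abel
    · rw [Function.update_self, Function.update_of_ne hjk.1, ← hc j hjk.symm (hSg j hj' hRj)]
      abel
    · rw [Function.update_of_ne (ne_of_mem_of_not_mem hj' ha),
        Function.update_of_ne (ne_of_mem_of_not_mem hk' ha)]
      exact hφ j hj' k hk' hRj hRk hjk

end Potential

/-! ### Pairings, primitive vectors and extreme points -/

/-- The pairing with `m ∈ M` as a linear functional on `N_ℝ`. -/
def pairL {n : ℕ} (m : Fin n → ℤ) : Module.Dual ℝ (Fin n → ℝ) :=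
  ∑ i, (m i : ℝ) • LinearMap.proj i

lemma pairL_apply {n : ℕ} (m : Fin n → ℤ) (x : Fin n → ℝ) : pairL m x = pair x m := by
  simp [pairL, pair, LinearMap.sum_apply, mul_comm]

lemma pairL_add {n : ℕ} (m m' : Fin n → ℤ) : pairL (m + m') = pairL m + pairL m' := by
  simp [pairL, add_smul, Finset.sum_add_distrib]

lemma pairL_zsmul {n : ℕ} (k : ℤ) (m : Fin n → ℤ) : pairL (k • m) = (k : ℝ) • pairL m := by
  simp [pairL, Finset.smul_sum, smul_smul]

lemma IsPrimitive.ne_zero {n : ℕ} {x : Fin n → ℤ} (h : IsPrimitive x) : x ≠ 0 := by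
  rintro rfl
  have := h 2 0 (by simp)
  rw [Int.isUnit_iff] at this
  omega

/-- The ratio `μ` is rational. In lowest terms its numerator divides `x` and its denominator divides
`y`, so primitivity makes both equal to one. -/
lemma IsPrimitive.eq_of_smul {n : ℕ} {x y : Fin n → ℤ} (hx : IsPrimitive x) (hy : IsPrimitive y)
    {μ : ℝ} (hμ : 0 ≤ μ) (h : toR x = μ • toR y) : x = y := by
  have hi : ∀ i, (x i : ℝ) = μ * y i := fun i => congrFun h i
  obtain ⟨i₀, hi₀⟩ : ∃ i, y i ≠ 0 := by
    by_contra! hcon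
    exact hy.ne_zero (funext hcon)
  obtain ⟨i₁, hi₁⟩ : ∃ i, x i ≠ 0 := by
    by_contra! hcon
    exact hx.ne_zero (funext hcon)
  have hμ0 : 0 < μ := by
    refine lt_of_le_of_ne hμ fun h0 => hi₁ ?_
    have := hi i₁
    rw [← h0, zero_mul] at this
    exact_mod_cast this
  let q : ℚ := x i₀ / y i₀
  have hq : (q : ℝ) = μ := by
    have := hi i₀
    simp only [q]
    push_cast
    rw [this]
    field_simp
  have hq0 : 0 < q := by exact_mod_cast hq ▸ hμ0
  have hden : ∀ i, (q.den : ℤ) * x i = q.num * y i := by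
    intro i
    have h1 := hi i
    rw [← hq] at h1
    have h2 : (x i : ℚ) = q * y i := by exact_mod_cast h1
    have h3 : (q.den : ℚ) * x i = q.num * y i := by
      rw [h2, ← mul_assoc, mul_comm (q.den : ℚ) q, Rat.mul_den_eq_num]
    exact_mod_cast h3
  have hcop : IsCoprime (q.num) (q.den : ℤ) := by
    rw [Int.isCoprime_iff_nat_coprime]
    exact q.reduced
  have h1 : ∀ i, q.num ∣ x i := fun i => hcop.dvd_of_dvd_mul_left (Dvd.intro _ (hden i).symm)
  have h2 : ∀ i, (q.den : ℤ) ∣ y i := fun i =>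
    hcop.symm.dvd_of_dvd_mul_left (Dvd.intro _ (hden i))
  choose x' hx' using h1
  choose y' hy' using h2
  have hu := hx q.num x' (funext hx')
  have hu' := hy q.den y' (funext hy')
  have e1 : q.num = 1 := by
    have : 0 < q.num := Rat.num_pos.2 hq0
    rcases Int.isUnit_iff.1 hu with h | h <;> omega
  have e2 : (q.den : ℤ) = 1 := by
    have : 0 < q.den := q.den_pos
    rcases Int.isUnit_iff.1 hu' with h | h <;> omega
  funext i
  have := hden i
  rwa [e1, e2, one_mul, one_mul] at this

lemma exists_extreme_step {E : Type*} [AddCommGroup E] [Module ℝ E] {A : Set E} {v w : E}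
    (hv : v ∈ A.extremePoints ℝ) {δ : ℝ} (hδ : 0 < δ) (h1 : v + δ • w ∈ A)
    (h2 : v - δ • w ∈ A) : w = 0 := by
  have hmem : v ∈ openSegment ℝ (v + δ • w) (v - δ • w) := by
    refine ⟨1 / 2, 1 / 2, by norm_num, by norm_num, by norm_num, ?_⟩
    rw [← smul_add]
    simp only [add_add_sub_cancel]
    rw [← two_smul ℝ v, smul_smul]
    norm_num
  have := hv.2 h1 h2 hmem
  have h3 : δ • w = 0 := by simpa using this
  exact (smul_eq_zero.1 h3).resolve_left hδ.ne'

lemma left_mem_extremePoints_segment {E : Type*} [AddCommGroup E] [Module ℝ E] (u v : E) :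
    u ∈ (segment ℝ u v).extremePoints ℝ := by
  by_cases huv : u = v
  · subst huv
    refine ⟨left_mem_segment ℝ u u, fun x hx y hy _ => ?_⟩
    simpa using hx
  refine ⟨left_mem_segment ℝ u v, ?_⟩
  rintro x hx y hy ⟨α, β, hα, hβ, hαβ, e⟩
  rw [segment_eq_image'] at hx hy
  obtain ⟨s, ⟨hs, -⟩, rfl⟩ := hx
  obtain ⟨t, ⟨ht, -⟩, rfl⟩ := hy
  have : (α * s + β * t) • (v - u) = 0 := by
    have h1 : α • (u + s • (v - u)) + β • (u + t • (v - u)) =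
        (α + β) • u + (α * s + β * t) • (v - u) := by module
    simp only at e
    rw [h1, hαβ, one_smul] at e
    simpa using e
  have h2 := (smul_eq_zero.1 this).resolve_right (sub_ne_zero.2 (Ne.symm huv))
  have h3 : s = 0 := by
    have h4 := mul_nonneg hα.le hs
    have h5 := mul_nonneg hβ.le ht
    have h6 : α * s = 0 := by linarith
    exact (mul_eq_zero.1 h6).resolve_left hα.ne'
  simp [h3]

/-! ### Vertices and compact edges of Q in terms of the generators of σ -/

namespace Setting

variable {n r N : ℕ} (D : Setting n r N)

/-- The fundamental generators as real vectors. -/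
def ray (j : Fin r) : Fin n → ℝ := toR (D.a j)

/-- The height of a fundamental generator. -/
def ht (j : Fin r) : ℝ := pairL D.R (D.ray j)

/-- The vertex of `Q` on a ray of positive height. -/
def vtx (j : Fin r) : Fin n → ℝ := (D.ht j)⁻¹ • D.ray j

lemma mem_sigma {x : Fin n → ℝ} :
    x ∈ D.sigma ↔ ∃ μ : Fin r → ℝ, (∀ j, 0 ≤ μ j) ∧ x = ∑ j, μ j • D.ray j := Iff.rfl

lemma add_mem_sigma {x y : Fin n → ℝ} (hx : x ∈ D.sigma) (hy : y ∈ D.sigma) :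
    x + y ∈ D.sigma := by
  obtain ⟨μ, hμ, rfl⟩ := hx
  obtain ⟨ν, hν, rfl⟩ := hy
  exact ⟨μ + ν, fun j => add_nonneg (hμ j) (hν j), by simp [add_smul, Finset.sum_add_distrib]⟩

lemma smul_mem_sigma {x : Fin n → ℝ} (hx : x ∈ D.sigma) {s : ℝ} (hs : 0 ≤ s) :
    s • x ∈ D.sigma := by
  obtain ⟨μ, hμ, rfl⟩ := hx
  exact ⟨s • μ, fun j => mul_nonneg hs (hμ j), by simp [Finset.smul_sum, smul_smul]⟩

lemma ray_mem_sigma (j : Fin r) : D.ray j ∈ D.sigma := by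
  classical
  refine ⟨Pi.single j 1, fun k => ?_, ?_⟩
  · by_cases h : k = j
    · subst h; simp
    · simp [h]
  · rw [Finset.sum_eq_single j]
    · simp [ray]
    · intro k _ hk; simp [hk]
    · simp

lemma mem_Q {x : Fin n → ℝ} : x ∈ D.Q ↔ x ∈ D.sigma ∧ pairL D.R x = 1 := by
  rw [pairL_apply]; exact Iff.rfl

lemma mem_tail {x : Fin n → ℝ} : x ∈ D.tail ↔ x ∈ D.sigma ∧ pairL D.R x = 0 := by
  rw [pairL_apply]; exact Iff.rfl

lemma convex_Q : Convex ℝ D.Q := by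
  intro x hx y hy α β hα hβ h
  rw [mem_Q] at *
  refine ⟨D.add_mem_sigma (D.smul_mem_sigma hx.1 hα) (D.smul_mem_sigma hy.1 hβ), ?_⟩
  simp [hx.2, hy.2, h]

lemma ht_nonneg (j : Fin r) : 0 ≤ D.ht j := by
  rw [ht, pairL_apply]; exact D.R_nonneg _ (D.ray_mem_sigma j)

lemma ray_ne_zero (j : Fin r) : D.ray j ≠ 0 := fun h => (D.a_primitive j).ne_zero (by
  funext i
  have : (D.a j i : ℝ) = 0 := congrFun h i
  exact_mod_cast this)

/-- The exposing functional attains its maximum over the cone at 0, so it is nonpositive. A second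
generator in its zero set would be a multiple of `a j`, hence equal to it by primitivity. -/
lemma exists_cutsFace_ray (j : Fin r) : ∃ f, CutsFace D.ray f {j} := by
  obtain ⟨l, hl⟩ := D.a_ray j ⟨0, fun _ => 0, fun _ => le_rfl, by simp⟩
  have hgen : ∀ x, x ∈ genCone ![D.a j] ↔ ∃ μ : ℝ, 0 ≤ μ ∧ x = μ • D.ray j := by
    intro x
    constructor
    · rintro ⟨μ, hμ, rfl⟩
      exact ⟨μ 0, hμ 0, by simp [ray]⟩
    · rintro ⟨μ, hμ, rfl⟩
      exact ⟨fun _ => μ, fun _ => hμ, by simp [ray]⟩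
  have h0 : ∀ y ∈ D.sigma, l y ≤ 0 := by
    have : (0 : Fin n → ℝ) ∈ genCone ![D.a j] := (hgen 0).2 ⟨0, le_rfl, by simp⟩
    rw [hl] at this
    intro y hy
    have h1 := this.2 y hy
    rwa [map_zero] at h1
  refine ⟨-l.toLinearMap, fun k => by simpa using h0 _ (D.ray_mem_sigma k), fun k => ?_⟩
  simp only [LinearMap.neg_apply, neg_eq_zero, Set.mem_singleton_iff]
  constructor
  · intro hk
    have hk' : l (D.ray k) = 0 := hk
    have : D.ray k ∈ genCone ![D.a j] := by
      rw [hl]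
      exact ⟨D.ray_mem_sigma k, fun y hy => by rw [hk']; exact h0 y hy⟩
    obtain ⟨μ, hμ, e⟩ := (hgen _).1 this
    exact D.a_injective ((D.a_primitive k).eq_of_smul (D.a_primitive j) hμ e)
  · rintro rfl
    have : D.ray k ∈ genCone ![D.a k] := (hgen _).2 ⟨1, zero_le_one, by simp⟩
    rw [hl] at this
    have h1 := this.2 0 ⟨0, fun _ => le_rfl, by simp⟩
    rw [map_zero] at h1
    exact le_antisymm (h0 _ this.1) h1

lemma vtx_mem_sigma (j : Fin r) : D.vtx j ∈ D.sigma :=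
  D.smul_mem_sigma (D.ray_mem_sigma j) (inv_nonneg.2 (D.ht_nonneg j))

lemma ht_smul_vtx {j : Fin r} (h : 0 < D.ht j) : D.ht j • D.vtx j = D.ray j := by
  rw [vtx, smul_smul, mul_inv_cancel₀ h.ne', one_smul]

lemma vtx_mem_Q {j : Fin r} (h : 0 < D.ht j) : D.vtx j ∈ D.Q := by
  rw [mem_Q]
  refine ⟨D.vtx_mem_sigma j, ?_⟩
  rw [vtx, map_smul, smul_eq_mul]
  exact inv_mul_cancel₀ h.ne'

lemma ht_origin : D.ht D.origin = 1 := by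
  rw [ht, pairL_apply]; exact D.origin_height

lemma vtx_origin : D.vtx D.origin = D.o := by
  rw [vtx, ht_origin, inv_one, one_smul]; rfl

lemma apply_vtx_eq_zero {j : Fin r} (h : 0 < D.ht j) (f : Module.Dual ℝ (Fin n → ℝ)) :
    f (D.vtx j) = 0 ↔ f (D.ray j) = 0 := by
  rw [vtx, map_smul, smul_eq_mul, mul_eq_zero]
  exact or_iff_right (inv_ne_zero h.ne')

lemma apply_nonneg_of_sigma {f : Module.Dual ℝ (Fin n → ℝ)} (hf : ∀ k, 0 ≤ f (D.ray k))
    {x : Fin n → ℝ} (hx : x ∈ D.sigma) : 0 ≤ f x := by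
  obtain ⟨μ, hμ, rfl⟩ := hx
  rw [map_sum]
  exact Finset.sum_nonneg fun k _ => by
    rw [map_smul]; exact mul_nonneg (hμ k) (hf k)

/-- A point of a face is a combination of the generators in this face. -/
lemma exists_combination_of_face {f : Module.Dual ℝ (Fin n → ℝ)} {Z : Set (Fin r)}
    (hf : CutsFace D.ray f Z) {x : Fin n → ℝ} (hx : x ∈ D.sigma) (h0 : f x = 0) :
    ∃ μ : Fin r → ℝ, (∀ j, 0 ≤ μ j) ∧ (∀ j, j ∉ Z → μ j = 0) ∧ x = ∑ j, μ j • D.ray j := by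
  obtain ⟨μ, hμ, rfl⟩ := hx
  refine ⟨μ, hμ, fun j hj => ?_, rfl⟩
  rw [map_sum] at h0
  have := (Finset.sum_eq_zero_iff_of_nonneg (fun k _ => by
    change 0 ≤ f (μ k • D.ray k)
    rw [map_smul]; exact mul_nonneg (hμ k) (hf.1 k))).1 h0 j (Finset.mem_univ j)
  rw [map_smul, smul_eq_mul] at this
  exact (mul_eq_zero.1 this).resolve_right (hf.pos hj).ne'

lemma vtx_injOn {j k : Fin r} (hj : 0 < D.ht j) (h : D.vtx j = D.vtx k) : j = k := by
  obtain ⟨f, hf⟩ := D.exists_cutsFace_ray k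
  by_contra hne
  have h1 : f (D.vtx k) = 0 := by
    rw [vtx, map_smul, hf.zero (Set.mem_singleton k), smul_zero]
  rw [← h, D.apply_vtx_eq_zero hj] at h1
  exact (hf.pos (by simpa using hne)).ne' h1

lemma vtx_extreme {j : Fin r} (h : 0 < D.ht j) : D.vtx j ∈ D.Q.extremePoints ℝ := by
  refine ⟨D.vtx_mem_Q h, fun x hx y hy hxy => ?_⟩
  obtain ⟨f, hf⟩ := D.exists_cutsFace_ray j
  have hfv : f (D.vtx j) = 0 := (D.apply_vtx_eq_zero h f).2 (hf.zero (Set.mem_singleton j))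
  rw [mem_Q] at hx hy
  obtain ⟨α, β, hα, hβ, -, e⟩ := hxy
  have e1 := congrArg f e
  rw [hfv, map_add, map_smul, map_smul, smul_eq_mul, smul_eq_mul] at e1
  have h1 := D.apply_nonneg_of_sigma hf.1 hx.1
  have h2 := D.apply_nonneg_of_sigma hf.1 hy.1
  have h3 : f x = 0 := by
    have := mul_nonneg hβ.le h2
    have h4 : α * f x = 0 := le_antisymm (by linarith) (mul_nonneg hα.le h1)
    exact (mul_eq_zero.1 h4).resolve_left hα.ne'
  obtain ⟨μ, -, hμ, rfl⟩ := D.exists_combination_of_face hf hx.1 h3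
  rw [Finset.sum_eq_single j (fun k _ hk => by rw [hμ k (by simpa using hk), zero_smul])
    (by simp)] at hx ⊢
  have h5 := hx.2
  rw [map_smul, smul_eq_mul] at h5
  have h6 : μ j = (D.ht j)⁻¹ := eq_inv_of_mul_eq_one_left h5
  rw [vtx, ← h6]

lemma exists_vtx_of_extreme {v : Fin n → ℝ} (hv : v ∈ D.Q.extremePoints ℝ) :
    ∃ j, 0 < D.ht j ∧ v = D.vtx j := by
  classical
  have hvQ := D.mem_Q.1 hv.1
  obtain ⟨μ, hμ, e⟩ := D.mem_sigma.1 hvQ.1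
  have h1 : ∑ j, μ j * D.ht j = 1 := by
    rw [← hvQ.2, e, map_sum]
    exact Finset.sum_congr rfl fun j _ => by rw [map_smul]; rfl
  obtain ⟨j, hj⟩ : ∃ j, 0 < μ j * D.ht j := by
    by_contra! hcon
    have : ∑ j, μ j * D.ht j ≤ 0 := Finset.sum_nonpos fun j _ => hcon j
    linarith
  have hht : 0 < D.ht j := pos_of_mul_pos_right hj (hμ j)
  have hμj : 0 < μ j := pos_of_mul_pos_left hj hht.le
  have hle : μ j * D.ht j ≤ 1 := by
    rw [← h1]
    exact Finset.single_le_sum (f := fun j => μ j * D.ht j)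
      (fun k _ => mul_nonneg (hμ k) (D.ht_nonneg k)) (Finset.mem_univ j)
  refine ⟨j, hht, ?_⟩
  -- As `vtx j` occurs in `v` with positive weight, one can move from `v` both towards `vtx j` and
  -- away from it inside `Q`.
  have := exists_extreme_step (w := D.vtx j - v) hv hj ?_ ?_
  · exact (sub_eq_zero.1 this).symm
  · have := D.convex_Q hv.1 (D.vtx_mem_Q hht) (sub_nonneg.2 hle) hj.le (by ring)
    convert this using 1
    module
  · have hvv : v - (μ j * D.ht j) • (D.vtx j - v) =
        (μ j * D.ht j) • v + (v - μ j • D.ray j) := by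
      rw [← D.ht_smul_vtx hht]; module
    have hmem : v - μ j • D.ray j ∈ D.sigma := by
      refine ⟨Function.update μ j 0, fun k => ?_, ?_⟩
      · by_cases hk : k = j
        · subst hk; simp
        · simp [hk, hμ k]
      · have h2 : ∑ k, Function.update μ j 0 k • D.ray k =
            (∑ k, μ k • D.ray k) - μ j • D.ray j := by
          rw [eq_sub_iff_add_eq, ← Finset.add_sum_erase _ _ (Finset.mem_univ j),
            ← Finset.add_sum_erase (a := j) _ (fun k => μ k • D.ray k) (Finset.mem_univ j)]
          rw [Function.update_self, zero_smul, zero_add, add_comm]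
          congr 1
          refine Finset.sum_congr rfl fun k hk => ?_
          rw [Function.update_of_ne (Finset.ne_of_mem_erase hk)]
        exact (h2.trans (by rw [← e])).symm
    rw [hvv, mem_Q]
    refine ⟨D.add_mem_sigma (D.smul_mem_sigma hvQ.1 hj.le) hmem, ?_⟩
    rw [map_add, map_sub, map_smul, map_smul, hvQ.2]
    change μ j * D.ht j * 1 + (1 - μ j * D.ht j) = 1
    ring

/-- Linear functionals as continuous functionals. -/
def cont (f : Module.Dual ℝ (Fin n → ℝ)) : StrongDual ℝ (Fin n → ℝ) :=
  LinearMap.toContinuousLinearMap f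

lemma cont_apply (f : Module.Dual ℝ (Fin n → ℝ)) (x : Fin n → ℝ) : cont f x = f x := rfl

lemma isExposed_face {f : Module.Dual ℝ (Fin n → ℝ)} {Z : Set (Fin r)} (hf : CutsFace D.ray f Z)
    {j : Fin r} (hj : 0 < D.ht j) (hjZ : j ∈ Z) : IsExposed ℝ D.Q {x ∈ D.Q | f x = 0} := by
  intro _
  refine ⟨cont (-f), ?_⟩
  have hv : f (D.vtx j) = 0 := (D.apply_vtx_eq_zero hj f).2 (hf.zero hjZ)
  ext x
  simp only [Set.mem_ofPred_eq, cont_apply, LinearMap.neg_apply, neg_le_neg_iff]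
  refine and_congr_right fun hx => ⟨fun h y hy => ?_, fun h => ?_⟩
  · rw [h]; exact D.apply_nonneg_of_sigma hf.1 (D.mem_Q.1 hy).1
  · exact le_antisymm ((h _ (D.vtx_mem_Q hj)).trans hv.le)
      (D.apply_nonneg_of_sigma hf.1 (D.mem_Q.1 hx).1)

lemma face_eq_segment {f : Module.Dual ℝ (Fin n → ℝ)} {j k : Fin r} (hjk : j ≠ k)
    (hf : CutsFace D.ray f {j, k}) (hj : 0 < D.ht j) (hk : 0 < D.ht k) :
    {x ∈ D.Q | f x = 0} = segment ℝ (D.vtx j) (D.vtx k) := by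
  have hvj : f (D.vtx j) = 0 := (D.apply_vtx_eq_zero hj f).2 (hf.zero (by simp))
  have hvk : f (D.vtx k) = 0 := (D.apply_vtx_eq_zero hk f).2 (hf.zero (by simp))
  ext x
  constructor
  · rintro ⟨hx, h0⟩
    rw [mem_Q] at hx
    obtain ⟨μ, hμ, hμ0, e⟩ := D.exists_combination_of_face hf hx.1 h0
    have e' : x = μ j • D.ray j + μ k • D.ray k := by
      rw [e, ← Finset.sum_pair (f := fun l => μ l • D.ray l) hjk]
      refine (Finset.sum_subset (Finset.subset_univ _) fun l _ hl => ?_).symm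
      rw [hμ0 l (by simpa using hl), zero_smul]
    have h1 := hx.2
    rw [e', map_add, map_smul, map_smul] at h1
    refine ⟨μ j * D.ht j, μ k * D.ht k, mul_nonneg (hμ j) hj.le, mul_nonneg (hμ k) hk.le, h1, ?_⟩
    rw [mul_smul, mul_smul, D.ht_smul_vtx hj, D.ht_smul_vtx hk, e']
  · intro hx
    refine ⟨D.convex_Q.segment_subset (D.vtx_mem_Q hj) (D.vtx_mem_Q hk) hx, ?_⟩
    obtain ⟨α, β, -, -, -, rfl⟩ := hx
    simp [hvj, hvk]

lemma exists_edge_of_adj {j k : Fin r} (h : Adj D.ray j k) (hj : 0 < D.ht j) (hk : 0 < D.ht k) :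
    ∃ i, (D.src i = D.vtx j ∧ D.tgt i = D.vtx k) ∨ (D.src i = D.vtx k ∧ D.tgt i = D.vtx j) := by
  obtain ⟨hjk, f, hf⟩ := h
  have hseg := D.face_eq_segment hjk hf hj hk
  have hexp := D.isExposed_face hf hj (by simp)
  have hne : D.vtx j ≠ D.vtx k := fun h => hjk (D.vtx_injOn hj h)
  rw [hseg] at hexp
  obtain ⟨i, hi⟩ := (D.edge_iff _).1 ⟨hexp, _, _, hne, rfl⟩
  have hsub : segment ℝ (D.src i) (D.tgt i) ⊆ D.Q := by
    rw [← hi]; exact D.convex_Q.segment_subset (D.vtx_mem_Q hj) (D.vtx_mem_Q hk)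
  have hs := hsub (left_mem_segment ℝ _ _)
  have ht := hsub (right_mem_segment ℝ _ _)
  have hmj : D.vtx j ∈ segment ℝ (D.src i) (D.tgt i) := hi ▸ left_mem_segment ℝ _ _
  have hmk : D.vtx k ∈ segment ℝ (D.src i) (D.tgt i) := hi ▸ right_mem_segment ℝ _ _
  have h1 := (mem_extremePoints_iff_forall_segment.1 (D.vtx_extreme hj)).2 _ hs _ ht hmj
  have h2 := (mem_extremePoints_iff_forall_segment.1 (D.vtx_extreme hk)).2 _ hs _ ht hmk
  rcases h1 with h1 | h1 <;> rcases h2 with h2 | h2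
  · exact absurd (h1.symm.trans h2) hne
  · exact ⟨i, Or.inl ⟨h1, h2⟩⟩
  · exact ⟨i, Or.inr ⟨h2, h1⟩⟩
  · exact absurd (h1.symm.trans h2) hne

/-- Together with `exists_edge_of_adj`, this identifies compact edges of `Q` with the
two-dimensional faces of σ that have both generators at positive height. -/
lemma exists_adj_of_edge (i : Fin N) : ∃ j k, 0 < D.ht j ∧ 0 < D.ht k ∧ Adj D.ray j k ∧
    D.src i = D.vtx j ∧ D.tgt i = D.vtx k := by
  obtain ⟨hexp, -⟩ := (D.edge_iff (segment ℝ (D.src i) (D.tgt i))).2 ⟨i, rfl⟩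
  have hs := hexp.isExtreme.extremePoints_subset_extremePoints
    (left_mem_extremePoints_segment (D.src i) (D.tgt i))
  have ht := hexp.isExtreme.extremePoints_subset_extremePoints
    (by rw [segment_symm]; exact left_mem_extremePoints_segment (D.tgt i) (D.src i))
  obtain ⟨j, hj, ej⟩ := D.exists_vtx_of_extreme hs
  obtain ⟨k, hk, ek⟩ := D.exists_vtx_of_extreme ht
  have hjk : j ≠ k := by
    rintro rfl
    exact D.src_ne_tgt i (ej.trans ek.symm)
  refine ⟨j, k, hj, hk, ⟨hjk, ?_⟩, ej, ek⟩
  obtain ⟨l, hl⟩ := hexp ⟨_, left_mem_segment ℝ _ _⟩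
  rw [ej, ek] at hl
  have hlj : ∀ y ∈ D.Q, l y ≤ l (D.vtx j) :=
    (hl.subset (left_mem_segment ℝ (D.vtx j) (D.vtx k))).2
  have hlk : l (D.vtx k) = l (D.vtx j) := le_antisymm (hlj _ (D.vtx_mem_Q hk))
    ((hl.subset (right_mem_segment ℝ (D.vtx j) (D.vtx k))).2 _ (D.vtx_mem_Q hj))
  -- The affine inequality that exposes the edge in `Q` is homogenized by means of `R`.
  let f : Module.Dual ℝ (Fin n → ℝ) := l (D.vtx j) • pairL D.R - l.toLinearMap
  have hf : ∀ m, f (D.ray m) = l (D.vtx j) * D.ht m - l (D.ray m) := fun m => rfl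
  have hfpos : ∀ m, 0 < D.ht m → f (D.ray m) = D.ht m * (l (D.vtx j) - l (D.vtx m)) :=
    fun m hm => by
      rw [hf, vtx.eq_1 D m, map_smul, smul_eq_mul]
      field_simp
  have hadd : ∀ m, D.ht m = 0 → D.vtx j + D.ray m ∈ D.Q := fun m hm => by
    rw [mem_Q]
    refine ⟨D.add_mem_sigma (D.vtx_mem_sigma j) (D.ray_mem_sigma m), ?_⟩
    rw [map_add, (D.mem_Q.1 (D.vtx_mem_Q hj)).2]
    change 1 + D.ht m = 1
    rw [hm, add_zero]
  refine ⟨f, fun m => ?_, fun m => ⟨fun hm => ?_, ?_⟩⟩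
  · rcases (D.ht_nonneg m).eq_or_lt with h0 | h0
    · have := hlj _ (hadd m h0.symm)
      rw [map_add] at this
      rw [hf, ← h0]
      linarith
    · rw [hfpos m h0]
      exact mul_nonneg h0.le (sub_nonneg.2 (hlj _ (D.vtx_mem_Q h0)))
  · rcases (D.ht_nonneg m).eq_or_lt with h0 | h0
    -- A generator of height zero in the zero set would be `s (vtx k - vtx j)` with `s ≥ 0`, and the
    -- ray functional of `k` is nonpositive on this vector.
    · exfalso
      rw [hf, ← h0] at hm
      have hmem : D.vtx j + D.ray m ∈ segment ℝ (D.vtx j) (D.vtx k) := by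
        rw [hl]
        refine ⟨hadd m h0.symm, fun y hy => ?_⟩
        rw [map_add]
        linarith [hlj y hy]
      rw [segment_eq_image'] at hmem
      obtain ⟨s, ⟨hs0, -⟩, e⟩ := hmem
      have e' : s • (D.vtx k - D.vtx j) = D.ray m := by simpa using e
      obtain ⟨fk, hfk⟩ := D.exists_cutsFace_ray k
      have hmk : m ≠ k := by rintro rfl; exact hk.ne h0
      have e2 := congrArg fk e'
      rw [map_smul, map_sub, (D.apply_vtx_eq_zero hk fk).2 (hfk.zero (Set.mem_singleton k)),
        smul_eq_mul] at e2
      have h1 := hfk.pos (k := m) (by simpa using hmk)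
      have h2 := D.apply_nonneg_of_sigma hfk.1 (D.vtx_mem_sigma j)
      nlinarith [mul_nonneg hs0 h2]
    · rw [hfpos m h0] at hm
      have h1 := (mul_eq_zero.1 hm).resolve_left h0.ne'
      have hmem : D.vtx m ∈ segment ℝ (D.vtx j) (D.vtx k) := by
        rw [hl]
        exact ⟨D.vtx_mem_Q h0, fun y hy => by linarith [hlj y hy]⟩
      rcases (mem_extremePoints_iff_forall_segment.1 (D.vtx_extreme h0)).2 _ (D.vtx_mem_Q hj) _
        (D.vtx_mem_Q hk) hmem with h2 | h2
      · left; exact (D.vtx_injOn hj h2).symm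
      · right; exact (D.vtx_injOn hk h2).symm
  · rintro (rfl | rfl)
    · rw [hfpos m hj]; simp
    · rw [hfpos m hk, hlk]; simp

end Setting

/-! ### Compact 2-faces, sign vectors and the displaced vertices -/

namespace Setting

variable {n r N : ℕ} (D : Setting n r N)

/-- The index of the generator through the starting point of an edge. -/
def srcIdx (i : Fin N) : Fin r := (D.exists_adj_of_edge i).choose

/-- The index of the generator through the end point of an edge. -/
def tgtIdx (i : Fin N) : Fin r := (D.exists_adj_of_edge i).choose_spec.choose

lemma srcIdx_pos (i : Fin N) : 0 < D.ht (D.srcIdx i) :=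
  (D.exists_adj_of_edge i).choose_spec.choose_spec.1

lemma tgtIdx_pos (i : Fin N) : 0 < D.ht (D.tgtIdx i) :=
  (D.exists_adj_of_edge i).choose_spec.choose_spec.2.1

lemma adj_idx (i : Fin N) : Adj D.ray (D.srcIdx i) (D.tgtIdx i) :=
  (D.exists_adj_of_edge i).choose_spec.choose_spec.2.2.1

lemma src_eq (i : Fin N) : D.src i = D.vtx (D.srcIdx i) :=
  (D.exists_adj_of_edge i).choose_spec.choose_spec.2.2.2.1

lemma tgt_eq (i : Fin N) : D.tgt i = D.vtx (D.tgtIdx i) :=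
  (D.exists_adj_of_edge i).choose_spec.choose_spec.2.2.2.2

lemma idx_ne (i : Fin N) : D.srcIdx i ≠ D.tgtIdx i := (D.adj_idx i).1

lemma exists_idx_of_adj {j k : Fin r} (h : Adj D.ray j k) (hj : 0 < D.ht j) (hk : 0 < D.ht k) :
    ∃ i, (D.srcIdx i = j ∧ D.tgtIdx i = k) ∨ (D.srcIdx i = k ∧ D.tgtIdx i = j) := by
  obtain ⟨i, hi⟩ := D.exists_edge_of_adj h hj hk
  rw [src_eq, tgt_eq] at hi
  refine ⟨i, hi.imp (fun h => ?_) fun h => ?_⟩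
  · exact ⟨D.vtx_injOn (D.srcIdx_pos i) h.1, D.vtx_injOn (D.tgtIdx_pos i) h.2⟩
  · exact ⟨D.vtx_injOn (D.srcIdx_pos i) h.1, D.vtx_injOn (D.tgtIdx_pos i) h.2⟩

lemma idx_injective {i i' : Fin N}
    (h : (D.srcIdx i = D.srcIdx i' ∧ D.tgtIdx i = D.tgtIdx i') ∨
      (D.srcIdx i = D.tgtIdx i' ∧ D.tgtIdx i = D.srcIdx i')) : i = i' := by
  apply D.edge_injective
  change segment ℝ (D.src i) (D.tgt i) = segment ℝ (D.src i') (D.tgt i')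
  rw [src_eq, tgt_eq, src_eq, tgt_eq]
  rcases h with ⟨h1, h2⟩ | ⟨h1, h2⟩
  · rw [h1, h2]
  · rw [h1, h2, segment_symm]

lemma d_eq (i : Fin N) : D.d i = D.vtx (D.tgtIdx i) - D.vtx (D.srcIdx i) := by
  rw [d, src_eq, tgt_eq]

lemma edge_subset_iff {f : Module.Dual ℝ (Fin n → ℝ)} {Z : Set (Fin r)}
    (hf : CutsFace D.ray f Z) (i : Fin N) :
    D.edge i ⊆ {x ∈ D.Q | f x = 0} ↔ D.srcIdx i ∈ Z ∧ D.tgtIdx i ∈ Z := by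
  have h1 := D.apply_vtx_eq_zero (D.srcIdx_pos i) f
  have h2 := D.apply_vtx_eq_zero (D.tgtIdx_pos i) f
  rw [edge, src_eq, tgt_eq, ← hf.2, ← hf.2, ← h1, ← h2]
  constructor
  · intro h
    exact ⟨(h (left_mem_segment ℝ _ _)).2, (h (right_mem_segment ℝ _ _)).2⟩
  · rintro ⟨h3, h4⟩ x hx
    refine ⟨D.convex_Q.segment_subset (D.vtx_mem_Q (D.srcIdx_pos i))
      (D.vtx_mem_Q (D.tgtIdx_pos i)) hx, ?_⟩
    obtain ⟨α, β, -, -, -, rfl⟩ := hx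
    simp [h3, h4]

/-- With all generators at positive height, the face is the convex hull of finitely many vertices.
The span of the generators is the sum of the direction space, on which `R` vanishes, and the line
through one vertex; so 3 = 2 + 1. -/
lemma isCompactTwoFace {f : Module.Dual ℝ (Fin n → ℝ)} {Z : Set (Fin r)}
    (hf : CutsFace D.ray f Z) (h3 : Module.finrank ℝ (Submodule.span ℝ (D.ray '' Z)) = 3)
    (hpos : ∀ l ∈ Z, 0 < D.ht l) : IsCompactTwoFace D.Q {x ∈ D.Q | f x = 0} := by
  obtain ⟨p, hp⟩ : Z.Nonempty := by
    rw [Set.nonempty_iff_ne_empty]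
    rintro rfl
    rw [Set.image_empty, Submodule.span_empty, finrank_bot] at h3
    omega
  have hvz : ∀ l ∈ Z, f (D.vtx l) = 0 := fun l hl =>
    (D.apply_vtx_eq_zero (hpos l hl) f).2 (hf.zero hl)
  have hF : {x ∈ D.Q | f x = 0} = convexHull ℝ (D.vtx '' Z) := by
    apply Set.Subset.antisymm
    · rintro x ⟨hx, h0⟩
      rw [mem_Q] at hx
      obtain ⟨μ, hμ, hμ0, e⟩ := D.exists_combination_of_face hf hx.1 h0
      classical
      have e1 : ∑ j with j ∈ Z, μ j * D.ht j = 1 := by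
        rw [← hx.2, e, map_sum, Finset.sum_filter]
        refine Finset.sum_congr rfl fun j _ => ?_
        split_ifs with hj
        · rw [map_smul]; rfl
        · rw [hμ0 j hj, zero_smul, map_zero]
      have e2 : x = ∑ j with j ∈ Z, (μ j * D.ht j) • D.vtx j := by
        rw [e, Finset.sum_filter]
        refine Finset.sum_congr rfl fun j _ => ?_
        split_ifs with hj
        · rw [mul_smul, D.ht_smul_vtx (hpos j hj)]
        · rw [hμ0 j hj, zero_smul]
      rw [e2]
      exact (convex_convexHull ℝ _).sum_mem (fun j _ => mul_nonneg (hμ j) (D.ht_nonneg j)) e1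
        fun j hj => subset_convexHull ℝ _ ⟨j, by simpa using hj, rfl⟩
    · refine convexHull_min ?_ ?_
      · rintro _ ⟨l, hl, rfl⟩
        exact ⟨D.vtx_mem_Q (hpos l hl), hvz l hl⟩
      · rintro x ⟨hx, hx0⟩ y ⟨hy, hy0⟩ α β hα hβ h
        exact ⟨D.convex_Q hx hy hα hβ h, by simp [hx0, hy0]⟩
  refine ⟨D.isExposed_face hf (hpos p hp) hp, ⟨_, D.vtx_mem_Q (hpos p hp), hvz p hp⟩, ?_, ?_⟩
  · rw [hF]
    exact (Z.toFinite.image _).isCompact_convexHull ℝ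
  · have hW : vectorSpan ℝ {x ∈ D.Q | f x = 0} = vectorSpan ℝ (D.vtx '' Z) := by
      rw [hF, ← direction_affineSpan, affineSpan_convexHull, direction_affineSpan]
    rw [hW]
    set W := vectorSpan ℝ (D.vtx '' Z) with hWdef
    have hspan : Submodule.span ℝ (D.ray '' Z) = W ⊔ Submodule.span ℝ {D.vtx p} := by
      apply le_antisymm
      · rw [Submodule.span_le]
        rintro _ ⟨l, hl, rfl⟩
        rw [SetLike.mem_coe, ← D.ht_smul_vtx (hpos l hl)]
        refine Submodule.smul_mem _ _ ?_
        rw [← sub_add_cancel (D.vtx l) (D.vtx p)]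
        exact Submodule.add_mem_sup
          (vsub_mem_vectorSpan ℝ (Set.mem_image_of_mem _ hl) (Set.mem_image_of_mem _ hp))
          (Submodule.mem_span_singleton_self _)
      · have hmem : ∀ l ∈ Z, D.vtx l ∈ Submodule.span ℝ (D.ray '' Z) := fun l hl =>
          Submodule.smul_mem _ _ (Submodule.subset_span ⟨l, hl, rfl⟩)
        refine sup_le ?_ ?_
        · rw [hWdef, vectorSpan_def, Submodule.span_le]
          rintro _ ⟨_, ⟨l, hl, rfl⟩, _, ⟨m, hm, rfl⟩, rfl⟩
          exact Submodule.sub_mem _ (hmem l hl) (hmem m hm)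
        · rw [Submodule.span_singleton_le_iff_mem]
          exact hmem p hp
    have hR1 : pairL D.R (D.vtx p) = 1 := (D.mem_Q.1 (D.vtx_mem_Q (hpos p hp))).2
    have hinf : W ⊓ Submodule.span ℝ {D.vtx p} = ⊥ := by
      rw [eq_bot_iff]
      rintro x ⟨hx1, hx2⟩
      have hle : W ≤ LinearMap.ker (pairL D.R) := by
        rw [hWdef, vectorSpan_def, Submodule.span_le]
        rintro _ ⟨_, ⟨l, hl, rfl⟩, _, ⟨m, hm, rfl⟩, rfl⟩
        change D.vtx l - D.vtx m ∈ LinearMap.ker _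
        rw [LinearMap.mem_ker, map_sub,
          (D.mem_Q.1 (D.vtx_mem_Q (hpos l hl))).2, (D.mem_Q.1 (D.vtx_mem_Q (hpos m hm))).2,
          sub_self]
      obtain ⟨s, rfl⟩ := Submodule.mem_span_singleton.1 hx2
      have h0 := LinearMap.mem_ker.1 (hle hx1)
      rw [map_smul, hR1, smul_eq_mul, mul_one] at h0
      simp [h0]
    have hne : D.vtx p ≠ 0 := by
      intro h0
      rw [h0, map_zero] at hR1
      exact zero_ne_one hR1
    have hdim := Submodule.finrank_sup_add_finrank_inf_eq W (Submodule.span ℝ {D.vtx p})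
    rw [hinf, ← hspan, h3, finrank_bot, finrank_span_singleton hne] at hdim
    omega

open Classical in
/-- The sign vector of a compact 2-face coming from an orientation of its edges. -/
def signOf (Z : Set (Fin r)) (s : Fin r → Fin r → ℤ) (i : Fin N) : ℤ :=
  if D.srcIdx i ∈ Z ∧ D.tgtIdx i ∈ Z then s (D.srcIdx i) (D.tgtIdx i) else 0

-- At a vertex of the face exactly two edges of the face meet, with opposite orientations relative
-- to it; at any other `p` every summand vanishes.
open Classical in
lemma signOf_cycle {Z : Set (Fin r)} (hpos : ∀ l ∈ Z, 0 < D.ht l) {s : Fin r → Fin r → ℤ}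
    (hs : ∀ p q, s p q = -s q p)
    (hloc : ∀ p ∈ Z, ∃ q ∈ Z, ∃ q' ∈ Z, Adj D.ray p q ∧ Adj D.ray p q' ∧ q' ≠ q ∧
      s p q + s p q' = 0 ∧ ∀ l ∈ Z, Adj D.ray p l → l = q ∨ l = q') (p : Fin r) :
    ∑ i, D.signOf Z s i *
      ((if D.tgtIdx i = p then 1 else 0) - (if D.srcIdx i = p then 1 else 0)) = 0 := by
  by_cases hp : p ∈ Z
  · obtain ⟨q, hq, q', hq', hpq, hpq', hne, hsum, hall⟩ := hloc p hp
    obtain ⟨i, hi⟩ := D.exists_idx_of_adj hpq (hpos p hp) (hpos q hq)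
    obtain ⟨i', hi'⟩ := D.exists_idx_of_adj hpq' (hpos p hp) (hpos q' hq')
    have hval : ∀ m ∈ Z, m ≠ p → ∀ e,
        (D.srcIdx e = p ∧ D.tgtIdx e = m) ∨ (D.srcIdx e = m ∧ D.tgtIdx e = p) →
        D.signOf Z s e *
          ((if D.tgtIdx e = p then 1 else 0) - (if D.srcIdx e = p then 1 else 0)) = s m p := by
      rintro m hm hmp e (⟨h1, h2⟩ | ⟨h1, h2⟩)
      · simp [signOf, h1, h2, hp, hm, hmp, hs p m]
      · simp [signOf, h1, h2, hp, hm, hmp]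
    have hii : i ≠ i' := by
      rintro rfl
      rcases hi with ⟨h1, h2⟩ | ⟨h1, h2⟩ <;> rcases hi' with ⟨h3, h4⟩ | ⟨h3, h4⟩
      · exact hne (h4.symm.trans h2)
      · exact hpq.1 (h4.symm.trans h2)
      · exact hpq.1 (h3.symm.trans h1)
      · exact hne (h3.symm.trans h1)
    rw [Finset.sum_eq_add i i' hii, hval q hq hpq.1.symm i hi, hval q' hq' hpq'.1.symm i' hi',
      hs q p, hs q' p]
    · linarith
    · rintro e - ⟨he, he'⟩
      by_cases hZ : D.srcIdx e ∈ Z ∧ D.tgtIdx e ∈ Z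
      · by_cases h1 : D.srcIdx e = p
        · exfalso
          have hadj := D.adj_idx e
          rw [h1] at hadj
          rcases hall _ hZ.2 hadj with h2 | h2
          · exact he (D.idx_injective (by grind))
          · exact he' (D.idx_injective (by grind))
        · by_cases h2 : D.tgtIdx e = p
          · exfalso
            have hadj := (D.adj_idx e).symm
            rw [h2] at hadj
            rcases hall _ hZ.1 hadj with h3 | h3
            · exact he (D.idx_injective (by grind))
            · exact he' (D.idx_injective (by grind))
          · simp [h1, h2]
      · simp [signOf, hZ]
    · simp
    · simp
  · refine Finset.sum_eq_zero fun i _ => ?_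
    by_cases hZ : D.srcIdx i ∈ Z ∧ D.tgtIdx i ∈ Z
    · have h1 : D.srcIdx i ≠ p := fun h => hp (h ▸ hZ.1)
      have h2 : D.tgtIdx i ≠ p := fun h => hp (h ▸ hZ.2)
      simp [h1, h2]
    · simp [signOf, hZ]

lemma isSignVector_signOf {f : Module.Dual ℝ (Fin n → ℝ)} {Z : Set (Fin r)}
    (hf : CutsFace D.ray f Z) (h3 : Module.finrank ℝ (Submodule.span ℝ (D.ray '' Z)) = 3)
    (hpos : ∀ l ∈ Z, 0 < D.ht l) {s : Fin r → Fin r → ℤ} (hs : ∀ p q, s p q = -s q p)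
    (hs1 : ∀ p ∈ Z, ∀ q ∈ Z, Adj D.ray p q → s p q = 1 ∨ s p q = -1)
    (hloc : ∀ p ∈ Z, ∃ q ∈ Z, ∃ q' ∈ Z, Adj D.ray p q ∧ Adj D.ray p q' ∧ q' ≠ q ∧
      s p q + s p q' = 0 ∧ ∀ l ∈ Z, Adj D.ray p l → l = q ∨ l = q') :
    D.IsSignVector {x ∈ D.Q | f x = 0} (D.signOf Z s) := by
  classical
  refine ⟨D.isCompactTwoFace hf h3 hpos, fun i hi => ?_, fun i hi => ?_, fun v => ?_⟩
  · rw [D.edge_subset_iff hf] at hi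
    rw [signOf, if_pos hi]
    exact hs1 _ hi.1 _ hi.2 (D.adj_idx i)
  · rw [D.edge_subset_iff hf] at hi
    rw [signOf, if_neg hi]
  · by_cases hv : ∃ p, 0 < D.ht p ∧ v = D.vtx p
    · obtain ⟨p, hp, rfl⟩ := hv
      refine (Finset.sum_congr rfl fun i _ => ?_).trans (D.signOf_cycle hpos hs hloc p)
      have h1 : D.tgt i = D.vtx p ↔ D.tgtIdx i = p := by
        rw [tgt_eq]
        exact ⟨fun h => D.vtx_injOn (D.tgtIdx_pos i) h, fun h => by rw [h]⟩
      have h2 : D.src i = D.vtx p ↔ D.srcIdx i = p := by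
        rw [src_eq]
        exact ⟨fun h => D.vtx_injOn (D.srcIdx_pos i) h, fun h => by rw [h]⟩
      simp only [h1, h2]
    · refine Finset.sum_eq_zero fun i _ => ?_
      have h1 : D.tgt i ≠ v := fun h => hv ⟨_, D.tgtIdx_pos i, by rw [← h, tgt_eq]⟩
      have h2 : D.src i ≠ v := fun h => hv ⟨_, D.srcIdx_pos i, by rw [← h, src_eq]⟩
      simp [h1, h2]

/-- Summation by parts: a chain without boundary pairs to zero with every coboundary. -/
lemma sum_smul_sub_eq_zero {ι : Type*} [Fintype ι] [DecidableEq ι] {A : Type*} [AddCommGroup A]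
    (ε : Fin N → ℤ) (u v : Fin N → ι)
    (h : ∀ p, ∑ i, ε i * ((if v i = p then 1 else 0) - (if u i = p then 1 else 0)) = 0)
    (ψ : ι → A) : ∑ i, ε i • (ψ (v i) - ψ (u i)) = 0 := by
  have h1 : ∀ i, ε i • (ψ (v i) - ψ (u i)) =
      ∑ p, (ε i * ((if v i = p then 1 else 0) - (if u i = p then 1 else 0))) • ψ p := by
    intro i
    simp only [mul_smul, ← Finset.smul_sum, sub_smul, Finset.sum_sub_distrib, ite_smul, one_smul,
      zero_smul, Finset.sum_ite_eq, Finset.mem_univ, if_true]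
  simp only [h1]
  rw [Finset.sum_comm]
  refine Finset.sum_eq_zero fun p _ => ?_
  rw [← Finset.sum_smul, h p, zero_smul]

/-- The closed cycles of compact 2-faces bound: `V` contains `(1, …, 1)`. -/
lemma sum_sign_smul_d {F : Set (Fin n → ℝ)} {ε : Fin N → ℤ} (h : D.IsSignVector F ε) :
    ∑ i, (ε i : ℝ) • D.d i = 0 := by
  classical
  have := sum_smul_sub_eq_zero (A := Fin n → ℝ) ε D.srcIdx D.tgtIdx (fun p => ?_) D.vtx
  · rw [← this]
    refine Finset.sum_congr rfl fun i _ => ?_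
    rw [d_eq, Int.cast_smul_eq_zsmul]
  · by_cases hp : 0 < D.ht p
    · refine (Finset.sum_congr rfl fun i _ => ?_).trans (h.2.2.2 (D.vtx p))
      have h1 : D.tgt i = D.vtx p ↔ D.tgtIdx i = p := by
        rw [tgt_eq]
        exact ⟨fun h => D.vtx_injOn (D.tgtIdx_pos i) h, fun h => by rw [h]⟩
      have h2 : D.src i = D.vtx p ↔ D.srcIdx i = p := by
        rw [src_eq]
        exact ⟨fun h => D.vtx_injOn (D.srcIdx_pos i) h, fun h => by rw [h]⟩
      simp only [h1, h2]
    · refine Finset.sum_eq_zero fun i _ => ?_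
      have h1 : D.tgtIdx i ≠ p := fun h => hp (h ▸ D.tgtIdx_pos i)
      have h2 : D.srcIdx i ≠ p := fun h => hp (h ▸ D.srcIdx_pos i)
      simp [h1, h2]

lemma one_mem_V : (fun _ => 1 : Fin N → ℝ) ∈ D.V :=
  ⟨fun F ε h => by simpa using D.sum_sign_smul_d h, fun _ _ _ => rfl⟩

/-- The displacement along the edge from `vtx j` to `vtx k`, dilated by `t`. -/
def step (t : Fin N → ℝ) (j k : Fin r) : Fin n → ℝ :=
  ∑ i, ((if D.srcIdx i = j ∧ D.tgtIdx i = k then t i else 0) -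
    (if D.srcIdx i = k ∧ D.tgtIdx i = j then t i else 0)) • D.d i

lemma step_symm (t : Fin N → ℝ) (j k : Fin r) : D.step t j k = -D.step t k j := by
  rw [step, step, ← Finset.sum_neg_distrib]
  exact Finset.sum_congr rfl fun i _ => by rw [← neg_smul, neg_sub]

lemma step_idx (t : Fin N → ℝ) (i : Fin N) :
    D.step t (D.srcIdx i) (D.tgtIdx i) = t i • D.d i := by
  rw [step, Finset.sum_eq_single i]
  · rw [if_pos ⟨rfl, rfl⟩, if_neg (fun h => D.idx_ne i h.1), sub_zero]
  · intro e _ he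
    rw [if_neg (fun h => he (D.idx_injective (Or.inl h))),
      if_neg (fun h => he (D.idx_injective (Or.inr h))), sub_zero, zero_smul]
  · simp

/-- The dilated edges of `Q` fit together: an element of `V` moves the vertices of `Q`. -/
lemma exists_vertex_map (t : D.V) :
    ∃ φ : Fin r → Fin n → ℝ, ∀ i, φ (D.tgtIdx i) - φ (D.srcIdx i) = t.1 i • D.d i := by
  classical
  have : Nonempty (Fin r) := ⟨D.origin⟩
  suffices h : ∃ φ : Fin r → Fin n → ℝ, ∀ j k, 0 < D.ht j → 0 < D.ht k → Adj D.ray j k →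
      φ k - φ j = D.step t.1 j k by
    obtain ⟨φ, hφ⟩ := h
    exact ⟨φ, fun i => by
      rw [hφ _ _ (D.srcIdx_pos i) (D.tgtIdx_pos i) (D.adj_idx i), step_idx]⟩
  refine exists_potential (b := D.ray) D.exists_cutsFace_ray D.ray_ne_zero
    (pairL D.R) D.ht_nonneg (D.step t.1) (D.step_symm t.1) ?_
  intro f Z hf h3 hpos φ j hj k hk l hl hjk hjl hlk hφ
  obtain ⟨s, hs, hs1, hloc⟩ := exists_orientation D.exists_cutsFace_ray hf h3
  have hsv := D.isSignVector_signOf hf h3 hpos hs hs1 hloc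
  -- The value at `j` is the one prescribed by the neighbour `k`. The dilated edges and the
  -- differences of `φ'` both sum to zero around the face.
  let φ' : Fin r → Fin n → ℝ := Function.update φ j (φ k + D.step t.1 k j)
  have hφj : φ' j = φ k + D.step t.1 k j := Function.update_self ..
  have hφne : ∀ m, m ≠ j → φ' m = φ m := fun m hm => Function.update_of_ne hm ..
  have hcyc := sum_smul_sub_eq_zero (D.signOf Z s) D.srcIdx D.tgtIdx
    (D.signOf_cycle hpos hs hloc) φ'
  have hV := t.2.1 _ _ hsv
  have hsum : ∑ i, D.signOf Z s i • (D.step t.1 (D.srcIdx i) (D.tgtIdx i) -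
      (φ' (D.tgtIdx i) - φ' (D.srcIdx i))) = 0 := by
    simp only [smul_sub (M := ℤ) _ (D.step _ _ _), Finset.sum_sub_distrib]
    rw [hcyc, sub_zero, ← hV]
    refine Finset.sum_congr rfl fun i _ => ?_
    rw [step_idx, mul_comm, mul_smul, Int.cast_smul_eq_zsmul]
  obtain ⟨e, he⟩ := D.exists_idx_of_adj hjl (hpos j hj) (hpos l hl)
  obtain ⟨q, -, q', -, -, -, -, -, hall⟩ := hloc j hj
  have hnbr : ∀ m ∈ Z, Adj D.ray j m → m = k ∨ m = l := by
    intro m hm hjm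
    rcases hall m hm hjm with h1 | h1 <;> rcases hall k hk hjk with h2 | h2 <;>
      rcases hall l hl hjl with h3 | h3 <;> grind
  -- The dilated edges agree with the differences of `φ'` on all edges of the face except possibly
  -- on the edge `e` between `j` and `l`. Since the total discrepancy is zero, they agree there too.
  have hmain : ∀ i, i ≠ e → D.signOf Z s i • (D.step t.1 (D.srcIdx i) (D.tgtIdx i) -
      (φ' (D.tgtIdx i) - φ' (D.srcIdx i))) = 0 := by
    intro i hi
    by_cases hZ : D.srcIdx i ∈ Z ∧ D.tgtIdx i ∈ Z
    · by_cases h1 : D.srcIdx i = j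
      · have hadj := D.adj_idx i
        rw [h1] at hadj
        rcases hnbr _ hZ.2 hadj with h2 | h2
        · rw [h1, h2, hφj, hφne k hjk.1.symm, D.step_symm t.1 k j]
          simp
        · exact absurd (D.idx_injective (by grind)) hi
      · by_cases h2 : D.tgtIdx i = j
        · have hadj := (D.adj_idx i).symm
          rw [h2] at hadj
          rcases hnbr _ hZ.1 hadj with h3 | h3
          · rw [h2, h3, hφj, hφne k hjk.1.symm]
            simp
          · exact absurd (D.idx_injective (by grind)) hi
        · rw [hφne _ h1, hφne _ h2, hφ _ hZ.1 _ hZ.2 (D.adj_idx i) h1 h2, sub_self, smul_zero]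
    · rw [signOf, if_neg hZ, zero_smul]
  rw [Finset.sum_eq_single e (fun i _ hi => hmain i hi) (by simp)] at hsum
  rw [← hφj, ← hφne l hjl.1.symm]
  rcases he with ⟨h1, h2⟩ | ⟨h1, h2⟩
  · rw [signOf, h1, h2, if_pos ⟨hj, hl⟩] at hsum
    have h4 : D.step t.1 j l - (φ' l - φ' j) = 0 := by
      rcases hs1 j hj l hl hjl with h | h
      · rwa [h, one_smul] at hsum
      · rwa [h, neg_smul, one_smul, neg_eq_zero] at hsum
    rw [D.step_symm t.1 l j, sub_eq_zero.1 h4]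
    abel
  · rw [signOf, h1, h2, if_pos ⟨hl, hj⟩] at hsum
    have h4 : D.step t.1 l j - (φ' j - φ' l) = 0 := by
      rcases hs1 l hl j hj hjl.symm with h | h
      · rwa [h, one_smul] at hsum
      · rwa [h, neg_smul, one_smul, neg_eq_zero] at hsum
    rw [sub_eq_zero.1 h4]
    abel

end Setting

/-! ### Monotone paths, walks and the definition of η^* -/

namespace Setting

variable {n r N : ℕ} (D : Setting n r N)

/-- Every vertex is connected with a minimal vertex by a monotone path along compact edges. -/
lemma monotone_induction {c : Module.Dual ℝ (Fin n → ℝ)}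
    (hc : ∀ j, D.ht j = 0 → 0 ≤ c (D.ray j)) {w : Fin r} (hw : 0 < D.ht w)
    (hmin : ∀ j, 0 < D.ht j → c (D.vtx w) ≤ c (D.vtx j)) (P : Fin r → Prop) (hP : P w)
    (hstep : ∀ j k, 0 < D.ht j → 0 < D.ht k → Adj D.ray j k → c (D.vtx k) ≤ c (D.vtx j) →
      P k → P j) (j : Fin r) (hj : 0 < D.ht j) : P j := by
  obtain ⟨f, hf⟩ := D.exists_cutsFace_ray w
  -- The perturbation `T c + f` has its strict minimum over the vertices at `w`, since `f` is zero
  -- there and positive at the other vertices. For large `T`, a decrease of it along an edge cannot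
  -- increase `c`. A counterexample at which it is least then has an improving edge to a vertex
  -- satisfying `P`.
  obtain ⟨T, hT, hTlarge⟩ := exists_large
    (fun s : Fin r × Fin r => c (D.vtx s.1) - c (D.vtx s.2))
    (fun s : Fin r × Fin r => f (D.vtx s.1) - f (D.vtx s.2))
  let g : Module.Dual ℝ (Fin n → ℝ) := T • c + f
  have hg : ∀ x, g x = T * c x + f x := fun x => rfl
  by_contra hbad
  obtain ⟨m, ⟨hm, hmP⟩, hmmin⟩ := Set.exists_min_image {j | 0 < D.ht j ∧ ¬ P j}
    (fun j => g (D.vtx j)) (Set.toFinite _) ⟨j, hj, hbad⟩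
  have hmw : m ≠ w := by
    rintro rfl
    exact hmP hP
  have hfw : f (D.vtx w) = 0 := (D.apply_vtx_eq_zero hw f).2 (hf.zero (Set.mem_singleton w))
  have hfm : 0 < f (D.vtx m) := by
    rw [vtx, map_smul]
    exact mul_pos (inv_pos.2 hm) (hf.pos (by simpa using hmw))
  have hlt : g (D.vtx w) < g (D.vtx m) := by
    rw [hg, hg, hfw]
    have := mul_le_mul_of_nonneg_left (hmin m hm) hT.le
    linarith
  have hval : ∀ k, 0 < D.ht k → (g - g (D.vtx m) • pairL D.R) (D.ray k) =
      D.ht k * (g (D.vtx k) - g (D.vtx m)) := by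
    intro k hk
    rw [← D.ht_smul_vtx hk]
    simp only [LinearMap.sub_apply, LinearMap.smul_apply, map_smul, smul_eq_mul,
      (D.mem_Q.1 (D.vtx_mem_Q hk)).2]
    ring
  obtain ⟨k, hmk, hk⟩ := exists_adj D.exists_cutsFace_ray (j := m)
    (g - g (D.vtx m) • pairL D.R) (by rw [hval m hm, sub_self, mul_zero])
    ⟨w, by rw [hval w hw]; exact mul_neg_of_pos_of_neg hw (sub_neg.2 hlt)⟩
  have hkpos : 0 < D.ht k := by
    refine lt_of_le_of_ne (D.ht_nonneg k) fun h0 => ?_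
    have h1 : (g - g (D.vtx m) • pairL D.R) (D.ray k) = T * c (D.ray k) + f (D.ray k) := by
      change g (D.ray k) - g (D.vtx m) * D.ht k = _
      rw [← h0, mul_zero, sub_zero, hg]
    rw [h1] at hk
    have h2 := mul_nonneg hT.le (hc k h0.symm)
    have h3 := hf.1 k
    linarith
  rw [hval k hkpos] at hk
  have hgk : g (D.vtx k) < g (D.vtx m) := by
    by_contra hcon
    exact absurd (mul_nonneg hkpos.le (sub_nonneg.2 (not_lt.1 hcon))) (not_le.2 hk)
  have hck : c (D.vtx k) ≤ c (D.vtx m) := by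
    by_contra hcon
    have := hTlarge (k, m) (sub_pos.2 (not_le.1 hcon))
    rw [hg, hg] at hgk
    simp only at this
    linarith
  by_cases hPk : P k
  · exact hmP (hstep m k hm hkpos hmk hck hPk)
  · exact absurd (hmmin k ⟨hkpos, hPk⟩) (not_le.2 hgk)

lemma ht_origin_pos : 0 < D.ht D.origin := by rw [ht_origin]; exact one_pos

/-- The vertices of `Q` are connected by compact edges. -/
lemma connected_induction (P : Fin r → Prop) (h0 : P D.origin)
    (hstep : ∀ i, P (D.srcIdx i) ↔ P (D.tgtIdx i)) (j : Fin r) (hj : 0 < D.ht j) : P j := by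
  -- For `c = 0` every vertex is minimal and every path is monotone.
  refine D.monotone_induction (c := 0) (by simp) D.ht_origin_pos (by simp) P h0 ?_ j hj
  intro j k hj hk hjk _ hPk
  obtain ⟨i, ⟨rfl, rfl⟩ | ⟨rfl, rfl⟩⟩ := D.exists_idx_of_adj hjk hj hk
  · exact (hstep i).2 hPk
  · exact (hstep i).1 hPk

lemma exists_walk {j : Fin r} (hj : 0 < D.ht j) : ∃ lam, D.Walk (D.vtx j) lam := by
  refine D.connected_induction (fun j => ∃ lam, D.Walk (D.vtx j) lam)
    ⟨0, by rw [vtx_origin]; exact Walk.nil⟩ (fun i => ?_) j hj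
  rw [← src_eq, ← tgt_eq]
  exact ⟨fun ⟨lam, h⟩ => ⟨_, Walk.forward i lam h⟩, fun ⟨lam, h⟩ => ⟨_, Walk.backward i lam h⟩⟩

/-- The sum over a walk telescopes, so it depends on the end point only. This is how the potential
of `exists_vertex_map` makes v_t independent of the walk. -/
lemma sum_walk {t : D.V} {φ : Fin r → Fin n → ℝ}
    (hφ : ∀ i, φ (D.tgtIdx i) - φ (D.srcIdx i) = t.1 i • D.d i) {v : Fin n → ℝ}
    {lam : Fin N → ℤ} (h : D.Walk v lam) : ∃ j, 0 < D.ht j ∧ v = D.vtx j ∧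
      ∑ i, (t.1 i * (lam i : ℝ)) • D.d i = φ j - φ D.origin := by
  classical
  have hsingle : ∀ i, ∑ e, (t.1 e * ((Pi.single i 1 : Fin N → ℤ) e : ℝ)) • D.d e =
      t.1 i • D.d i := by
    intro i
    rw [Finset.sum_eq_single i]
    · simp
    · intro e _ he; simp [he]
    · simp
  induction h with
  | nil => exact ⟨D.origin, D.ht_origin_pos, D.vtx_origin.symm, by simp⟩
  | forward i lam h ih =>
    obtain ⟨j, hj, e, hsum⟩ := ih
    obtain rfl : D.srcIdx i = j := D.vtx_injOn (D.srcIdx_pos i) (by rw [← src_eq, e])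
    refine ⟨_, D.tgtIdx_pos i, D.tgt_eq i, ?_⟩
    simp only [Pi.add_apply, Int.cast_add, mul_add, add_smul, Finset.sum_add_distrib, hsingle, hsum,
      ← hφ i]
    abel
  | backward i lam h ih =>
    obtain ⟨j, hj, e, hsum⟩ := ih
    obtain rfl : D.tgtIdx i = j := D.vtx_injOn (D.tgtIdx_pos i) (by rw [← tgt_eq, e])
    refine ⟨_, D.srcIdx_pos i, D.src_eq i, ?_⟩
    simp only [Pi.sub_apply, Int.cast_sub, mul_sub, sub_smul, Finset.sum_sub_distrib, hsingle, hsum,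
      ← hφ i]
    abel

lemma isLattice_o : IsLattice D.o := ⟨_, rfl⟩

lemma exists_isEnd_of_walk {v : Fin n → ℝ} {lam : Fin N → ℤ} (h : D.Walk v lam)
    (hv : ¬ IsLattice v) : ∃ i, D.IsEnd i v := by
  cases h with
  | nil => exact absurd D.isLattice_o hv
  | forward i lam h => exact ⟨i, Or.inr rfl⟩
  | backward i lam h => exact ⟨i, Or.inl rfl⟩

open Classical in
/-- A walk from the origin to a vertex. -/
def walkTo (j : Fin r) : Fin N → ℤ := if h : 0 < D.ht j then (D.exists_walk h).choose else 0

lemma walk_walkTo {j : Fin r} (h : 0 < D.ht j) : D.Walk (D.vtx j) (D.walkTo j) := by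
  rw [walkTo, dif_pos h]
  exact (D.exists_walk h).choose_spec

/-- The point `v_t` for the vertex `v = vtx j`, as a linear function of `t`. -/
def vtxT (j : Fin r) : D.V →ₗ[ℝ] (Fin n → ℝ) :=
  ∑ i, (D.coord i).smulRight ((D.walkTo j i : ℝ) • D.d i)

lemma vtxT_apply (j : Fin r) (t : D.V) :
    D.vtxT j t = ∑ i, (t.1 i * (D.walkTo j i : ℝ)) • D.d i := by
  simp [vtxT, LinearMap.sum_apply, coord, mul_smul]

lemma vtxT_of_walk {j : Fin r} (hj : 0 < D.ht j) {lam : Fin N → ℤ} (h : D.Walk (D.vtx j) lam)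
    (t : D.V) : ∑ i, (t.1 i * (lam i : ℝ)) • D.d i = D.vtxT j t := by
  obtain ⟨φ, hφ⟩ := D.exists_vertex_map t
  obtain ⟨k, -, e, h1⟩ := D.sum_walk hφ h
  obtain ⟨l, -, e', h2⟩ := D.sum_walk hφ (D.walk_walkTo hj)
  obtain rfl := D.vtx_injOn hj e
  obtain rfl := D.vtx_injOn hj e'
  rw [h1, vtxT_apply, h2]

lemma vtxT_sub (i : Fin N) (t : D.V) :
    D.vtxT (D.tgtIdx i) t - D.vtxT (D.srcIdx i) t = t.1 i • D.d i := by
  classical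
  have h := D.walk_walkTo (D.srcIdx_pos i)
  rw [← src_eq] at h
  have h' := Walk.forward i _ h
  rw [tgt_eq] at h'
  rw [← D.vtxT_of_walk (D.tgtIdx_pos i) h', vtxT_apply]
  simp only [Pi.add_apply, Int.cast_add, mul_add, add_smul, Finset.sum_add_distrib]
  rw [add_sub_cancel_left, Finset.sum_eq_single i]
  · simp
  · intro e _ he; simp [he]
  · simp

lemma vtxT_origin (t : D.V) : D.vtxT D.origin t = 0 := by
  rw [← D.vtxT_of_walk D.ht_origin_pos (lam := 0) (by rw [vtx_origin]; exact Walk.nil)]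
  simp

/-- The element `(1, …, 1)` of `V`. -/
def one : D.V := ⟨fun _ => 1, D.one_mem_V⟩

lemma vtxT_one {j : Fin r} (hj : 0 < D.ht j) : D.vtxT j D.one = D.vtx j - D.o := by
  refine D.connected_induction (fun j => D.vtxT j D.one = D.vtx j - D.o)
    (by rw [vtxT_origin, vtx_origin, sub_self]) (fun i => ?_) j hj
  have h := D.vtxT_sub i D.one
  rw [show D.one.1 i = 1 from rfl, one_smul, d_eq] at h
  constructor
  · intro h1
    rw [h1, sub_eq_iff_eq_add] at h
    rw [h]; abel
  · intro h1
    rw [h1, sub_eq_iff_eq_add, ← sub_eq_iff_eq_add'] at h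
    rw [← h]; abel

lemma etaOf_apply {j : Fin r} (hj : 0 < D.ht j) {lam : Fin N → ℤ} (h : D.Walk (D.vtx j) lam)
    (c : Fin n → ℤ) : D.etaOf c lam = -(pairL c ∘ₗ D.vtxT j) := by
  ext t
  rw [LinearMap.neg_apply, LinearMap.comp_apply, ← D.vtxT_of_walk hj h, map_sum, etaOf,
    LinearMap.sum_apply, ← Finset.sum_neg_distrib]
  refine Finset.sum_congr rfl fun i _ => ?_
  rw [map_smul, pairL_apply, LinearMap.smul_apply, smul_eq_mul, smul_eq_mul]
  change _ * t.1 i = _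
  ring

/-- The integral minimal height of a vertex. -/
def ceilAt (c : Fin n → ℤ) (j : Fin r) : ℤ := ⌈-pairL c (D.vtx j)⌉

/-- The rounding error of the height of a vertex. -/
def slack (c : Fin n → ℤ) (j : Fin r) : ℝ := D.ceilAt c j + pairL c (D.vtx j)

lemma slack_nonneg (c : Fin n → ℤ) (j : Fin r) : 0 ≤ D.slack c j := by
  have := Int.le_ceil (-pairL c (D.vtx j))
  rw [slack, ceilAt]
  linarith

lemma slack_eq_zero_of_int {c : Fin n → ℤ} {j : Fin r} {m : ℤ} (h : pairL c (D.vtx j) = m) :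
    D.slack c j = 0 := by
  rw [slack, ceilAt, h, ← Int.cast_neg, Int.ceil_intCast]
  push_cast
  ring

lemma pairL_toR (c x : Fin n → ℤ) : pairL c (toR x) = ((∑ i, x i * c i : ℤ) : ℝ) := by
  rw [pairL_apply, pair]
  push_cast
  rfl

lemma slack_eq_zero_of_isLattice (c : Fin n → ℤ) {j : Fin r} (h : IsLattice (D.vtx j)) :
    D.slack c j = 0 := by
  obtain ⟨x, hx⟩ := h
  exact D.slack_eq_zero_of_int (by rw [hx, pairL_toR])

open Classical in
/-- The coordinate `t_v` of a vertex `v`: `t_i` for some edge containing `v`. -/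
def vcoord (j : Fin r) : Module.Dual ℝ D.V :=
  -- The default value does not matter: a vertex on no compact edge is a lattice point by
  -- `exists_isEnd_of_walk`, and there `slack` vanishes.
  if h : ∃ i, D.IsEnd i (D.vtx j) then D.coord h.choose else 0

/-- At a lattice vertex the factor is zero; at a non-lattice vertex the equations of `V` identify
the coordinates of all edges that meet there. -/
lemma slack_smul_vcoord (c : Fin n → ℤ) {j : Fin r} {i : Fin N} (h : D.IsEnd i (D.vtx j)) :
    D.slack c j • D.vcoord j = D.slack c j • D.coord i := by
  by_cases hl : IsLattice (D.vtx j)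
  · rw [D.slack_eq_zero_of_isLattice c hl, zero_smul, zero_smul]
  · have hex : ∃ i, D.IsEnd i (D.vtx j) := ⟨i, h⟩
    rw [vcoord, dif_pos hex]
    congr 1
    ext t
    exact t.2.2 _ _ ⟨_, hex.choose_spec, h, hl⟩

/-- The candidate for `η^*(c)` computed at a vertex. -/
def etaAt (c : Fin n → ℤ) (j : Fin r) : Module.Dual ℝ D.V :=
  -(pairL c ∘ₗ D.vtxT j) + D.slack c j • D.vcoord j

/-- The change of `c` along the edge cancels against the unrounded part of the slack, and only the
difference of the two ceilings remains. Integrality of η^* and its comparison between vertices both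
rest on this. -/
lemma etaAt_edge (c : Fin n → ℤ) (i : Fin N) :
    D.etaAt c (D.tgtIdx i) - D.etaAt c (D.srcIdx i) =
      (D.ceilAt c (D.tgtIdx i) - D.ceilAt c (D.srcIdx i)) • D.coord i := by
  rw [etaAt, etaAt, D.slack_smul_vcoord c (i := i) (Or.inl (D.src_eq i).symm),
    D.slack_smul_vcoord c (i := i) (Or.inr (D.tgt_eq i).symm)]
  ext t
  have h := congrArg (pairL c) (D.vtxT_sub i t)
  rw [map_sub, map_smul, d_eq, map_sub, smul_eq_mul] at h
  rw [← Int.cast_smul_eq_zsmul ℝ]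
  simp only [LinearMap.sub_apply, LinearMap.add_apply, LinearMap.neg_apply, LinearMap.comp_apply,
    LinearMap.smul_apply, smul_eq_mul, slack]
  rw [show D.coord i t = t.1 i from rfl]
  push_cast
  linear_combination -h

lemma etaAt_origin (c : Fin n → ℤ) : D.etaAt c D.origin = 0 := by
  rw [etaAt, D.slack_eq_zero_of_isLattice c (by rw [vtx_origin]; exact D.isLattice_o), zero_smul,
    add_zero, neg_eq_zero]
  ext t
  simp [vtxT_origin]

lemma coord_mem_VZdual (i : Fin N) : D.coord i ∈ D.VZdual := (D.coord_mem_monS i).2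

lemma etaAt_mem_VZdual (c : Fin n → ℤ) {j : Fin r} (hj : 0 < D.ht j) :
    D.etaAt c j ∈ D.VZdual := by
  refine D.connected_induction (fun j => D.etaAt c j ∈ D.VZdual)
    (by rw [etaAt_origin]; exact D.VZdual.zero_mem) (fun i => ?_) j hj
  have h := D.etaAt_edge c i
  have hm := D.VZdual.zsmul_mem (D.coord_mem_VZdual i)
    (D.ceilAt c (D.tgtIdx i) - D.ceilAt c (D.srcIdx i))
  rw [← h] at hm
  constructor
  · intro h1
    simpa using D.VZdual.add_mem hm h1
  · intro h1
    simpa using D.VZdual.sub_mem h1 hm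

/-- The semigroup generated by the coordinate functions. -/
def AS : AddSubmonoid (Module.Dual ℝ D.V) := AddSubmonoid.closure (Set.range D.coord)

lemma coord_mem_AS (i : Fin N) : D.coord i ∈ D.AS := AddSubmonoid.subset_closure ⟨i, rfl⟩

lemma AS_le_monS : D.AS ≤ D.monS := by
  rw [AS, AddSubmonoid.closure_le]
  rintro _ ⟨i, rfl⟩
  exact D.coord_mem_monS i

lemma mem_AS_iff {τ : Module.Dual ℝ D.V} : τ ∈ D.AS ↔ ∃ m : Fin N → ℕ, τ = ∑ i, m i • D.coord i := by
  rw [AS, AddSubmonoid.mem_closure_range_iff]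
  constructor
  · rintro ⟨m, rfl⟩
    exact ⟨m, by rw [Finsupp.sum_fintype _ _ (by simp)]⟩
  · rintro ⟨m, rfl⟩
    exact ⟨Finsupp.equivFunOnFinite.symm m, by rw [Finsupp.sum_fintype _ _ (by simp)]; rfl⟩

lemma apply_one_of_AS {m : Fin N → ℕ} :
    (∑ i, m i • D.coord i : Module.Dual ℝ D.V) D.one = ((∑ i, m i : ℕ) : ℝ) := by
  rw [LinearMap.sum_apply]
  push_cast
  refine Finset.sum_congr rfl fun i _ => ?_
  rw [LinearMap.smul_apply, show D.coord i D.one = 1 from rfl]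
  simp

lemma exists_nat_of_AS {τ : Module.Dual ℝ D.V} (h : τ ∈ D.AS) : ∃ k : ℕ, τ D.one = k := by
  obtain ⟨m, rfl⟩ := D.mem_AS_iff.1 h
  exact ⟨_, D.apply_one_of_AS⟩

/-- Evaluation at (1, …, 1) counts the coordinate functions in a sum, so `AS` is graded by ℕ with
only zero in degree zero. In particular it is pointed. -/
lemma eq_zero_of_AS {τ : Module.Dual ℝ D.V} (h : τ ∈ D.AS) (h1 : τ D.one ≤ 0) : τ = 0 := by
  obtain ⟨m, rfl⟩ := D.mem_AS_iff.1 h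
  rw [apply_one_of_AS] at h1
  have h2 : ∑ i, m i = 0 := by
    have : (((∑ i, m i : ℕ)) : ℝ) = 0 := le_antisymm h1 (Nat.cast_nonneg _)
    exact_mod_cast this
  refine Finset.sum_eq_zero fun i hi => ?_
  rw [Finset.sum_eq_zero_iff.1 h2 i hi, zero_smul]

lemma vcoord_mem_AS (j : Fin r) : D.vcoord j ∈ D.AS := by
  rw [vcoord]
  split_ifs with h
  · exact D.coord_mem_AS _
  · exact D.AS.zero_mem

lemma apply_nonneg_of_AS {τ : Module.Dual ℝ D.V} (h : τ ∈ D.AS) {t : D.V} (ht : t ∈ D.C) :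
    0 ≤ τ t := (D.AS_le_monS h).1 t ht

lemma exists_minIdx (c : Fin n → ℤ) :
    ∃ j, 0 < D.ht j ∧ ∀ k, 0 < D.ht k → pairL c (D.vtx j) ≤ pairL c (D.vtx k) := by
  obtain ⟨j, hj, h⟩ := Set.exists_min_image {j | 0 < D.ht j} (fun j => pairL c (D.vtx j))
    (Set.toFinite _) ⟨D.origin, D.ht_origin_pos⟩
  exact ⟨j, hj, h⟩

/-- The index of a vertex in which `c` is minimal. -/
def minIdx (c : Fin n → ℤ) : Fin r := (D.exists_minIdx c).choose

lemma minIdx_pos (c : Fin n → ℤ) : 0 < D.ht (D.minIdx c) := (D.exists_minIdx c).choose_spec.1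

lemma minIdx_le (c : Fin n → ℤ) {k : Fin r} (hk : 0 < D.ht k) :
    pairL c (D.vtx (D.minIdx c)) ≤ pairL c (D.vtx k) := (D.exists_minIdx c).choose_spec.2 k hk

/-- The element `η^*(c)`. -/
def etaStar (c : Fin n → ℤ) : Module.Dual ℝ D.V := D.etaAt c (D.minIdx c)

lemma ray_mem_tail {j : Fin r} (h : D.ht j = 0) : D.ray j ∈ D.tail :=
  D.mem_tail.2 ⟨D.ray_mem_sigma j, h⟩

lemma nonneg_of_dualTail {c : Fin n → ℤ} (hc : c ∈ D.dualTail) {j : Fin r} (h : D.ht j = 0) :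
    0 ≤ pairL c (D.ray j) := by
  rw [pairL_apply]
  exact hc.2 _ (D.ray_mem_tail h)

/-- On a path along which `c` descends to the minimal vertex the ceilings increase, so by
`etaAt_edge` each step adds a nonnegative multiple of a coordinate function. -/
lemma etaAt_min_sub_mem {c : Fin n → ℤ} (hc : c ∈ D.dualTail) {w j : Fin r} (hw : 0 < D.ht w)
    (hmin : ∀ k, 0 < D.ht k → pairL c (D.vtx w) ≤ pairL c (D.vtx k)) (hj : 0 < D.ht j) :
    D.etaAt c w - D.etaAt c j ∈ D.AS := by
  refine D.monotone_induction (fun k hk => D.nonneg_of_dualTail hc hk) hw hmin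
    (fun j => D.etaAt c w - D.etaAt c j ∈ D.AS) (by simp [D.AS.zero_mem]) ?_ j hj
  intro j k hj hk hjk hle hPk
  have hceil : D.ceilAt c j ≤ D.ceilAt c k := Int.ceil_mono (neg_le_neg hle)
  obtain ⟨m, hm⟩ := Int.eq_ofNat_of_zero_le (sub_nonneg.2 hceil)
  suffices h : ∃ i, D.etaAt c k - D.etaAt c j = m • D.coord i by
    obtain ⟨i, hi⟩ := h
    have := D.AS.add_mem hPk (D.AS.nsmul_mem (D.coord_mem_AS i) m)
    rw [← hi] at this
    simpa using this
  obtain ⟨i, ⟨rfl, rfl⟩ | ⟨rfl, rfl⟩⟩ := D.exists_idx_of_adj hjk hj hk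
  · exact ⟨i, by rw [etaAt_edge, hm, natCast_zsmul]⟩
  · refine ⟨i, ?_⟩
    rw [← neg_sub, etaAt_edge, ← neg_zsmul, neg_sub, hm, natCast_zsmul]

lemma etaStar_sub_mem {c : Fin n → ℤ} (hc : c ∈ D.dualTail) {j : Fin r} (hj : 0 < D.ht j) :
    D.etaStar c - D.etaAt c j ∈ D.AS :=
  D.etaAt_min_sub_mem hc (D.minIdx_pos c) (fun _ hk => D.minIdx_le c hk) hj

/-- For two minimal vertices the difference and its negative both lie in the pointed semigroup `AS`.
-/
lemma etaAt_eq_etaStar {c : Fin n → ℤ} (hc : c ∈ D.dualTail) {w : Fin r} (hw : 0 < D.ht w)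
    (hmin : ∀ k, 0 < D.ht k → pairL c (D.vtx w) ≤ pairL c (D.vtx k)) :
    D.etaAt c w = D.etaStar c := by
  have h1 := D.etaAt_min_sub_mem hc hw hmin (D.minIdx_pos c)
  have h2 := D.etaStar_sub_mem hc hw
  rw [← etaStar] at h1
  obtain ⟨k, hk⟩ := D.exists_nat_of_AS h1
  refine (sub_eq_zero.1 (D.eq_zero_of_AS h2 ?_)).symm
  rw [← neg_sub, LinearMap.neg_apply, hk]
  simp

lemma le_of_mem_Q {c : Fin n → ℤ} (hc : c ∈ D.dualTail) {w : Fin r}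
    (hmin : ∀ k, 0 < D.ht k → pairL c (D.vtx w) ≤ pairL c (D.vtx k)) {x : Fin n → ℝ}
    (hx : x ∈ D.Q) : pairL c (D.vtx w) ≤ pairL c x := by
  have h := D.apply_nonneg_of_sigma (f := pairL c - pairL c (D.vtx w) • pairL D.R) (fun k => ?_)
    (D.mem_Q.1 hx).1
  · rw [LinearMap.sub_apply, LinearMap.smul_apply, (D.mem_Q.1 hx).2] at h
    simpa using h
  · change 0 ≤ pairL c (D.ray k) - pairL c (D.vtx w) * D.ht k
    rcases (D.ht_nonneg k).eq_or_lt with h0 | h0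
    · rw [← h0, mul_zero, sub_zero]
      exact D.nonneg_of_dualTail hc h0.symm
    · have h1 := mul_le_mul_of_nonneg_left (hmin k h0) h0.le
      rw [← D.ht_smul_vtx h0, map_smul, smul_eq_mul]
      linarith

end Setting

/-! ### Subadditivity of η^* and the semigroups of X̄, X' and Y -/

namespace Setting

variable {n r N : ℕ} (D : Setting n r N)

lemma eta0_eq {c : Fin n → ℤ} (hc : c ∈ D.dualTail) {w : Fin r} (hw : 0 < D.ht w)
    (hmin : ∀ k, 0 < D.ht k → pairL c (D.vtx w) ≤ pairL c (D.vtx k)) :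
    D.eta0 c = -pairL c (D.vtx w) := by
  have h : IsLeast ((fun x => pair x c) '' D.Q) (pairL c (D.vtx w)) := by
    refine ⟨⟨D.vtx w, D.vtx_mem_Q hw, (pairL_apply _ _).symm⟩, ?_⟩
    rintro _ ⟨x, hx, rfl⟩
    change _ ≤ pair x c
    rw [← pairL_apply]
    exact D.le_of_mem_Q hc hmin hx
  rw [eta0, h.csInf_eq]

lemma eta0Star_eq {c : Fin n → ℤ} (hc : c ∈ D.dualTail) {w : Fin r} (hw : 0 < D.ht w)
    (hmin : ∀ k, 0 < D.ht k → pairL c (D.vtx w) ≤ pairL c (D.vtx k)) :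
    D.eta0Star c = D.ceilAt c w := by
  rw [eta0Star, D.eta0_eq hc hw hmin, ceilAt]

lemma slack_eq {c : Fin n → ℤ} (hc : c ∈ D.dualTail) {w : Fin r} (hw : 0 < D.ht w)
    (hmin : ∀ k, 0 < D.ht k → pairL c (D.vtx w) ≤ pairL c (D.vtx k)) :
    (D.eta0Star c : ℝ) - D.eta0 c = D.slack c w := by
  rw [D.eta0Star_eq hc hw hmin, D.eta0_eq hc hw hmin, slack, sub_neg_eq_add]

/-- Independence of the walk is `etaOf_apply`, of the edge `slack_smul_vcoord`, of the minimal
vertex `etaAt_eq_etaStar`. For existence, a non-lattice vertex lies on some compact edge, as it is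
reached by a nontrivial walk. -/
lemma isEtaStar_iff {c : Fin n → ℤ} (hc : c ∈ D.dualTail) {η : Module.Dual ℝ D.V} :
    D.IsEtaStar c η ↔ η = D.etaStar c := by
  constructor
  · rintro ⟨v, lam, ⟨hv, hmin⟩, hw, h⟩
    obtain ⟨j, hj, rfl⟩ := D.exists_vtx_of_extreme hv
    have hmin' : ∀ k, 0 < D.ht k → pairL c (D.vtx j) ≤ pairL c (D.vtx k) := fun k hk => by
      rw [pairL_apply, pairL_apply]; exact hmin _ (D.vtx_mem_Q hk)
    rw [← D.etaAt_eq_etaStar hc hj hmin', etaAt]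
    rcases h with ⟨hl, rfl⟩ | ⟨-, i, hi, rfl⟩
    · rw [D.etaOf_apply hj hw, D.slack_eq_zero_of_isLattice c hl, zero_smul, add_zero]
    · rw [D.etaOf_apply hj hw, D.slack_eq hc hj hmin', D.slack_smul_vcoord c hi]
  · rintro rfl
    have hj := D.minIdx_pos c
    have hmin : ∀ k, 0 < D.ht k → pairL c (D.vtx (D.minIdx c)) ≤ pairL c (D.vtx k) :=
      fun k hk => D.minIdx_le c hk
    have hw := D.walk_walkTo hj
    refine ⟨D.vtx (D.minIdx c), D.walkTo (D.minIdx c), ⟨D.vtx_extreme hj, fun x hx => ?_⟩, hw, ?_⟩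
    · rw [← pairL_apply, ← pairL_apply]
      exact D.le_of_mem_Q hc hmin hx
    · rw [etaStar, etaAt, D.etaOf_apply hj hw]
      by_cases hl : IsLattice (D.vtx (D.minIdx c))
      · exact Or.inl ⟨hl, by rw [D.slack_eq_zero_of_isLattice c hl, zero_smul, add_zero]⟩
      · obtain ⟨i, hi⟩ := D.exists_isEnd_of_walk hw hl
        exact Or.inr ⟨hl, i, hi, by rw [D.slack_eq hc hj hmin, D.slack_smul_vcoord c hi]⟩

lemma etaStar_zero : D.etaStar 0 = 0 :=
  ((D.isEtaStar_iff D.dualTail.zero_mem).1 D.isEtaStar_zero).symm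

lemma pairL_o {c : Fin n → ℤ} (hc : c ∈ D.dualTail) : pairL c D.o = 0 := by
  rw [pairL_apply]; exact hc.1

/-- At t = (1, …, 1) the point v_t is v - o and each t_i is 1, so the correction term rounds -⟨v, c⟩
up. This relates `AX` to the semigroup of σ. -/
lemma etaStar_one {c : Fin n → ℤ} (hc : c ∈ D.dualTail) :
    D.etaStar c D.one = D.eta0Star c := by
  have hj := D.minIdx_pos c
  rw [D.eta0Star_eq hc hj (fun _ hk => D.minIdx_le c hk), etaStar, etaAt]
  have h1 : (D.slack c (D.minIdx c) • D.vcoord (D.minIdx c)) D.one = D.slack c (D.minIdx c) := by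
    by_cases hl : IsLattice (D.vtx (D.minIdx c))
    · rw [D.slack_eq_zero_of_isLattice c hl, zero_smul, LinearMap.zero_apply]
    · obtain ⟨i, hi⟩ := D.exists_isEnd_of_walk (D.walk_walkTo hj) hl
      rw [D.slack_smul_vcoord c hi, LinearMap.smul_apply, smul_eq_mul]
      exact mul_one _
  rw [LinearMap.add_apply, h1, LinearMap.neg_apply, LinearMap.comp_apply, D.vtxT_one hj, map_sub,
    D.pairL_o hc, slack]
  ring

lemma etaStar_mem_VZdual (c : Fin n → ℤ) : D.etaStar c ∈ D.VZdual :=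
  D.etaAt_mem_VZdual c (D.minIdx_pos c)

/-- At a fixed vertex the first terms are additive, and the ceilings are subadditive with an
integral defect, which multiplies the coordinate of the vertex. -/
lemma etaAt_add (c c' : Fin n → ℤ) (j : Fin r) :
    D.etaAt c j + D.etaAt c' j - D.etaAt (c + c') j ∈ D.AS := by
  have h : D.ceilAt (c + c') j ≤ D.ceilAt c j + D.ceilAt c' j := by
    rw [ceilAt, ceilAt, ceilAt, pairL_add, LinearMap.add_apply, neg_add]
    exact Int.ceil_add_le _ _
  obtain ⟨m, hm⟩ := Int.eq_ofNat_of_zero_le (sub_nonneg.2 h)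
  have e : D.etaAt c j + D.etaAt c' j - D.etaAt (c + c') j = m • D.vcoord j := by
    have hm' : (D.ceilAt c j : ℝ) + D.ceilAt c' j - D.ceilAt (c + c') j = m := by
      exact_mod_cast hm
    ext t
    rw [← Nat.cast_smul_eq_nsmul ℝ, ← hm']
    simp only [etaAt, slack, pairL_add, LinearMap.sub_apply, LinearMap.add_apply,
      LinearMap.neg_apply, LinearMap.comp_apply, LinearMap.smul_apply, smul_eq_mul]
    ring
  rw [e]
  exact D.AS.nsmul_mem (D.vcoord_mem_AS j) m

/-- All three terms are compared at one vertex that is minimal for `c + c'`; passing to the minimal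
vertices of `c` and `c'` only adds elements of `AS`. -/
lemma etaStar_add {c c' : Fin n → ℤ} (hc : c ∈ D.dualTail) (hc' : c' ∈ D.dualTail) :
    D.etaStar c + D.etaStar c' - D.etaStar (c + c') ∈ D.AS := by
  have hj := D.minIdx_pos (c + c')
  have := D.AS.add_mem (D.AS.add_mem (D.etaStar_sub_mem hc hj) (D.etaStar_sub_mem hc' hj))
    (D.etaAt_add c c' (D.minIdx (c + c')))
  rw [← etaStar] at this
  convert this using 1
  abel

/-- The semigroup of all `[c, η]` with `η - η^*(c) ∈ T`. -/
def overMon (T : AddSubmonoid (Module.Dual ℝ D.V)) (hT : D.AS ≤ T) :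
    AddSubmonoid ((Fin n → ℤ) × Module.Dual ℝ D.V) where
  carrier := {p | p.1 ∈ D.dualTail ∧ p.2 - D.etaStar p.1 ∈ T}
  zero_mem' := ⟨D.dualTail.zero_mem, by
    rw [Prod.fst_zero, Prod.snd_zero, etaStar_zero, sub_zero]; exact T.zero_mem⟩
  add_mem' := by
    rintro p q ⟨hp, hp'⟩ ⟨hq, hq'⟩
    refine ⟨D.dualTail.add_mem hp hq, ?_⟩
    have := T.add_mem (T.add_mem hp' hq') (hT (D.etaStar_add hp hq))
    convert this using 1
    rw [Prod.fst_add, Prod.snd_add]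
    abel

variable {T : AddSubmonoid (Module.Dual ℝ D.V)} {hT : D.AS ≤ T}

lemma etaStar_mem_overMon {c : Fin n → ℤ} (hc : c ∈ D.dualTail) :
    (c, D.etaStar c) ∈ D.overMon T hT := ⟨hc, by simp [T.zero_mem]⟩

lemma zero_mem_overMon {τ : Module.Dual ℝ D.V} (h : τ ∈ T) :
    ((0, τ) : (Fin n → ℤ) × Module.Dual ℝ D.V) ∈ D.overMon T hT :=
  ⟨D.dualTail.zero_mem, by simpa [etaStar_zero] using h⟩

/-- By subadditivity of η^* the set that generates Γ is already closed under addition. -/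
lemma Gamma_eq : D.Gamma = D.overMon D.monS D.AS_le_monS := by
  apply le_antisymm
  · rw [Gamma, AddSubmonoid.closure_le]
    rintro ⟨c, η⟩ ⟨h1, h2, θ, hθ, h3⟩
    obtain rfl := (D.isEtaStar_iff h1).1 hθ
    exact ⟨h1, h3, D.VZdual.sub_mem h2 (D.etaStar_mem_VZdual c)⟩
  · rintro ⟨c, η⟩ ⟨h1, h2, h3⟩
    refine AddSubmonoid.subset_closure ⟨h1, ?_, _, (D.isEtaStar_iff h1).2 rfl, h2⟩
    have := D.VZdual.add_mem h3 (D.etaStar_mem_VZdual c)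
    simpa using this

/-- The semigroup of the coordinate ring of `X̄`. -/
def AX : AddSubmonoid ((Fin n → ℤ) × Module.Dual ℝ D.V) := D.overMon D.AS le_rfl

lemma vtxT_mem_Qt {j : Fin r} (hj : 0 < D.ht j) (t : D.V) : D.vtxT j t ∈ D.Qt t := by
  refine ⟨_, subset_convexHull ℝ _ ⟨D.vtx j, D.walkTo j, D.vtx_extreme hj, D.walk_walkTo hj, rfl⟩,
    0, ⟨⟨0, fun _ => le_rfl, by simp⟩, by simp [pair]⟩, ?_⟩
  rw [add_zero, vtxT_apply]

/-- As `c` is nonnegative on the tail cone, it suffices to test the points v_t. There the value is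
that of `etaStar c - etaAt c j` plus a nonnegative multiple of a coordinate, hence nonnegative on
`C`. -/
lemma etaStar_mem_monX {c : Fin n → ℤ} (hc : c ∈ D.dualTail) : (c, D.etaStar c) ∈ D.monX := by
  refine ⟨hc.1, D.etaStar_mem_VZdual c, ?_⟩
  rintro ⟨x, t⟩ ⟨ht, y, hy, z, hz, e⟩
  change 0 ≤ pair x c + D.etaStar c t
  change x = y + z at e
  have hz' : 0 ≤ pairL c z := by rw [pairL_apply]; exact hc.2 z hz
  have hsub : D.vertexSet t ⊆ {y | -D.etaStar c t ≤ pairL c y} := by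
    rintro _ ⟨v, lam, hv, hw, rfl⟩
    obtain ⟨j, hj, rfl⟩ := D.exists_vtx_of_extreme hv
    rw [D.vtxT_of_walk hj hw]
    have h1 := D.apply_nonneg_of_AS (D.etaStar_sub_mem hc hj) ht
    have h2 := mul_nonneg (D.slack_nonneg c j) (D.apply_nonneg_of_AS (D.vcoord_mem_AS j) ht)
    rw [LinearMap.sub_apply, etaAt, LinearMap.add_apply, LinearMap.neg_apply,
      LinearMap.comp_apply, LinearMap.smul_apply, smul_eq_mul] at h1
    change -D.etaStar c t ≤ pairL c (D.vtxT j t)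
    linarith
  have h := convexHull_min hsub (convex_halfSpace_ge (pairL c).isLinear _) hy
  change -D.etaStar c t ≤ pairL c y at h
  rw [e, ← pairL_apply, map_add]
  linarith

lemma AX_le_monX : D.AX ≤ D.monX := by
  rintro ⟨c, η⟩ ⟨h1, h2⟩
  have := D.monX.add_mem (D.etaStar_mem_monX h1) (D.zero_mem_monX (D.AS_le_monS h2))
  simpa using this

lemma pair_add_zsmul_R (c : Fin n → ℤ) (k : ℤ) (x : Fin n → ℝ) :
    pair x (c + k • D.R) = pairL c x + k * pairL D.R x := by
  rw [← pairL_apply, pairL_add, pairL_zsmul]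
  rfl

lemma mem_monY_iff {c : Fin n → ℤ} (hc : c ∈ D.dualTail) {k : ℤ} :
    c + k • D.R ∈ D.monY ↔ D.eta0Star c ≤ k := by
  have hj := D.minIdx_pos c
  have hmin : ∀ k, 0 < D.ht k → pairL c (D.vtx (D.minIdx c)) ≤ pairL c (D.vtx k) :=
    fun k hk => D.minIdx_le c hk
  rw [D.eta0Star_eq hc hj hmin, ceilAt, Int.ceil_le]
  constructor
  · intro h
    have := h _ (D.vtx_mem_sigma (D.minIdx c))
    rw [pair_add_zsmul_R, (D.mem_Q.1 (D.vtx_mem_Q hj)).2] at this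
    linarith
  · intro h x hx
    have := D.apply_nonneg_of_sigma (f := pairL (c + k • D.R)) (fun m => ?_) hx
    · rwa [pairL_apply] at this
    · rw [pairL_apply, pair_add_zsmul_R]
      change 0 ≤ pairL c (D.ray m) + k * D.ht m
      rcases (D.ht_nonneg m).eq_or_lt with h0 | h0
      · rw [← h0, mul_zero, add_zero]
        exact D.nonneg_of_dualTail hc h0.symm
      · rw [← D.ht_smul_vtx h0, map_smul, smul_eq_mul]
        nlinarith [hmin m h0]

/-- Every element of `σ^∨ ∩ M` is of the form `[c, k]` with `c ∈ 𝕃^* ∩ (Q^∞)^∨`. -/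
lemma exists_dualTail_of_monY {m : Fin n → ℤ} (hm : m ∈ D.monY) :
    ∃ c ∈ D.dualTail, ∃ k : ℤ, m = c + k • D.R := by
  have ho : ∀ m' : Fin n → ℤ, pair D.o m' = ((∑ i, D.a D.origin i * m' i : ℤ) : ℝ) := fun m' => by
    rw [← pairL_apply, o, pairL_toR]
  refine ⟨m + (-(∑ i, D.a D.origin i * m i)) • D.R, ⟨?_, fun x hx => ?_⟩,
    ∑ i, D.a D.origin i * m i, by rw [neg_smul]; abel⟩
  · change pair D.o _ = 0
    rw [pair_add_zsmul_R, pairL_apply, ho m, pairL_apply, show pair D.o D.R = 1 from D.origin_height]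
    push_cast
    ring
  · rw [pair_add_zsmul_R, (D.mem_tail.1 hx).2, mul_zero, add_zero, pairL_apply]
    exact hm x hx.1

lemma dualTail_unique {c c' : Fin n → ℤ} (hc : c ∈ D.dualTail) (hc' : c' ∈ D.dualTail) {k k' : ℤ}
    (h : c + k • D.R = c' + k' • D.R) : c = c' ∧ k = k' := by
  have h1 := congrArg (pair D.o) h
  rw [pair_add_zsmul_R, pair_add_zsmul_R, D.pairL_o hc, D.pairL_o hc', pairL_apply,
    show pair D.o D.R = 1 from D.origin_height, zero_add, zero_add, mul_one, mul_one] at h1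
  have h2 : k = k' := by exact_mod_cast h1
  subst h2
  exact ⟨add_right_cancel h, rfl⟩

variable {w : ℕ} {c : Fin w → Fin n → ℤ}

/-- The exponents of the coordinate functions on `X̄` generate its semigroup. -/
lemma AX_eq_closure (hc : D.IsGenerating c) :
    D.AX = AddSubmonoid.closure (Set.range (Sum.elim (fun ν => (c ν, D.etaStar (c ν)))
      fun i => ((0, D.coord i) : (Fin n → ℤ) × Module.Dual ℝ D.V))) := by
  set B := AddSubmonoid.closure (Set.range (Sum.elim (fun ν => (c ν, D.etaStar (c ν)))
      fun i => ((0, D.coord i) : (Fin n → ℤ) × Module.Dual ℝ D.V))) with hB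
  have hle : B ≤ D.AX := by
    rw [hB, AddSubmonoid.closure_le]
    rintro _ ⟨ν | i, rfl⟩
    · exact D.etaStar_mem_overMon (hc.mem ν)
    · exact D.zero_mem_overMon (D.coord_mem_AS i)
  apply le_antisymm _ hle
  have hAS : ∀ τ ∈ D.AS, ((0, τ) : (Fin n → ℤ) × Module.Dual ℝ D.V) ∈ B := by
    intro τ hτ
    have h1 : D.AS ≤ B.comap (AddMonoidHom.inr (Fin n → ℤ) (Module.Dual ℝ D.V)) := by
      rw [AS, AddSubmonoid.closure_le]
      rintro _ ⟨i, rfl⟩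
      exact AddSubmonoid.subset_closure ⟨Sum.inr i, rfl⟩
    exact h1 hτ
  -- An expression of `m` by the generators of σ^∨ ∩ M is lifted to `B` by omitting the summands
  -- `R`; their number is `l`.
  have key : ∀ m ∈ D.monY, ∃ p ∈ B, ∃ k l : ℤ, 0 ≤ l ∧ p.2 D.one = k ∧ m = p.1 + (k + l) • D.R := by
    intro m hm
    rw [← hc.closure_eq] at hm
    induction hm using AddSubmonoid.closure_induction with
    | mem m hm =>
      rcases hm with rfl | ⟨ν, rfl⟩
      · exact ⟨0, B.zero_mem, 0, 1, zero_le_one, by simp, by simp⟩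
      · exact ⟨(c ν, D.etaStar (c ν)), AddSubmonoid.subset_closure ⟨Sum.inl ν, rfl⟩,
          D.eta0Star (c ν), 0, le_rfl, D.etaStar_one (hc.mem ν), by simp⟩
    | zero => exact ⟨0, B.zero_mem, 0, 0, le_rfl, by simp, by simp⟩
    | add m m' _ _ h h' =>
      obtain ⟨p, hp, k, l, hl, hk, rfl⟩ := h
      obtain ⟨p', hp', k', l', hl', hk', rfl⟩ := h'
      refine ⟨p + p', B.add_mem hp hp', k + k', l + l', add_nonneg hl hl', ?_, ?_⟩
      · rw [Prod.snd_add, LinearMap.add_apply, hk, hk']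
        push_cast
        rfl
      · rw [Prod.fst_add]
        module
  rintro ⟨u, η⟩ ⟨hu, hη⟩
  change u ∈ D.dualTail at hu
  obtain ⟨p, hp, k, l, hl, hk, e⟩ := key _ ((D.mem_monY_iff hu).2 le_rfl)
  obtain ⟨hp1, hp2⟩ := hle hp
  obtain ⟨rfl, h2⟩ := D.dualTail_unique hu hp1 e
  -- The lift was taken of `u + η₀^*(u) R`, the lowest element over `u`. So `p.2 - η^*(u)` is an
  -- element of `AS` of degree `-l ≤ 0`, and it vanishes.
  have h3 : p.2 - D.etaStar p.1 = 0 := by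
    refine D.eq_zero_of_AS hp2 ?_
    rw [LinearMap.sub_apply, hk, D.etaStar_one hu, h2]
    push_cast
    have : (0 : ℝ) ≤ l := by exact_mod_cast hl
    linarith
  have h4 := B.add_mem hp (hAS _ hη)
  have h5 : p + (0, η - D.etaStar p.1) = (p.1, η) := by
    ext1
    · simp
    · change p.2 + (η - D.etaStar p.1) = η
      rw [sub_eq_zero.1 h3]
      abel
  rwa [h5] at h4

end Setting

/-! ### Saturated lattices and rational points -/

/-- Functionals on a saturated sublattice of `ℤ^N` are restrictions of functionals on `ℤ^N`. -/
lemma exists_extension_of_saturated {N : ℕ} (W : Submodule ℤ (Fin N → ℤ))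
    (hsat : ∀ (k : ℤ) x, k ≠ 0 → k • x ∈ W → x ∈ W) (f : W →ₗ[ℤ] ℤ) :
    ∃ z : Fin N → ℤ, ∀ x : W, f x = ∑ i, x.1 i * z i := by
  -- The quotient by a saturated sublattice is finitely generated and torsion free, hence free. So
  -- the sublattice is a direct summand, and `f` extends through a retraction onto it.
  have htf : Module.IsTorsionFree ℤ ((Fin N → ℤ) ⧸ W) := by
    rw [Module.isTorsionFree_iff_smul_eq_zero]
    intro k m
    obtain ⟨x, rfl⟩ := W.mkQ_surjective m
    intro h
    by_cases hk : k = 0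
    · exact Or.inl hk
    · right
      rw [← map_smul, Submodule.mkQ_apply, Submodule.Quotient.mk_eq_zero] at h
      rw [Submodule.mkQ_apply, Submodule.Quotient.mk_eq_zero]
      exact hsat k x hk h
  obtain ⟨s, hs⟩ := Module.projective_lifting_property W.mkQ LinearMap.id W.mkQ_surjective
  have hmem : ∀ x, x - s (W.mkQ x) ∈ W := by
    intro x
    rw [← Submodule.Quotient.mk_eq_zero, ← Submodule.mkQ_apply, map_sub]
    have := LinearMap.congr_fun hs (W.mkQ x)
    rw [LinearMap.comp_apply, LinearMap.id_apply] at this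
    rw [this, sub_self]
  let ρ : (Fin N → ℤ) →ₗ[ℤ] W := (LinearMap.id - s ∘ₗ W.mkQ).codRestrict W hmem
  have hρ : ∀ x : W, ρ x = x := by
    intro x
    ext1
    change x.1 - s (W.mkQ x.1) = x.1
    rw [Submodule.mkQ_apply, (Submodule.Quotient.mk_eq_zero W).2 x.2, map_zero, sub_zero]
  refine ⟨fun i => f (ρ (Pi.single i 1)), fun x => ?_⟩
  conv_lhs => rw [← hρ x, ← LinearMap.comp_apply, LinearMap.pi_apply_eq_sum_univ (f ∘ₗ ρ) x.1]
  refine Finset.sum_congr rfl fun i _ => ?_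
  rw [smul_eq_mul, LinearMap.comp_apply]
  congr 4
  ext j
  simp [Pi.single_apply, eq_comm]

lemma exists_common_denominator {ι : Type*} [Fintype ι] (q : ι → ℚ) :
    ∃ K : ℕ, 0 < K ∧ ∃ z : ι → ℤ, ∀ i, (K : ℚ) * q i = z i := by
  refine ⟨∏ i, (q i).den, Finset.prod_pos fun i _ => (q i).den_pos, ?_⟩
  have : ∀ i, ∃ z : ℤ, ((∏ i, (q i).den : ℕ) : ℚ) * q i = z := by
    intro i
    obtain ⟨m, hm⟩ := Finset.dvd_prod_of_mem (fun i => (q i).den) (Finset.mem_univ i)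
    refine ⟨m * (q i).num, ?_⟩
    rw [hm]
    push_cast
    rw [mul_comm ((q i).den : ℚ) (m : ℚ), mul_assoc, Rat.den_mul_eq_num]
  choose z hz using this
  exact ⟨z, hz⟩

/-- A linear subspace of `ℝ^N` which is stable under `ℚ`-linear functionals is spanned by its
rational points. -/
lemma mem_span_rational {N : ℕ} (W : Submodule ℝ (Fin N → ℝ))
    (hW : ∀ (f : ℝ →ₗ[ℚ] ℚ), ∀ t ∈ W, (fun i => ((f (t i) : ℚ) : ℝ)) ∈ W) {t : Fin N → ℝ}
    (ht : t ∈ W) : t ∈ Submodule.span ℝ {q | q ∈ W ∧ ∃ p : Fin N → ℚ, q = fun i => (p i : ℝ)} := by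
  classical
  -- The coordinates of `t` are expanded in a basis of ℝ over ℚ. The vectors of coefficients are
  -- rational points of `W`, and `t` is a real combination of finitely many of them.
  let B := Module.Basis.ofVectorSpace ℚ ℝ
  let s : Finset (Module.Basis.ofVectorSpaceIndex ℚ ℝ) :=
    Finset.univ.biUnion fun i => (B.repr (t i)).support
  have e : t = ∑ b ∈ s, (B b : ℝ) • (fun i => ((B.coord b (t i) : ℚ) : ℝ)) := by
    ext i
    rw [Finset.sum_apply]
    conv_lhs => rw [← B.linearCombination_repr (t i), Finsupp.linearCombination_apply, Finsupp.sum]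
    refine (Finset.sum_subset (Finset.subset_biUnion_of_mem
      (fun i => (B.repr (t i)).support) (Finset.mem_univ i)) fun b _ hb => ?_).trans ?_
    · rw [Finsupp.notMem_support_iff.1 hb, zero_smul]
    · refine Finset.sum_congr rfl fun b _ => ?_
      rw [Pi.smul_apply, smul_eq_mul, B.coord_apply, Rat.smul_def, mul_comm]
  rw [e]
  exact Submodule.sum_mem _ fun b _ => Submodule.smul_mem _ _
    (Submodule.subset_span ⟨hW (B.coord b) t ht, _, rfl⟩)

/-! ### The lattice of V, and multiples of elements in AS and AX -/

namespace Setting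

variable {n r N : ℕ} (D : Setting n r N)

/-- The heights are integers. -/
def htZ (j : Fin r) : ℤ := ∑ i, D.a j i * D.R i

lemma ht_eq_htZ (j : Fin r) : D.ht j = D.htZ j := by
  rw [ht, ray, pairL_toR, htZ]

lemma d_rational (i : Fin N) : ∃ q : Fin n → ℚ, ∀ m, D.d i m = q m := by
  refine ⟨fun m => (D.htZ (D.tgtIdx i) : ℚ)⁻¹ * D.a (D.tgtIdx i) m -
    (D.htZ (D.srcIdx i) : ℚ)⁻¹ * D.a (D.srcIdx i) m, fun m => ?_⟩
  rw [d_eq, vtx, vtx, ht_eq_htZ, ht_eq_htZ]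
  push_cast
  rfl

lemma rational_mem_V (f : ℝ →ₗ[ℚ] ℚ) (t : Fin N → ℝ) (ht : t ∈ D.V) :
    (fun i => ((f (t i) : ℚ) : ℝ)) ∈ D.V := by
  refine ⟨fun F ε h => ?_, fun i j h => by simp only [ht.2 i j h]⟩
  choose q hq using D.d_rational
  ext m
  have h1 := congrFun (ht.1 F ε h) m
  rw [Finset.sum_apply] at h1 ⊢
  simp only [Pi.smul_apply, smul_eq_mul, hq, Pi.zero_apply] at h1 ⊢
  have h2 := congrArg f h1
  rw [map_sum, map_zero] at h2
  have h3 : ∑ i, f (t i) * ε i * q i m = 0 := by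
    rw [← h2]
    refine Finset.sum_congr rfl fun i _ => ?_
    have : t i * (ε i : ℝ) * (q i m : ℝ) = ((ε i : ℚ) * q i m) • t i := by
      rw [Rat.smul_def]
      push_cast
      ring
    rw [this, map_smul, smul_eq_mul]
    ring
  exact_mod_cast h3

/-- The rational points of `V`. -/
def VQ : Submodule ℚ (Fin N → ℚ) where
  carrier := {q | (fun i => (q i : ℝ)) ∈ D.V}
  zero_mem' := by
    change (fun _ => ((0 : ℚ) : ℝ)) ∈ D.V
    convert D.V.zero_mem using 1
    ext i
    simp
  add_mem' := by
    intro p q hp hq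
    change (fun i => (((p + q) i : ℚ) : ℝ)) ∈ D.V
    convert D.V.add_mem hp hq using 1
    ext i
    simp
  smul_mem' := by
    intro x q hq
    change (fun i => (((x • q) i : ℚ) : ℝ)) ∈ D.V
    convert D.V.smul_mem (x : ℝ) hq using 1
    ext i
    simp

/-- A rational point of `V`, as a real point. -/
def ofVQ : D.VQ →ₗ[ℚ] D.V where
  toFun q := ⟨fun i => (q.1 i : ℝ), q.2⟩
  map_add' p q := by ext i; simp
  map_smul' x q := by ext i; simp [Rat.smul_def]

/-- The lattice `V_ℤ`. -/
def VZ : Submodule ℤ (Fin N → ℤ) where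
  carrier := {z | (fun i => (z i : ℝ)) ∈ D.V}
  zero_mem' := by
    change (fun _ => ((0 : ℤ) : ℝ)) ∈ D.V
    convert D.V.zero_mem using 1
    ext i
    simp
  add_mem' := by
    intro p q hp hq
    change (fun i => (((p + q) i : ℤ) : ℝ)) ∈ D.V
    convert D.V.add_mem hp hq using 1
    ext i
    simp
  smul_mem' := by
    intro x q hq
    change (fun i => (((x • q) i : ℤ) : ℝ)) ∈ D.V
    convert D.V.smul_mem (x : ℝ) hq using 1
    ext i
    simp

/-- An integral point of `V`, as a real point. -/
def ofVZ : D.VZ →ₗ[ℤ] D.V where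
  toFun q := ⟨fun i => (q.1 i : ℝ), q.2⟩
  map_add' p q := by ext i; simp
  map_smul' x q := by ext i; simp

lemma VZ_saturated (k : ℤ) (x : Fin N → ℤ) (hk : k ≠ 0) (h : k • x ∈ D.VZ) : x ∈ D.VZ := by
  have hk' : (k : ℝ) ≠ 0 := by exact_mod_cast hk
  have h1 := D.V.smul_mem (k : ℝ)⁻¹ h
  change (fun i => (x i : ℝ)) ∈ D.V
  convert h1 using 1
  ext i
  simp [hk']

lemma exists_multiple_VZ (q : D.VQ) : ∃ K : ℕ, 0 < K ∧ ∃ z : D.VZ, (K : ℝ) • D.ofVQ q = D.ofVZ z := by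
  obtain ⟨K, hK, z, hz⟩ := exists_common_denominator q.1
  have e : ∀ i, (K : ℝ) * (q.1 i : ℝ) = z i := fun i => by exact_mod_cast hz i
  refine ⟨K, hK, ⟨z, ?_⟩, ?_⟩
  · change (fun i => (z i : ℝ)) ∈ D.V
    have := D.V.smul_mem (K : ℝ) q.2
    convert this using 1
    ext i
    exact (e i).symm
  · ext i
    exact e i

/-- The edges of `Q` are rational vectors, so `V` is defined over ℚ and is spanned by its rational
points. -/
lemma dual_ext_VQ {η θ : Module.Dual ℝ D.V} (h : ∀ q, η (D.ofVQ q) = θ (D.ofVQ q)) : η = θ := by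
  ext ⟨t, ht⟩
  have hspan := mem_span_rational D.V D.rational_mem_V ht
  have hle : Submodule.span ℝ {q | q ∈ D.V ∧ ∃ p : Fin N → ℚ, q = fun i => (p i : ℝ)} ≤
      (LinearMap.ker (η - θ)).map D.V.subtype := by
    rw [Submodule.span_le]
    rintro _ ⟨hp, p, rfl⟩
    refine ⟨⟨_, hp⟩, ?_, rfl⟩
    have := h ⟨p, hp⟩
    rw [SetLike.mem_coe, LinearMap.mem_ker, LinearMap.sub_apply, sub_eq_zero]
    exact this
  obtain ⟨⟨t', ht'⟩, h1, h2⟩ := hle hspan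
  obtain rfl : t' = t := h2
  rw [SetLike.mem_coe, LinearMap.mem_ker, LinearMap.sub_apply, sub_eq_zero] at h1
  exact h1

lemma dual_ext_VZ {η θ : Module.Dual ℝ D.V} (h : ∀ z, η (D.ofVZ z) = θ (D.ofVZ z)) : η = θ := by
  refine D.dual_ext_VQ fun q => ?_
  obtain ⟨K, hK, z, hz⟩ := D.exists_multiple_VZ q
  have := h z
  rw [← hz, map_smul, map_smul, smul_eq_mul, smul_eq_mul] at this
  exact mul_left_cancel₀ (by exact_mod_cast hK.ne') this

lemma exists_int_of_VZdual {η : Module.Dual ℝ D.V} (hη : η ∈ D.VZdual) (z : D.VZ) :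
    ∃ k : ℤ, η (D.ofVZ z) = k := hη _ ⟨z.1, fun _ => rfl⟩

/-- The lattice `V_ℤ^*` is generated by the coordinate functions. -/
lemma exists_of_VZdual {η : Module.Dual ℝ D.V} (hη : η ∈ D.VZdual) :
    ∃ z : Fin N → ℤ, η = ∑ i, z i • D.coord i := by
  choose k hk using D.exists_int_of_VZdual hη
  let f : D.VZ →ₗ[ℤ] ℤ :=
    { toFun := k
      map_add' := fun x y => by
        have : (k (x + y) : ℝ) = k x + k y := by rw [← hk, ← hk, ← hk, map_add, map_add]
        exact_mod_cast this
      map_smul' := fun a x => by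
        have : (k (a • x) : ℝ) = a * k x := by
          rw [← hk, ← hk, map_smul, map_zsmul, zsmul_eq_mul]
        exact_mod_cast this }
  obtain ⟨z, hz⟩ := exists_extension_of_saturated D.VZ D.VZ_saturated f
  refine ⟨z, D.dual_ext_VZ fun x => ?_⟩
  rw [hk, show k x = f x from rfl, hz, LinearMap.sum_apply]
  push_cast
  refine Finset.sum_congr rfl fun i _ => ?_
  rw [← Int.cast_smul_eq_zsmul ℝ, LinearMap.smul_apply, smul_eq_mul, mul_comm]
  rfl

/-- An integral combination of the coordinates becomes nonnegative after adding `|z i|` times each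
of them. This supplies the denominators for the birationality of S → S̄. -/
lemma exists_add_mem_AS {η : Module.Dual ℝ D.V} (hη : η ∈ D.VZdual) :
    ∃ τ ∈ D.AS, η + τ ∈ D.AS := by
  obtain ⟨z, rfl⟩ := D.exists_of_VZdual hη
  refine ⟨∑ i, (z i).natAbs • D.coord i, D.mem_AS_iff.2 ⟨_, rfl⟩,
    D.mem_AS_iff.2 ⟨fun i => (z i + (z i).natAbs).toNat, ?_⟩⟩
  rw [← Finset.sum_add_distrib]
  refine Finset.sum_congr rfl fun i _ => ?_
  rw [← natCast_zsmul (D.coord i) (z i + (z i).natAbs).toNat, Int.toNat_of_nonneg (by omega),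
    add_zsmul, natCast_zsmul]

lemma exists_rat_of_VZdual {η : Module.Dual ℝ D.V} (hη : η ∈ D.VZdual) (q : D.VQ) :
    ∃ k : ℚ, η (D.ofVQ q) = k := by
  obtain ⟨K, hK, z, hz⟩ := D.exists_multiple_VZ q
  obtain ⟨k, hk⟩ := D.exists_int_of_VZdual hη z
  rw [← hz, map_smul, smul_eq_mul] at hk
  have hK' : (K : ℝ) ≠ 0 := by exact_mod_cast hK.ne'
  refine ⟨k / K, ?_⟩
  push_cast
  rw [← hk, mul_div_cancel_left₀ _ hK']

/-- An element of `C(Q)^∨ ∩ V_ℤ^*` has a multiple which is a nonnegative integral combination of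
the coordinate functions. -/
lemma exists_multiple_AS {η : Module.Dual ℝ D.V} (hη : η ∈ D.monS) :
    ∃ m : ℕ, 0 < m ∧ m • η ∈ D.AS := by
  choose k hk using D.exists_rat_of_VZdual hη.2
  -- Farkas' lemma is applied over ℚ, on the rational points of `V`, so that the coefficients come
  -- out rational and have a common denominator.
  let f : Module.Dual ℚ D.VQ :=
    { toFun := k
      map_add' := fun x y => by
        have : (k (x + y) : ℝ) = k x + k y := by rw [← hk, ← hk, ← hk, map_add, map_add]
        exact_mod_cast this
      map_smul' := fun a x => by
        have : (k (a • x) : ℝ) = a * k x := by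
          rw [← hk, ← hk, map_smul, ← smul_eq_mul, ← map_smul η]
          refine congrArg η (Subtype.ext (funext fun i => ?_))
          exact Rat.smul_def _ _
        exact_mod_cast this }
  obtain ⟨μ, hμ, e⟩ := farkas N (fun i => (LinearMap.proj i).comp D.VQ.subtype) f (by
    intro q hq
    have h1 : D.ofVQ q ∈ D.C := fun i => by
      have := hq i
      change (0 : ℝ) ≤ (q.1 i : ℝ)
      exact_mod_cast this
    have h2 := hη.1 _ h1
    rw [hk] at h2
    exact_mod_cast h2)
  obtain ⟨K, hK, z, hz⟩ := exists_common_denominator μ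
  have hz0 : ∀ i, 0 ≤ z i := fun i => by
    have : (0 : ℚ) ≤ z i := by
      rw [← hz]
      exact mul_nonneg (Nat.cast_nonneg _) (hμ i)
    exact_mod_cast this
  refine ⟨K, hK, D.mem_AS_iff.2 ⟨fun i => (z i).toNat, D.dual_ext_VQ fun q => ?_⟩⟩
  have h1 : k q = ∑ i, μ i * q.1 i := by
    have := LinearMap.congr_fun e q
    rw [LinearMap.sum_apply] at this
    exact this
  rw [← Nat.cast_smul_eq_nsmul ℝ, LinearMap.smul_apply, hk, h1, LinearMap.sum_apply, smul_eq_mul]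
  push_cast
  rw [Finset.mul_sum]
  refine Finset.sum_congr rfl fun i _ => ?_
  have h2 : ((z i).toNat : ℝ) = K * μ i := by
    have h3 : ((z i).toNat : ℤ) = z i := Int.toNat_of_nonneg (hz0 i)
    have h4 : (((z i).toNat : ℤ) : ℚ) = K * μ i := by rw [h3, hz]
    exact_mod_cast h4
  rw [← Nat.cast_smul_eq_nsmul ℝ, LinearMap.smul_apply, h2, smul_eq_mul, mul_assoc]
  rfl

instance : Module.Finite ℤ D.VZdual := by
  let f : (Fin N → ℤ) →ₗ[ℤ] D.VZdual :=
    Fintype.linearCombination ℤ fun i => (⟨D.coord i, D.coord_mem_VZdual i⟩ : D.VZdual)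
  refine Module.Finite.of_surjective f fun η => ?_
  obtain ⟨z, hz⟩ := D.exists_of_VZdual η.2
  refine ⟨z, Subtype.ext ?_⟩
  rw [Fintype.linearCombination_apply, hz, AddSubgroup.val_finsetSum]
  rfl

instance : Module.IsTorsionFree ℤ D.VZdual := by
  rw [Module.isTorsionFree_iff_smul_eq_zero]
  intro k η h
  have h1 : k • η.1 = 0 := congrArg Subtype.val h
  exact (smul_eq_zero.1 h1).imp id fun h2 => Subtype.ext h2

instance : Module.Free ℤ D.VZdual := inferInstance

/-- A common multiple of the heights of the vertices. -/
lemma exists_common_height : ∃ K : ℕ, 0 < K ∧ ∀ (c : Fin n → ℤ) (j : Fin r), 0 < D.ht j →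
    D.slack ((K : ℤ) • c) j = 0 := by
  obtain ⟨K, hK, z, hz⟩ := exists_common_denominator fun j => (D.htZ j : ℚ)⁻¹
  refine ⟨K, hK, fun c j hj => D.slack_eq_zero_of_int (m := z j * ∑ i, D.a j i * c i) ?_⟩
  have h1 : (K : ℝ) * (D.ht j)⁻¹ = z j := by
    have h2 := congrArg (fun q : ℚ => (q : ℝ)) (hz j)
    push_cast at h2
    rw [ht_eq_htZ, h2]
  rw [pairL_zsmul, LinearMap.smul_apply, vtx, map_smul, ray, pairL_toR, Int.cast_mul, ← h1]
  simp only [smul_eq_mul]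
  push_cast
  ring

/-- The part of C̃(Q) over t = 0 contains the tail cone. -/
lemma mem_dualTail_of_monX {p : (Fin n → ℤ) × Module.Dual ℝ D.V} (hp : p ∈ D.monX) :
    p.1 ∈ D.dualTail := by
  refine ⟨hp.1, fun x hx => ?_⟩
  have h0 : ((0 : Fin n → ℝ) : Fin n → ℝ) ∈ convexHull ℝ (D.vertexSet 0) :=
    subset_convexHull ℝ _ ⟨D.o, 0, D.o_extreme, Walk.nil, by simp⟩
  have := hp.2.2 (x, 0) ⟨fun i => le_rfl, 0, h0, x, hx, by simp⟩
  simpa using this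

/-- Over the multiple `K • c` by a common height there is no rounding, so `K • η - η^*(K c)` is `K`
times `t ↦ η t + ⟨v_t, c⟩`. This is nonnegative on `C` since v_t ∈ Q_t, and `exists_multiple_AS`
applies. -/
lemma exists_multiple_AX {p : (Fin n → ℤ) × Module.Dual ℝ D.V} (hp : p ∈ D.monX) :
    ∃ m : ℕ, 0 < m ∧ m • p ∈ D.AX := by
  obtain ⟨K, hK, hslack⟩ := D.exists_common_height
  have hc := D.mem_dualTail_of_monX hp
  obtain ⟨c, η⟩ := p
  set c' : Fin n → ℤ := (K : ℤ) • c with hc'def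
  have hc' : c' ∈ D.dualTail := by
    rw [hc'def, natCast_zsmul]
    exact D.dualTail.nsmul_mem hc K
  set j := D.minIdx c' with hjdef
  have hj : 0 < D.ht j := D.minIdx_pos c'
  have e : K • η - D.etaStar c' = K • (η + pairL c ∘ₗ D.vtxT j) := by
    rw [etaStar, etaAt, ← hjdef, hslack c j hj, zero_smul, add_zero, sub_neg_eq_add, smul_add]
    congr 1
    rw [hc'def, pairL_zsmul, LinearMap.smul_comp, Int.cast_natCast, Nat.cast_smul_eq_nsmul]
  have hS : K • η - D.etaStar c' ∈ D.monS := by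
    refine ⟨fun t ht => ?_, D.VZdual.sub_mem (D.VZdual.nsmul_mem hp.2.1 K)
      (D.etaStar_mem_VZdual c')⟩
    rw [e, ← Nat.cast_smul_eq_nsmul ℝ, LinearMap.smul_apply]
    have h1 := hp.2.2 (D.vtxT j t, t) ⟨ht, D.vtxT_mem_Qt hj t⟩
    rw [← pairL_apply] at h1
    refine mul_nonneg (Nat.cast_nonneg _) ?_
    rw [LinearMap.add_apply, LinearMap.comp_apply]
    change 0 ≤ pairL c (D.vtxT j t) + η t at h1
    linarith
  obtain ⟨m, hm, hmS⟩ := D.exists_multiple_AS hS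
  refine ⟨m * K, Nat.mul_pos hm hK, ?_⟩
  have h2 := D.AX.add_mem (D.AX.nsmul_mem (D.etaStar_mem_overMon (hT := le_rfl) hc') m)
    (D.zero_mem_overMon (hT := le_rfl) hmS)
  convert h2 using 1
  ext1
  · simp only [Prod.smul_fst, Prod.fst_add, add_zero, hc'def, natCast_zsmul, mul_smul]
  · change (m * K) • η = m • D.etaStar c' + m • (K • η - D.etaStar c')
    rw [← smul_add, add_sub_cancel, mul_smul]

lemma exists_add_mem_AX {p : (Fin n → ℤ) × Module.Dual ℝ D.V} (hp : p ∈ D.monX) :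
    ∃ τ ∈ D.AS, p + (0, τ) ∈ D.AX := by
  obtain ⟨τ, hτ, h⟩ := D.exists_add_mem_AS
    (D.VZdual.sub_mem hp.2.1 (D.etaStar_mem_VZdual p.1))
  refine ⟨τ, hτ, ?_, ?_⟩
  · rw [Prod.fst_add, add_zero]
    exact D.mem_dualTail_of_monX hp
  · rw [Prod.fst_add, Prod.snd_add, add_zero]
    convert h using 1
    abel

end Setting

/-! ### Power sums and Newton's identities -/

/-- In characteristic zero the power sums determine the elementary symmetric polynomials. -/
lemma aeval_esymm_eq_of_psum {A σ τ : Type*} [CommRing A] [Algebra ℂ A] [Fintype σ] [Fintype τ]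
    (x : σ → A) (y : τ → A) (h : ∀ k, 1 ≤ k → ∑ i, x i ^ k = ∑ i, y i ^ k) (k : ℕ) :
    MvPolynomial.aeval x (MvPolynomial.esymm σ ℂ k) =
      MvPolynomial.aeval y (MvPolynomial.esymm τ ℂ k) := by
  induction k using Nat.strong_induction_on with
  | _ k ih =>
    rcases Nat.eq_zero_or_pos k with rfl | hk
    · simp
    have hx := congrArg (MvPolynomial.aeval x) (MvPolynomial.mul_esymm_eq_sum σ ℂ k)
    have hy := congrArg (MvPolynomial.aeval y) (MvPolynomial.mul_esymm_eq_sum τ ℂ k)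
    have hsum : MvPolynomial.aeval x ((-1) ^ (k + 1) *
        ∑ a ∈ Finset.HasAntidiagonal.antidiagonal k with a.1 < k,
          (-1) ^ a.1 * MvPolynomial.esymm σ ℂ a.1 * MvPolynomial.psum σ ℂ a.2) =
        MvPolynomial.aeval y ((-1) ^ (k + 1) *
        ∑ a ∈ Finset.HasAntidiagonal.antidiagonal k with a.1 < k,
          (-1) ^ a.1 * MvPolynomial.esymm τ ℂ a.1 * MvPolynomial.psum τ ℂ a.2) := by
      simp only [map_mul, map_pow, map_neg, map_one, map_sum]
      congr 1
      refine Finset.sum_congr rfl fun a ha => ?_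
      rw [Finset.mem_filter, Finset.HasAntidiagonal.mem_antidiagonal] at ha
      rw [ih a.1 ha.2]
      congr 1
      simp only [MvPolynomial.psum, map_sum, map_pow, MvPolynomial.aeval_X]
      exact h a.2 (by omega)
    rw [← hx, ← hy, map_mul, map_mul, map_natCast, map_natCast] at hsum
    have hunit : IsUnit (k : A) := by
      have : IsUnit (k : ℂ) := (Nat.cast_ne_zero.2 hk.ne').isUnit
      simpa using this.map (algebraMap ℂ A)
    exact hunit.mul_left_cancel hsum

/-- The product is the elementary symmetric polynomial of top degree; equal cardinalities make the
two top degrees agree. -/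
lemma prod_eq_of_psum {A σ τ : Type*} [CommRing A] [Algebra ℂ A] [Fintype σ] [Fintype τ]
    (x : σ → A) (y : τ → A) (hcard : Fintype.card σ = Fintype.card τ)
    (h : ∀ k, 1 ≤ k → ∑ i, x i ^ k = ∑ i, y i ^ k) : ∏ i, x i = ∏ i, y i := by
  have hprod : ∀ {ρ : Type _} [Fintype ρ] (z : ρ → A),
      MvPolynomial.aeval z (MvPolynomial.esymm ρ ℂ (Fintype.card ρ)) = ∏ i, z i := by
    intro ρ _ z
    rw [MvPolynomial.esymm, ← Finset.card_univ, Finset.powersetCard_self, Finset.sum_singleton,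
      map_prod]
    simp
  have hprod' : MvPolynomial.aeval y (MvPolynomial.esymm τ ℂ (Fintype.card τ)) = ∏ i, y i := by
    rw [MvPolynomial.esymm, ← Finset.card_univ, Finset.powersetCard_self, Finset.sum_singleton,
      map_prod]
    simp
  rw [← hprod x, ← hprod', aeval_esymm_eq_of_psum x y h, hcard]

/-- Monomials with the same weighted power sums agree. -/
lemma prod_pow_eq_of_psum {A : Type*} [CommRing A] [Algebra ℂ A] {N : ℕ} (t : Fin N → A)
    (a b : Fin N → ℕ) (hcard : ∑ i, a i = ∑ i, b i)
    (h : ∀ k, 1 ≤ k → ∑ i, (a i : A) * t i ^ k = ∑ i, (b i : A) * t i ^ k) :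
    ∏ i, t i ^ a i = ∏ i, t i ^ b i := by
  -- Each `t i` is repeated `a i` times, respectively `b i` times, so that the weighted sums become
  -- ordinary power sums.
  have := prod_eq_of_psum (fun s : Σ i, Fin (a i) => t s.1) (fun s : Σ i, Fin (b i) => t s.1)
    (by simpa using hcard) (fun k hk => by
      rw [Fintype.sum_sigma, Fintype.sum_sigma]
      simpa using h k hk)
  rw [Fintype.prod_sigma, Fintype.prod_sigma] at this
  simpa using this

/-- The basis of a semigroup algebra given by the monomials. -/
def singleBasis (G : Type*) [AddMonoid G] : Module.Basis G ℂ (AddMonoidAlgebra ℂ G) :=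
  .ofRepr (AddMonoidAlgebra.coeffLinearEquiv ℂ)

lemma singleBasis_apply (G : Type*) [AddMonoid G] (g : G) :
    singleBasis G g = AddMonoidAlgebra.single g 1 := rfl

/-! ### The embedding of ℳ in S̄ -/

namespace Setting

variable {n r N : ℕ} (D : Setting n r N)

/-- The functionals that define `V`. -/
def relSpan : Submodule ℝ (Module.Dual ℝ (Fin N → ℝ)) :=
  Submodule.span ℝ
    ({ℓ | ∃ F ε, D.IsSignVector F ε ∧ ∃ m : Fin n,
        ℓ = ∑ i, ((ε i : ℝ) * D.d i m) • LinearMap.proj i} ∪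
      {ℓ | ∃ i j, D.ShareNonLattice i j ∧ 
        ℓ = LinearMap.proj (R := ℝ) (φ := fun _ => ℝ) i - LinearMap.proj j})

lemma coannihilator_le_V : D.relSpan.dualCoannihilator ≤ D.V := by
  intro t ht
  rw [Submodule.mem_dualCoannihilator] at ht
  refine ⟨fun F ε h => ?_, fun i j h => ?_⟩
  · ext m
    have := ht _ (Submodule.subset_span (Or.inl ⟨F, ε, h, m, rfl⟩))
    rw [LinearMap.sum_apply] at this
    rw [Finset.sum_apply, Pi.zero_apply, ← this]
    refine Finset.sum_congr rfl fun i _ => ?_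
    simp only [Pi.smul_apply, smul_eq_mul, LinearMap.smul_apply, LinearMap.proj_apply]
    ring
  · have := ht _ (Submodule.subset_span (Or.inr ⟨i, j, h, rfl⟩))
    exact sub_eq_zero.1 this

/-- Linear relations between the coordinates on `V` give elements of `𝒥`. -/
lemma powerSum_mem_J {ℓ : Module.Dual ℝ (Fin N → ℝ)} (hℓ : ∀ t ∈ D.V, ℓ t = 0) {k : ℕ}
    (hk : 1 ≤ k) : ∑ i, MvPolynomial.C ((ℓ (Pi.single i 1) : ℝ) : ℂ) * MvPolynomial.X i ^ k ∈
      D.J := by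
  -- By duality in finite dimension, a functional vanishing on `V` is a real combination of its
  -- defining equations. Replacing each t_i by t_i^k is linear in the coefficients, so it suffices
  -- to treat these equations.
  have hmem : ℓ ∈ D.relSpan := by
    rw [← Subspace.dualCoannihilator_dualAnnihilator_eq (W := D.relSpan),
      Submodule.mem_dualAnnihilator]
    exact fun t ht => hℓ t (D.coannihilator_le_V ht)
  clear hℓ
  induction hmem using Submodule.span_induction with
  | mem ℓ h =>
    rcases h with ⟨F, ε, hε, m, rfl⟩ | ⟨i, j, hij, hℓ⟩
    · refine Ideal.subset_span (Or.inl ⟨F, ε, hε, k, m, hk, ?_⟩)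
      refine Finset.sum_congr rfl fun i _ => ?_
      congr 3
      rw [LinearMap.sum_apply, Finset.sum_eq_single i]
      · simp
      · intro e _ he
        simp [he]
      · simp
    · have h1 : (MvPolynomial.X i - MvPolynomial.X j : MvPolynomial (Fin N) ℂ) ∈ D.J :=
        Ideal.subset_span (Or.inr ⟨i, j, hij, rfl⟩)
      have h2 : ∀ e, ((ℓ (Pi.single e 1) : ℝ) : ℂ) =
          (if i = e then 1 else 0) - (if j = e then 1 else 0) := fun e => by
        rw [hℓ]
        rw [LinearMap.sub_apply, LinearMap.proj_apply, LinearMap.proj_apply, Pi.single_apply,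
          Pi.single_apply]
        split_ifs <;> simp
      have h3 : ∑ e, MvPolynomial.C ((ℓ (Pi.single e 1) : ℝ) : ℂ) * MvPolynomial.X e ^ k =
          (MvPolynomial.X i ^ k - MvPolynomial.X j ^ k : MvPolynomial (Fin N) ℂ) := by
        simp [h2, sub_mul, Finset.sum_sub_distrib, apply_ite MvPolynomial.C]
      rw [h3]
      exact Ideal.mem_of_dvd _ (sub_dvd_pow_sub_pow _ _ k) h1
  | zero => simp
  | add ℓ ℓ' _ _ h h' =>
    convert D.J.add_mem h h' using 1
    rw [← Finset.sum_add_distrib]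
    refine Finset.sum_congr rfl fun i _ => ?_
    rw [LinearMap.add_apply, Complex.ofReal_add, MvPolynomial.C_add, add_mul]
  | smul x ℓ _ h =>
    convert D.J.mul_mem_left (MvPolynomial.C (x : ℂ)) h using 1
    rw [Finset.mul_sum]
    refine Finset.sum_congr rfl fun i _ => ?_
    rw [LinearMap.smul_apply, smul_eq_mul, Complex.ofReal_mul, MvPolynomial.C_mul, mul_assoc]

/-- The difference of the exponents is a linear relation on `V`, so the weighted power sums agree
modulo 𝒥. Evaluation at (1, …, 1) shows that the degrees agree, and Newton's identities give the
claim. -/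
lemma prod_pow_eq {a b : Fin N → ℕ}
    (h : ∑ i, a i • D.coord i = ∑ i, b i • D.coord i) :
    Ideal.Quotient.mk D.J (∏ i, MvPolynomial.X i ^ a i) =
      Ideal.Quotient.mk D.J (∏ i, MvPolynomial.X i ^ b i) := by
  have hcard : ∑ i, a i = ∑ i, b i := by
    have := LinearMap.congr_fun h D.one
    rw [apply_one_of_AS, apply_one_of_AS] at this
    exact_mod_cast this
  rw [map_prod, map_prod]
  simp only [map_pow]
  refine prod_pow_eq_of_psum (fun i => Ideal.Quotient.mk D.J (MvPolynomial.X i)) a b hcard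
    fun k hk => ?_
  let ℓ : Module.Dual ℝ (Fin N → ℝ) := ∑ i, ((a i : ℝ) - b i) • LinearMap.proj i
  have hℓ : ∀ t ∈ D.V, ℓ t = 0 := by
    intro t ht
    have := LinearMap.congr_fun h ⟨t, ht⟩
    rw [LinearMap.sum_apply, LinearMap.sum_apply, ← sub_eq_zero, ← Finset.sum_sub_distrib] at this
    rw [← this, LinearMap.sum_apply]
    refine Finset.sum_congr rfl fun i _ => ?_
    rw [← Nat.cast_smul_eq_nsmul ℝ, ← Nat.cast_smul_eq_nsmul ℝ]
    simp only [LinearMap.smul_apply, smul_eq_mul, LinearMap.proj_apply, sub_mul]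
    rfl
  have hval : ∀ i, ℓ (Pi.single i 1) = (a i : ℝ) - b i := by
    intro i
    rw [LinearMap.sum_apply, Finset.sum_eq_single i]
    · simp
    · intro e _ he
      simp [he]
    · simp
  have hJ := D.powerSum_mem_J hℓ hk
  rw [← Ideal.Quotient.eq_zero_iff_mem, map_sum] at hJ
  rw [← sub_eq_zero, ← Finset.sum_sub_distrib, ← hJ]
  refine Finset.sum_congr rfl fun i _ => ?_
  rw [hval]
  push_cast
  rw [map_sub, map_natCast, map_natCast, map_mul, map_sub, map_natCast, map_natCast, map_pow,
    sub_mul]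

/-- `ℳ` is contained in `S̄`: the coordinate ring of `S̄` maps to that of `ℳ`. -/
lemma exists_retraction : ∃ ψ : AddMonoidAlgebra ℂ D.AS →ₐ[ℂ] MvPolynomial (Fin N) ℂ ⧸ D.J,
    ∀ i, ψ (AddMonoidAlgebra.single ⟨D.coord i, D.coord_mem_AS i⟩ 1) =
      Ideal.Quotient.mk D.J (MvPolynomial.X i) := by
  choose m hm using fun τ : D.AS => D.mem_AS_iff.1 τ.2
  -- The chosen word for an element of `AS` is irrelevant modulo 𝒥 by `prod_pow_eq`; this is why the
  -- map is multiplicative.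
  let F : Multiplicative D.AS →* MvPolynomial (Fin N) ℂ ⧸ D.J :=
    { toFun := fun τ => Ideal.Quotient.mk D.J (∏ i, MvPolynomial.X i ^ m τ.toAdd i)
      map_one' := by
        have := D.prod_pow_eq (a := m 0) (b := 0) (by rw [← hm]; simp)
        refine this.trans ?_
        simp
      map_mul' := fun σ τ => by
        have := D.prod_pow_eq (a := m (σ.toAdd + τ.toAdd)) (b := m σ.toAdd + m τ.toAdd) (by
          rw [← hm]
          simp only [Pi.add_apply, add_smul, Finset.sum_add_distrib]
          rw [← hm, ← hm]
          rfl)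
        refine this.trans ?_
        simp [pow_add, Finset.prod_mul_distrib] }
  refine ⟨AddMonoidAlgebra.lift ℂ _ D.AS F, fun i => ?_⟩
  rw [AddMonoidAlgebra.lift_single, one_smul]
  have := D.prod_pow_eq (a := m ⟨D.coord i, D.coord_mem_AS i⟩) (b := Pi.single i 1) (by
    rw [← hm, Finset.sum_eq_single i]
    · simp
    · intro e _ he; simp [he]
    · simp)
  refine this.trans ?_
  rw [Finset.prod_eq_single i]
  · simp
  · intro e _ he; simp [he]
  · simp

end Setting

/-- By the binomial theorem the system of all power sum equations is invariant under translation.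
The equation with `k = 0` must be included. -/
lemma sum_mul_add_pow_eq_zero {A ι : Type*} [CommRing A] [Fintype ι] (e x : ι → A)
    (h : ∀ k, ∑ i, e i * x i ^ k = 0) (y : A) (k : ℕ) : ∑ i, e i * (x i + y) ^ k = 0 := by
  simp only [add_pow, Finset.mul_sum]
  rw [Finset.sum_comm]
  refine Finset.sum_eq_zero fun l _ => ?_
  have : ∀ i, e i * (x i ^ l * y ^ (k - l) * (k.choose l : A)) =
      (e i * x i ^ l) * (y ^ (k - l) * (k.choose l : A)) := fun i => by ring
  simp only [this]
  rw [← Finset.sum_mul, h, zero_mul]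

/-! ### ℳ as a product of ℳ̄ with a line -/

namespace Setting

variable {n r N : ℕ} (D : Setting n r N)

/-- The difference `t_i - t_j`, as a function on `ℂ^N / ℂ (1, …, 1)`. -/
def diff (i j : Fin N) : diffRing N :=
  ⟨MvPolynomial.X i - MvPolynomial.X j, Algebra.subset_adjoin ⟨i, j, rfl⟩⟩

/-- The coordinate ring of `ℳ`. -/
def ringM : Type := MvPolynomial (Fin N) ℂ ⧸ D.J

instance : CommRing D.ringM := inferInstanceAs (CommRing (MvPolynomial (Fin N) ℂ ⧸ D.J))

instance : Algebra ℂ D.ringM := inferInstanceAs (Algebra ℂ (MvPolynomial (Fin N) ℂ ⧸ D.J))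

/-- The coordinate ring of `ℳ̄`. -/
def ringMbar : Type := diffRing N ⧸ D.Jbar

instance : CommRing D.ringMbar := inferInstanceAs (CommRing (diffRing N ⧸ D.Jbar))

instance : Algebra ℂ D.ringMbar := inferInstanceAs (Algebra ℂ (diffRing N ⧸ D.Jbar))

/-- The restriction of polynomials to `ℳ`. -/
def mkM : MvPolynomial (Fin N) ℂ →ₐ[ℂ] D.ringM := Ideal.Quotient.mkₐ ℂ D.J

/-- The restriction of functions to `ℳ̄`. -/
def mkMbar : diffRing N →ₐ[ℂ] D.ringMbar := Ideal.Quotient.mkₐ ℂ D.Jbar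

lemma mkM_surjective : Function.Surjective D.mkM := Ideal.Quotient.mk_surjective

lemma mkMbar_surjective : Function.Surjective D.mkMbar := Ideal.Quotient.mk_surjective

lemma mkM_eq_zero {p : MvPolynomial (Fin N) ℂ} : D.mkM p = 0 ↔ p ∈ D.J :=
  Ideal.Quotient.eq_zero_iff_mem

lemma mkMbar_eq_zero {g : diffRing N} : D.mkMbar g = 0 ↔ D.mkM g.1 = 0 :=
  Ideal.Quotient.eq_zero_iff_mem.trans D.mkM_eq_zero.symm

/-- The coefficients of the equations of `ℳ`. -/
def coeffJ (ε : Fin N → ℤ) (m : Fin n) (i : Fin N) : ℂ := (((ε i : ℝ) * D.d i m : ℝ) : ℂ)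

lemma sum_coeffJ {F : Set (Fin n → ℝ)} {ε : Fin N → ℤ} (h : D.IsSignVector F ε) (m : Fin n) :
    ∑ i, D.coeffJ ε m i = 0 := by
  have h1 := congrFun (D.sum_sign_smul_d h) m
  rw [Finset.sum_apply] at h1
  simp only [Pi.smul_apply, smul_eq_mul, Pi.zero_apply] at h1
  simp only [coeffJ]
  rw [← Complex.ofReal_sum, h1, Complex.ofReal_zero]

/-- A homomorphism from `ℂ[t]` kills `𝒥` if it kills its generators. -/
lemma J_le_ker {A : Type*} [CommRing A] [Algebra ℂ A] (t : Fin N → A)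
    (h1 : ∀ F ε, D.IsSignVector F ε → ∀ (m : Fin n) (k : ℕ), 1 ≤ k →
      ∑ i, algebraMap ℂ A (D.coeffJ ε m i) * t i ^ k = 0)
    (h2 : ∀ i j, D.ShareNonLattice i j → t i = t j) :
    ∀ p ∈ D.J, MvPolynomial.aeval (R := ℂ) t p = 0 := by
  have : D.J ≤ RingHom.ker (MvPolynomial.aeval (R := ℂ) t) := by
    refine Ideal.span_le.2 ?_
    rintro g (⟨F, ε, h, k, m, hk, rfl⟩ | ⟨i, j, hij, rfl⟩)
    · rw [SetLike.mem_coe, RingHom.mem_ker, map_sum, ← h1 F ε h m k hk]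
      refine Finset.sum_congr rfl fun i _ => ?_
      rw [map_mul, map_pow, MvPolynomial.aeval_C, MvPolynomial.aeval_X]
      rfl
    · rw [SetLike.mem_coe, RingHom.mem_ker, map_sub, MvPolynomial.aeval_X, MvPolynomial.aeval_X,
        h2 i j hij, sub_self]
  exact fun p hp => this hp

/-- Homomorphisms from the coordinate ring of `ℳ`. -/
def liftM {A : Type*} [CommRing A] [Algebra ℂ A] (t : Fin N → A)
    (h : ∀ p ∈ D.J, MvPolynomial.aeval (R := ℂ) t p = 0) : D.ringM →ₐ[ℂ] A :=
  Ideal.Quotient.liftₐ D.J (MvPolynomial.aeval t) h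

lemma liftM_mkM {A : Type*} [CommRing A] [Algebra ℂ A] (t : Fin N → A)
    (h : ∀ p ∈ D.J, MvPolynomial.aeval (R := ℂ) t p = 0) (p : MvPolynomial (Fin N) ℂ) :
    D.liftM t h (D.mkM p) = MvPolynomial.aeval t p := rfl

lemma ringM_ext {A : Type*} [CommRing A] [Algebra ℂ A] {f g : D.ringM →ₐ[ℂ] A}
    (h : ∀ i, f (D.mkM (MvPolynomial.X i)) = g (D.mkM (MvPolynomial.X i))) : f = g := by
  have : f.comp D.mkM = g.comp D.mkM := MvPolynomial.algHom_ext h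
  ext a
  obtain ⟨p, rfl⟩ := D.mkM_surjective a
  exact AlgHom.congr_fun this p

lemma ringMbar_ext {A : Type*} [CommRing A] [Algebra ℂ A] {f g : D.ringMbar →ₐ[ℂ] A}
    (h : ∀ i j, f (D.mkMbar (diff i j)) = g (D.mkMbar (diff i j))) : f = g := by
  have : f.comp D.mkMbar = g.comp D.mkMbar := by
    refine AlgHom.adjoin_ext ?_
    rintro _ ⟨i, j, rfl⟩
    exact h i j
  ext a
  obtain ⟨p, rfl⟩ := D.mkMbar_surjective a
  exact AlgHom.congr_fun this p

lemma sum_coeffJ_mul_pow {F : Set (Fin n → ℝ)} {ε : Fin N → ℤ} (h : D.IsSignVector F ε)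
    (m : Fin n) (k : ℕ) : ∑ i, algebraMap ℂ D.ringM (D.coeffJ ε m i) *
      D.mkM (MvPolynomial.X i) ^ k = 0 := by
  -- The case `k = 0` is not among the generators of 𝒥; it holds because the edges of a 2-face form
  -- a cycle.
  rcases Nat.eq_zero_or_pos k with rfl | hk
  · simp only [pow_zero, mul_one]
    rw [← map_sum, D.sum_coeffJ h, map_zero]
  · have h1 : D.mkM (∑ i, MvPolynomial.C (D.coeffJ ε m i) * MvPolynomial.X i ^ k) = 0 := by
      rw [mkM_eq_zero]
      exact Ideal.subset_span (Or.inl ⟨F, ε, h, k, m, hk, rfl⟩)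
    rw [map_sum] at h1
    rw [← h1]
    refine Finset.sum_congr rfl fun i _ => ?_
    rw [map_mul, map_pow, ← MvPolynomial.algebraMap_eq, AlgHom.commutes]

lemma sum_coeffJ_mul_diff_pow {F : Set (Fin n → ℝ)} {ε : Fin N → ℤ}
    (h : D.IsSignVector F ε) (m : Fin n) (i₀ : Fin N) (k : ℕ) :
    ∑ i, algebraMap ℂ D.ringMbar (D.coeffJ ε m i) * D.mkMbar (diff i i₀) ^ k = 0 := by
  have h1 := sum_mul_add_pow_eq_zero _ _ (D.sum_coeffJ_mul_pow h m)
    (-D.mkM (MvPolynomial.X i₀)) k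
  have h2 : D.mkMbar (∑ i, algebraMap ℂ (diffRing N) (D.coeffJ ε m i) * diff i i₀ ^ k) = 0 := by
    rw [mkMbar_eq_zero, ← h1, ← Subalgebra.coe_val, map_sum, map_sum]
    refine Finset.sum_congr rfl fun i _ => ?_
    rw [map_mul, map_pow, map_mul, map_pow, AlgHom.commutes, AlgHom.commutes, ← sub_eq_add_neg,
      ← map_sub]
    rfl
  rw [map_sum] at h2
  rw [← h2]
  refine Finset.sum_congr rfl fun i _ => ?_
  rw [map_mul, map_pow, AlgHom.commutes]

/-- The coordinate functions of `ℳ` in terms of their differences and one of them. -/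
def polyCoord (i₀ i : Fin N) : Polynomial D.ringMbar :=
  Polynomial.C (D.mkMbar (diff i i₀)) + Polynomial.X

/-- The coordinate ring of `ℳ` as a polynomial ring over that of `ℳ̄`. -/
def toPoly (i₀ : Fin N) : D.ringM →ₐ[ℂ] Polynomial D.ringMbar :=
  D.liftM (D.polyCoord i₀) <| D.J_le_ker _
    (fun F ε h m k _ => sum_mul_add_pow_eq_zero _ _ (fun k => by
      have := congrArg Polynomial.C (D.sum_coeffJ_mul_diff_pow h m i₀ k)
      rw [map_zero, map_sum] at this
      rw [← this]
      refine Finset.sum_congr rfl fun i _ => ?_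
      rw [map_mul, map_pow]
      rfl) Polynomial.X k)
    (fun i j hij => by
      have : D.mkMbar (diff i i₀) = D.mkMbar (diff j i₀) := by
        rw [← sub_eq_zero, ← map_sub, mkMbar_eq_zero, mkM_eq_zero]
        change MvPolynomial.X i - MvPolynomial.X i₀ -
          (MvPolynomial.X j - MvPolynomial.X i₀) ∈ D.J
        rw [sub_sub_sub_cancel_right]
        exact Ideal.subset_span (Or.inr ⟨i, j, hij, rfl⟩)
      rw [polyCoord, polyCoord, this])

lemma toPoly_X (i₀ i : Fin N) : D.toPoly i₀ (D.mkM (MvPolynomial.X i)) =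
    Polynomial.C (D.mkMbar (diff i i₀)) + Polynomial.X := by
  rw [toPoly, liftM_mkM, MvPolynomial.aeval_X, polyCoord]

/-- The homomorphism of coordinate rings of `ℓ`. -/
def ellHom : D.ringMbar →ₐ[ℂ] D.ringM :=
  { (Ideal.quotientMap D.J (diffRing N).val.toRingHom (le_refl D.Jbar) :
      diffRing N ⧸ D.Jbar →+* MvPolynomial (Fin N) ℂ ⧸ D.J) with
    commutes' := fun _ => rfl }

lemma ellHom_mkMbar (g : diffRing N) : D.ellHom (D.mkMbar g) = D.mkM g.1 := rfl

lemma ellHom_diff (i j : Fin N) : D.ellHom (D.mkMbar (diff i j)) =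
    D.mkM (MvPolynomial.X i) - D.mkM (MvPolynomial.X j) := by
  rw [ellHom_mkMbar, ← map_sub]
  rfl

lemma toPoly_ellHom (i₀ : Fin N) (a : D.ringMbar) : D.toPoly i₀ (D.ellHom a) = Polynomial.C a := by
  have : (D.toPoly i₀).comp D.ellHom =
      (Polynomial.CAlgHom : D.ringMbar →ₐ[ℂ] Polynomial D.ringMbar) := by
    refine D.ringMbar_ext fun i j => ?_
    rw [AlgHom.comp_apply, ellHom_diff, map_sub, toPoly_X, toPoly_X, add_sub_add_right_eq_sub,
      ← map_sub, ← map_sub]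
    change _ = Polynomial.C _
    congr 2
    exact Subtype.ext (sub_sub_sub_cancel_right _ _ _)
  exact AlgHom.congr_fun this a

/-- The inverse of `toPoly`. -/
def ofPoly (i₀ : Fin N) : Polynomial D.ringMbar →+* D.ringM :=
  Polynomial.eval₂RingHom D.ellHom (D.mkM (MvPolynomial.X i₀))

lemma ofPoly_C (i₀ : Fin N) (a : D.ringMbar) : D.ofPoly i₀ (Polynomial.C a) = D.ellHom a := by
  rw [ofPoly, Polynomial.coe_eval₂RingHom, Polynomial.eval₂_C]
  rfl

lemma ofPoly_X (i₀ : Fin N) : D.ofPoly i₀ Polynomial.X = D.mkM (MvPolynomial.X i₀) := by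
  rw [ofPoly, Polynomial.coe_eval₂RingHom, Polynomial.eval₂_X]

lemma toPoly_ofPoly (i₀ : Fin N) (p : Polynomial D.ringMbar) :
    D.toPoly i₀ (D.ofPoly i₀ p) = p := by
  have : (D.toPoly i₀).toRingHom.comp (D.ofPoly i₀) = RingHom.id _ := by
    refine Polynomial.ringHom_ext (fun a => ?_) ?_
    · change D.toPoly i₀ (D.ofPoly i₀ (Polynomial.C a)) = Polynomial.C a
      rw [ofPoly_C, toPoly_ellHom]
    · change D.toPoly i₀ (D.ofPoly i₀ Polynomial.X) = Polynomial.X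
      have : (diff i₀ i₀ : diffRing N) = 0 := Subtype.ext (sub_self _)
      rw [ofPoly_X, toPoly_X, this, map_zero, map_zero, zero_add]
  exact RingHom.congr_fun this p

lemma ofPoly_toPoly (i₀ : Fin N) (a : D.ringM) : D.ofPoly i₀ (D.toPoly i₀ a) = a := by
  let ρ : Polynomial D.ringMbar →ₐ[ℂ] D.ringM :=
    { D.ofPoly i₀ with
      commutes' := fun z => by
        change D.ofPoly i₀ (Polynomial.C (algebraMap ℂ _ z)) = _
        rw [ofPoly_C, AlgHom.commutes] }
  have : ρ.comp (D.toPoly i₀) = AlgHom.id ℂ _ := by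
    refine D.ringM_ext fun i => ?_
    change D.ofPoly i₀ (D.toPoly i₀ _) = D.mkM (MvPolynomial.X i)
    rw [toPoly_X, map_add, ofPoly_C, ofPoly_X, ellHom_diff, sub_add_cancel]
  exact AlgHom.congr_fun this a

/-- The coordinate ring of `ℳ` is free over that of `ℳ̄`. -/
lemma exists_basis_M (i₀ : Fin N) :
    letI := D.ellHom.toRingHom.toAlgebra
    ∃ b : Module.Basis ℕ D.ringMbar D.ringM, ∀ k, b k = D.mkM (MvPolynomial.X i₀) ^ k := by
  let := D.ellHom.toRingHom.toAlgebra
  let e : Polynomial D.ringMbar ≃ₗ[D.ringMbar] D.ringM :=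
    { toFun := D.ofPoly i₀
      invFun := D.toPoly i₀
      left_inv := D.toPoly_ofPoly i₀
      right_inv := D.ofPoly_toPoly i₀
      map_add' := map_add _
      map_smul' := fun a p => by
        rw [Polynomial.smul_eq_C_mul, map_mul, ofPoly_C]
        rfl }
  refine ⟨(Polynomial.basisMonomials _).map e, fun k => ?_⟩
  rw [Module.Basis.map_apply, Polynomial.coe_basisMonomials]
  change D.ofPoly i₀ (Polynomial.monomial k 1) = _
  rw [← one_mul (Polynomial.monomial k 1), ← Polynomial.X_pow_eq_monomial, one_mul, map_pow,
    ofPoly_X]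

/-- The point `0 ∈ ℳ̄` as a homomorphism of rings. -/
def zeroHom : D.ringMbar →ₐ[ℂ] ℂ :=
  { (Ideal.Quotient.lift D.Jbar ((evalZero N).comp (diffRing N).val.toRingHom)
      fun _ hg => D.evalZero_J hg : diffRing N ⧸ D.Jbar →+* ℂ) with
    commutes' := fun z => by
      change evalZero N (MvPolynomial.C z) = z
      simp [evalZero] }

lemma zeroHom_diff (i j : Fin N) : D.zeroHom (D.mkMbar (diff i j)) = 0 := by
  change evalZero N (MvPolynomial.X i - MvPolynomial.X j) = 0
  simp [evalZero]

/-- The diagonal line in `ℳ`. -/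
def diagHom : D.ringM →ₐ[ℂ] AddMonoidAlgebra ℂ ℕ :=
  D.liftM (fun _ => AddMonoidAlgebra.single 1 1) <| D.J_le_ker _
    (fun F ε h m k _ => by rw [← Finset.sum_mul, ← map_sum, D.sum_coeffJ h, map_zero, zero_mul])
    (fun _ _ _ => rfl)

lemma diagHom_X (i : Fin N) :
    D.diagHom (D.mkM (MvPolynomial.X i)) = AddMonoidAlgebra.single 1 1 := by
  rw [diagHom, liftM_mkM, MvPolynomial.aeval_X]

lemma diagHom_ellHom (a : D.ringMbar) :
    D.diagHom (D.ellHom a) = algebraMap ℂ (AddMonoidAlgebra ℂ ℕ) (D.zeroHom a) := by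
  have : D.diagHom.comp D.ellHom = (Algebra.ofId ℂ (AddMonoidAlgebra ℂ ℕ)).comp D.zeroHom := by
    refine D.ringMbar_ext fun i j => ?_
    rw [AlgHom.comp_apply, ellHom_diff, map_sub, diagHom_X, diagHom_X, sub_self, AlgHom.comp_apply,
      zeroHom_diff, map_zero]
  exact AlgHom.congr_fun this a

/-- The fiber of `ℓ` over `0` is the diagonal line. -/
lemma isPushout_ell (i₀ : Fin N) :
    IsPushout (CommRingCat.ofHom D.ellHom.toRingHom) (CommRingCat.ofHom D.zeroHom.toRingHom)
      (CommRingCat.ofHom D.diagHom.toRingHom)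
      (CommRingCat.ofHom (algebraMap ℂ (AddMonoidAlgebra ℂ ℕ))) := by
  let a1 := D.ellHom.toRingHom.toAlgebra
  let a2 := D.zeroHom.toRingHom.toAlgebra
  let a3 := D.diagHom.toRingHom.toAlgebra
  let a4 := (D.diagHom.toRingHom.comp D.ellHom.toRingHom).toAlgebra
  have : IsScalarTower D.ringMbar D.ringM (AddMonoidAlgebra ℂ ℕ) :=
    IsScalarTower.of_algebraMap_eq fun x => rfl
  have : IsScalarTower D.ringMbar ℂ (AddMonoidAlgebra ℂ ℕ) :=
    IsScalarTower.of_algebraMap_eq fun x => D.diagHom_ellHom x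
  obtain ⟨b, hb⟩ := D.exists_basis_M i₀
  have : Algebra.IsPushout D.ringMbar ℂ D.ringM (AddMonoidAlgebra ℂ ℕ) :=
    isPushout_of_basis b (singleBasis ℕ) fun k => by
      rw [hb, singleBasis_apply]
      change _ = D.diagHom _
      rw [map_pow, diagHom_X, AddMonoidAlgebra.single_pow]
      simp
  exact (CommRingCat.isPushout_of_isPushout D.ringMbar ℂ D.ringM (AddMonoidAlgebra ℂ ℕ)).flip

lemma flat_ellHom (i₀ : Fin N) : D.ellHom.toRingHom.Flat := by
  let := D.ellHom.toRingHom.toAlgebra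
  obtain ⟨b, -⟩ := D.exists_basis_M i₀
  have := Module.Free.of_basis b
  change Module.Flat _ _
  infer_instance

end Setting

/-! ### Monomial maps to affine spaces -/

lemma mapDomainRingHom_injective {P A : Type*} [AddCommMonoid P] [AddCommMonoid A] {j : A →+ P}
    (hj : Function.Injective j) : Function.Injective (AddMonoidAlgebra.mapDomainRingHom ℂ j) :=
  AddMonoidAlgebra.mapDomain_injective hj

lemma mapDomainRingHom_single {P A : Type*} [AddCommMonoid P] [AddCommMonoid A] (j : A →+ P)
    (a : A) (z : ℂ) : AddMonoidAlgebra.mapDomainRingHom ℂ j (AddMonoidAlgebra.single a z) =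
      AddMonoidAlgebra.single (j a) z :=
  AddMonoidAlgebra.mapDomain_single ..

lemma mapDomainRingHom_algebraMap {P A : Type*} [AddCommMonoid P] [AddCommMonoid A] (j : A →+ P)
    (z : ℂ) : AddMonoidAlgebra.mapDomainRingHom ℂ j (algebraMap ℂ _ z) = algebraMap ℂ _ z := by
  change AddMonoidAlgebra.mapDomainRingHom ℂ j (AddMonoidAlgebra.single 0 z) =
    AddMonoidAlgebra.single 0 z
  rw [mapDomainRingHom_single, map_zero]

namespace Setting

/-- Monomials whose exponents generate the semigroup generate the semigroup algebra. -/
lemma aeval_mono_surjective {ι G : Type} [AddCommMonoid G] (P : AddSubmonoid G) (x : ι → G)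
    (hP : P = AddSubmonoid.closure (Set.range x)) (hx : ∀ i, x i ∈ P) :
    Function.Surjective (MvPolynomial.aeval (R := ℂ) fun i => mono P (x i) (hx i)) := by
  rw [← AlgHom.range_eq_top, eq_top_iff]
  intro y _
  have hmem : ∀ p (hp : p ∈ P), mono P p hp ∈
      (MvPolynomial.aeval (R := ℂ) fun i => mono P (x i) (hx i)).range := by
    intro p hp
    have hp' := hp
    rw [hP] at hp'
    induction hp' using AddSubmonoid.closure_induction with
    | mem p h =>
      obtain ⟨i, rfl⟩ := h
      exact ⟨MvPolynomial.X i, MvPolynomial.aeval_X _ _⟩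
    | zero => exact Subalgebra.one_mem _
    | add p q h h' ih ih' =>
      rw [← hP] at h h'
      have := Subalgebra.mul_mem _ (ih h) (ih' h')
      rw [mono, mono, AddMonoidAlgebra.single_mul_single, mul_one] at this
      exact this
  induction y using AddMonoidAlgebra.induction_linear with
  | zero => exact Subalgebra.zero_mem _
  | add a b ha hb => exact Subalgebra.add_mem _ (ha trivial) (hb trivial)
  | single p z =>
    have := Subalgebra.smul_mem _ (hmem p.1 p.2) z
    rw [mono, AddMonoidAlgebra.smul_single, smul_eq_mul, mul_one] at this
    exact this

lemma ofHom_aeval_comp {ι A B : Type} [CommRing A] [CommRing B] [Algebra ℂ A] [Algebra ℂ B]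
    (g : A →+* B) (hg : ∀ z, g (algebraMap ℂ A z) = algebraMap ℂ B z) (f : ι → A) :
    CommRingCat.ofHom (MvPolynomial.aeval f : MvPolynomial ι ℂ →ₐ[ℂ] A).toRingHom ≫
      CommRingCat.ofHom g = CommRingCat.ofHom
        (MvPolynomial.aeval (fun i => g (f i)) : MvPolynomial ι ℂ →ₐ[ℂ] B).toRingHom := by
  rw [← CommRingCat.ofHom_comp]
  refine congrArg CommRingCat.ofHom (MvPolynomial.ringHom_ext (fun z => ?_) fun i => ?_)
  · change g (MvPolynomial.aeval f (MvPolynomial.C z)) = MvPolynomial.aeval _ (MvPolynomial.C z)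
    rw [MvPolynomial.aeval_C, MvPolynomial.aeval_C, hg]
  · change g (MvPolynomial.aeval f (MvPolynomial.X i)) = MvPolynomial.aeval _ (MvPolynomial.X i)
    rw [MvPolynomial.aeval_X, MvPolynomial.aeval_X]

/-- Composition of a morphism to an affine space with a morphism of affine schemes. -/
lemma SpecMap_toAffine {ι A B : Type} [CommRing A] [CommRing B] [Algebra ℂ A] [Algebra ℂ B]
    (g : A →+* B) (hg : ∀ z, g (algebraMap ℂ A z) = algebraMap ℂ B z) (f : ι → A) :
    Spec.map (CommRingCat.ofHom g) ≫ toAffine f = toAffine fun i => g (f i) :=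
  (Spec.map_comp _ _).symm.trans (congrArg Spec.map (ofHom_aeval_comp g hg f))

variable {n r N : ℕ} (D : Setting n r N)

/-! ### Normality -/

/-- Evaluation of elements of `V_ℤ^*` at a point of `V`. -/
def evalAt (t : D.V) : D.VZdual →+ ℝ where
  toFun η := η.1 t
  map_zero' := rfl
  map_add' _ _ := rfl

lemma isIntegrallyClosed_monS :
    IsDomain (AddMonoidAlgebra ℂ D.monS) ∧ IsIntegrallyClosed (AddMonoidAlgebra ℂ D.monS) := by
  let j : D.monS →+ D.VZdual :=
    { toFun := fun x => ⟨x.1, x.2.2⟩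
      map_zero' := rfl
      map_add' := fun _ _ => rfl }
  refine isIntegrallyClosed_of_halfSpaces j (fun x y h => Subtype.ext
    (congrArg (fun η : D.VZdual => η.1) h))
    {q | ∃ t ∈ D.C, q = D.evalAt t} fun x => ⟨?_, fun h => ?_⟩
  · rintro ⟨y, rfl⟩ _ ⟨t, ht, rfl⟩
    exact y.2.1 t ht
  · exact ⟨⟨x.1, fun t ht => h _ ⟨t, ht, rfl⟩, x.2⟩, rfl⟩

/-- The pairing with a point of `N_ℝ`. -/
def pairAt (x : Fin n → ℝ) : (Fin n → ℤ) →+ ℝ where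
  toFun c := pair x c
  map_zero' := by simp [pair]
  map_add' c c' := by simp [pair, mul_add, Finset.sum_add_distrib]

lemma isIntegrallyClosed_monX :
    IsDomain (AddMonoidAlgebra ℂ D.monX) ∧ IsIntegrallyClosed (AddMonoidAlgebra ℂ D.monX) := by
  let j : D.monX →+ (Fin n → ℤ) × D.VZdual :=
    { toFun := fun x => (x.1.1, ⟨x.1.2, x.2.2.1⟩)
      map_zero' := rfl
      map_add' := fun _ _ => rfl }
  refine isIntegrallyClosed_of_halfSpaces j (fun x y h => Subtype.ext (Prod.ext
      (congrArg (fun p : (Fin n → ℤ) × D.VZdual => p.1) h)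
      (congrArg (fun p : (Fin n → ℤ) × D.VZdual => p.2.1) h)))
    -- The condition ⟨o, c⟩ = 0 is expressed by two opposite half spaces.
    ({(pairAt D.o).comp (AddMonoidHom.fst _ _), (-pairAt D.o).comp (AddMonoidHom.fst _ _)} ∪
      {q | ∃ p ∈ D.Ctilde, q = (pairAt p.1).coprod (D.evalAt p.2)}) fun x => ⟨?_, fun h => ?_⟩
  · rintro ⟨y, rfl⟩ _ ((rfl | rfl) | ⟨p, hp, rfl⟩)
    · exact (y.2.1 : pair D.o y.1.1 = 0).ge
    · change 0 ≤ -pair D.o y.1.1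
      rw [show pair D.o y.1.1 = 0 from y.2.1, neg_zero]
    · exact y.2.2.2 p hp
  · have h1 : 0 ≤ pair D.o x.1 := h _ (Or.inl (Or.inl rfl))
    have h2 : 0 ≤ -pair D.o x.1 := h _ (Or.inl (Or.inr rfl))
    exact ⟨⟨(x.1, x.2.1), le_antisymm (by linarith) h1, x.2.2,
      fun p hp => h _ (Or.inr ⟨p, hp, rfl⟩)⟩, rfl⟩

/-- The inclusion of the semigroup of `S̄` in that of `S`. -/
def inclS : D.AS →+ D.monS := AddSubmonoid.inclusion D.AS_le_monS

/-- The inclusion of the semigroup of `X̄` in that of `X`. -/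
def inclX : D.AX →+ D.monX := AddSubmonoid.inclusion D.AX_le_monX

lemma AX_le_Gamma : D.AX ≤ D.Gamma := by
  rw [Gamma_eq]
  exact fun p hp => ⟨hp.1, D.AS_le_monS hp.2⟩

/-- The inclusion of the semigroup of `X̄` in that of `X'`. -/
def inclX' : D.AX →+ D.Gamma := AddSubmonoid.inclusion D.AX_le_Gamma

/-- The semigroup homomorphism of the projection `X̄ → S̄`. -/
def inclBar : D.AS →+ D.AX where
  toFun τ := ⟨(0, τ.1), D.zero_mem_overMon τ.2⟩
  map_zero' := rfl
  map_add' σ τ := by ext <;> simp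

lemma inclS_injective : Function.Injective D.inclS := AddSubmonoid.inclusion_injective _

lemma inclX_injective : Function.Injective D.inclX := AddSubmonoid.inclusion_injective _

lemma isDomain_AS : IsDomain (AddMonoidAlgebra ℂ D.AS) := by
  have := D.isIntegrallyClosed_monS.1
  exact (mapDomainRingHom_injective D.inclS_injective).isDomain

lemma isDomain_AX : IsDomain (AddMonoidAlgebra ℂ D.AX) := by
  have := D.isIntegrallyClosed_monX.1
  exact (mapDomainRingHom_injective D.inclX_injective).isDomain

lemma isNormalization_inclS : IsNormalization
    (Spec.map (CommRingCat.ofHom (AddMonoidAlgebra.mapDomainRingHom ℂ D.inclS))) := by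
  have := D.isDomain_AS
  obtain ⟨_, _⟩ := D.isIntegrallyClosed_monS
  refine isNormalization_SpecMap (B := .of (AddMonoidAlgebra ℂ D.AS))
    (A := .of (AddMonoidAlgebra ℂ D.monS)) _ (mapDomainRingHom_injective D.inclS_injective)
    (isIntegral_of_multiple _ fun p => ?_) (exists_mul_mem_range _ fun p => ?_)
  · obtain ⟨m, hm, h⟩ := D.exists_multiple_AS p.2
    exact ⟨m, hm, ⟨_, h⟩, rfl⟩
  · obtain ⟨τ, hτ, h⟩ := D.exists_add_mem_AS p.2.2
    exact ⟨⟨τ, hτ⟩, ⟨_, h⟩, rfl⟩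

lemma isNormalization_inclX : IsNormalization
    (Spec.map (CommRingCat.ofHom (AddMonoidAlgebra.mapDomainRingHom ℂ D.inclX))) := by
  have := D.isDomain_AX
  obtain ⟨_, _⟩ := D.isIntegrallyClosed_monX
  refine isNormalization_SpecMap (B := .of (AddMonoidAlgebra ℂ D.AX))
    (A := .of (AddMonoidAlgebra ℂ D.monX)) _ (mapDomainRingHom_injective D.inclX_injective)
    (isIntegral_of_multiple _ fun p => ?_) (exists_mul_mem_range _ fun p => ?_)
  · obtain ⟨m, hm, h⟩ := D.exists_multiple_AX p.2
    exact ⟨m, hm, ⟨_, h⟩, rfl⟩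
  · obtain ⟨τ, hτ, h⟩ := D.exists_add_mem_AX p.2
    exact ⟨⟨_, D.zero_mem_overMon hτ⟩, ⟨_, h⟩, rfl⟩

/-! ### The cocartesian squares -/

/-- The section `c ↦ [c, η^*(c)]`. -/
def sectionX (c : D.dualTail) : D.AX := ⟨_, D.etaStar_mem_overMon c.2⟩

lemma bijective_sectionX :
    Function.Bijective fun x : D.dualTail × D.AS => D.sectionX x.1 + D.inclBar x.2 := by
  constructor
  · rintro ⟨c, τ⟩ ⟨c', τ'⟩ h
    have h1 : c.1 + 0 = c'.1 + 0 := congrArg (fun p : D.AX => p.1.1) h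
    have h2 : D.etaStar c.1 + τ.1 = D.etaStar c'.1 + τ'.1 := congrArg (fun p : D.AX => p.1.2) h
    rw [add_zero, add_zero] at h1
    obtain rfl := Subtype.ext h1
    rw [add_right_inj] at h2
    rw [Subtype.ext h2]
  · rintro ⟨⟨c, η⟩, hc, hη⟩
    refine ⟨(⟨c, hc⟩, ⟨_, hη⟩), Subtype.ext (Prod.ext (add_zero c) ?_)⟩
    exact add_sub_cancel _ _

lemma bijective_sectionX' :
    Function.Bijective fun x : D.dualTail × D.monS =>
      D.inclX' (D.sectionX x.1) + D.inclGamma x.2 := by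
  constructor
  · rintro ⟨c, τ⟩ ⟨c', τ'⟩ h
    have h1 : c.1 + 0 = c'.1 + 0 := congrArg (fun p : D.Gamma => p.1.1) h
    have h2 : D.etaStar c.1 + τ.1 = D.etaStar c'.1 + τ'.1 := congrArg (fun p : D.Gamma => p.1.2) h
    rw [add_zero, add_zero] at h1
    obtain rfl := Subtype.ext h1
    rw [add_right_inj] at h2
    rw [Subtype.ext h2]
  · rintro ⟨⟨c, η⟩, h⟩
    have h' := h
    rw [Gamma_eq] at h'
    obtain ⟨hc, hη⟩ := h'
    refine ⟨(⟨c, hc⟩, ⟨_, hη⟩), Subtype.ext (Prod.ext (add_zero c) ?_)⟩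
    exact add_sub_cancel _ _

/-- The value at `(1, …, 1)` of an element of the semigroup of `S̄`. -/
def degS : D.AS →+ ℕ where
  -- The value is a natural number by `exists_nat_of_AS`; the floor only extracts it.
  toFun τ := ⌊τ.1 D.one⌋₊
  map_zero' := by simp
  map_add' σ τ := by
    obtain ⟨k, hk⟩ := D.exists_nat_of_AS σ.2
    obtain ⟨l, hl⟩ := D.exists_nat_of_AS τ.2
    rw [AddSubmonoid.coe_add, LinearMap.add_apply, hk, hl, ← Nat.cast_add, Nat.floor_natCast,
      Nat.floor_natCast, Nat.floor_natCast]

lemma exists_int_of_AX {p : (Fin n → ℤ) × Module.Dual ℝ D.V} (hp : p ∈ D.AX) :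
    ∃ k : ℤ, p.2 D.one = k ∧ D.eta0Star p.1 ≤ k := by
  obtain ⟨m, hm⟩ := D.exists_nat_of_AS hp.2
  rw [LinearMap.sub_apply, D.etaStar_one hp.1, sub_eq_iff_eq_add] at hm
  refine ⟨m + D.eta0Star p.1, ?_, by omega⟩
  rw [hm]
  push_cast
  rfl

/-- The semigroup homomorphism `[c, η] ↦ [c, η(1, …, 1)]`. -/
def specialize : D.AX →+ D.monY where
  toFun p := ⟨p.1.1 + ⌊p.1.2 D.one⌋ • D.R, by
    obtain ⟨k, hk, hle⟩ := D.exists_int_of_AX p.2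
    rw [hk, Int.floor_intCast]
    exact (D.mem_monY_iff p.2.1).2 hle⟩
  map_zero' := by ext; simp
  map_add' p q := by
    obtain ⟨k, hk, -⟩ := D.exists_int_of_AX p.2
    obtain ⟨l, hl, -⟩ := D.exists_int_of_AX q.2
    ext1
    simp only [AddSubmonoid.coe_add, Prod.fst_add, Prod.snd_add, LinearMap.add_apply]
    rw [hk, hl, ← Int.cast_add, Int.floor_intCast, Int.floor_intCast, Int.floor_intCast]
    module

lemma specialize_sectionX (c : D.dualTail) :
    (D.specialize (D.sectionX c)).1 = c.1 + D.eta0Star c.1 • D.R := by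
  change c.1 + ⌊D.etaStar c.1 D.one⌋ • D.R = _
  rw [D.etaStar_one c.2, Int.floor_intCast]

/-- The multiples of the degree `R`. -/
def multR : ℕ →+ D.monY := multiplesHom D.monY ⟨D.R, D.R_mem_monY⟩

lemma multR_apply (k : ℕ) : (D.multR k).1 = (k : ℤ) • D.R := by
  rw [multR, multiplesHom_apply, natCast_zsmul]
  rfl

lemma specialize_inclBar : D.specialize.comp D.inclBar = D.multR.comp D.degS := by
  ext1 τ
  obtain ⟨k, hk⟩ := D.exists_nat_of_AS τ.2
  apply Subtype.ext
  rw [AddMonoidHom.comp_apply, AddMonoidHom.comp_apply, multR_apply]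
  change 0 + ⌊τ.1 D.one⌋ • D.R = ((⌊τ.1 D.one⌋₊ : ℕ) : ℤ) • D.R
  rw [hk, Nat.floor_natCast, zero_add, ← Int.cast_natCast (R := ℝ), Int.floor_intCast]

/-- Over each `c` the elements of σ^∨ ∩ M are those with `k ≥ η₀^*(c)`, so they form one translate
of ℕR starting at the image of `[c, η^*(c)]`. -/
lemma bijective_specialize :
    Function.Bijective fun x : D.dualTail × ℕ =>
      D.specialize (D.sectionX x.1) + D.multR x.2 := by
  have hval : ∀ x : D.dualTail × ℕ, (D.specialize (D.sectionX x.1) + D.multR x.2).1 =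
      x.1.1 + (D.eta0Star x.1.1 + x.2) • D.R := fun x => by
    rw [AddSubmonoid.coe_add, specialize_sectionX, multR_apply, add_smul, add_assoc]
  constructor
  · rintro ⟨c, k⟩ ⟨c', k'⟩ h
    have h1 := (hval (c, k)).symm.trans ((congrArg Subtype.val h).trans (hval (c', k')))
    obtain ⟨h2, h3⟩ := D.dualTail_unique c.2 c'.2 h1
    obtain rfl := Subtype.ext h2
    have h4 : D.eta0Star c.1 + (k : ℤ) = D.eta0Star c.1 + k' := h3
    have : k = k' := by omega
    rw [this]
  · rintro ⟨m, hm⟩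
    obtain ⟨c, hc, k, rfl⟩ := D.exists_dualTail_of_monY hm
    obtain ⟨l, hl⟩ := Int.eq_ofNat_of_zero_le (sub_nonneg.2 ((D.mem_monY_iff hc).1 hm))
    refine ⟨(⟨c, hc⟩, l), Subtype.ext ?_⟩
    rw [hval]
    change c + (D.eta0Star c + l) • D.R = c + k • D.R
    rw [← hl, add_sub_cancel]

end Setting

/-! ### Assembly of the morphisms of schemes -/

/-- Over a flat morphism with cartesian squares over it, the fiber of a composition. -/
lemma isPullback_lift_comp {𝒞 : Type*} [Category 𝒞] {X S M B Y L P : 𝒞} (p : X ⟶ S)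
    (j : M ⟶ S) [HasPullback p j] (ℓ : M ⟶ B) (u : Y ⟶ X) (v : Y ⟶ L) (a : L ⟶ M) (b : L ⟶ P)
    (z : P ⟶ B) (h : IsPullback u v p (a ≫ j)) (h' : IsPullback a b ℓ z) :
    ∃ i : Y ⟶ pullback p j, i ≫ pullback.fst p j = u ∧
      IsPullback i (v ≫ b) (pullback.snd p j ≫ ℓ) z := by
  have w : u ≫ p = (v ≫ a) ≫ j := by rw [h.w, Category.assoc]
  refine ⟨pullback.lift u (v ≫ a) w, pullback.lift_fst _ _ _, ?_⟩
  refine IsPullback.paste_vert (IsPullback.of_right ?_ (pullback.lift_snd _ _ _)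
    (IsPullback.of_hasPullback p j)) h'
  rwa [pullback.lift_fst]

lemma flatInBasePoint_of_flat {X Y : Scheme.{0}} (f : X ⟶ Y) [Flat f] (y : Y) :
    FlatInBasePoint f y := by
  unfold FlatInBasePoint
  infer_instance

/-- The assembly of the maps between `X`, `S` and their images from the maps between the models
`B` and `T` of these images. -/
lemma exists_maps_of_image_iso {X S X' Y M Mb A A' B T L P : Scheme.{0}} {f : X ⟶ A} {g : S ⟶ A'}
    {iX : X ⟶ B} {iS : S ⟶ T} {aX : B ⟶ A} {aS : T ⟶ A'} (eX : f.image ≅ B) (eS : g.image ≅ T)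
    (hX : eX.hom ≫ aX = f.imageι) (hX' : f.toImage ≫ eX.hom = iX)
    (hS : eS.hom ≫ aS = g.imageι) (hS' : g.toImage ≫ eS.hom = iS)
    (nX : IsNormalization iX) (nS : IsNormalization iS) {pr : A ⟶ A'} (β : B ⟶ T) (fβ : Flat β)
    (hβ : aX ≫ pr = β ≫ aS) {π : X' ⟶ S} (iX' : X' ⟶ B) (hπ : IsPullback iX' π β iS)
    {ℓ : M ⟶ Mb} (fℓ : Flat ℓ) {m : M ⟶ A'} (ψ : M ⟶ T) (hψ : ψ ≫ aS = m) (s : Y ⟶ B) (v : Y ⟶ L)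
    (δ : L ⟶ T) (h : IsPullback s v β δ) (a : L ⟶ M) (haψ : a ≫ ψ = δ) (b : L ⟶ P) {z : P ⟶ Mb}
    (h' : IsPullback a b ℓ z) {y : Y ⟶ A} (hy : y = s ≫ aX) {x' : X' ⟶ A} (hx' : x' = iX' ≫ aX)
    {str : Y ⟶ P} (hstr : str = v ≫ b) (o : Mb) :
    (IsNormalization f.toImage ∧ IsNormalization g.toImage) ∧
      ∃ p : f.image ⟶ g.image, p ≫ g.imageι = f.imageι ≫ pr ∧
        (∃ q : X' ⟶ f.image, q ≫ f.imageι = x' ∧ IsPullback q π p g.toImage) ∧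
        ∃ j : M ⟶ g.image, j ≫ g.imageι = m ∧
          FlatInBasePoint (pullback.snd p j ≫ ℓ) o ∧
          ∃ i : Y ⟶ pullback p j, i ≫ pullback.fst p j ≫ f.imageι = y ∧
            IsPullback i str (pullback.snd p j ≫ ℓ) z := by
  subst hy hx' hstr haψ hψ
  have hX3 : eX.inv ≫ f.imageι = aX := (Iso.inv_comp_eq _).2 hX.symm
  have hS3 : eS.inv ≫ g.imageι = aS := (Iso.inv_comp_eq _).2 hS.symm
  have hS4 : g.toImage = iS ≫ eS.inv := (Iso.eq_comp_inv eS).2 hS'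
  refine ⟨⟨?_, ?_⟩, eX.hom ≫ β ≫ eS.inv, ?_, ⟨iX' ≫ eX.inv, ?_, ?_⟩, ψ ≫ eS.inv, ?_,
    flatInBasePoint_of_flat _ _, ?_⟩
  · rw [(Iso.eq_comp_inv eX).2 hX']
    exact nX.comp_isIso _
  · rw [hS4]
    exact nS.comp_isIso _
  · rw [Category.assoc, Category.assoc, hS3, ← hβ, ← hX, Category.assoc]
  · rw [Category.assoc, hX3]
  · exact hπ.of_iso (Iso.refl _) eX.symm (Iso.refl _) eS.symm (by simp) (by simp) (by simp)
      (by simp [hS4])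
  · rw [Category.assoc, hS3]
  · have h1 : IsPullback (s ≫ eX.inv) v (eX.hom ≫ β ≫ eS.inv) (a ≫ ψ ≫ eS.inv) :=
      h.of_iso (Iso.refl _) eX.symm (Iso.refl _) eS.symm (by simp) (by simp) (by simp) (by simp)
    obtain ⟨i, hi, hi'⟩ := isPullback_lift_comp _ _ _ _ _ _ _ _ h1 h'
    exact ⟨i, by rw [← Category.assoc, hi, Category.assoc, hX3], hi'⟩

lemma flat_SpecMap_mapDomain {P T K : Type} [AddCommMonoid P] [AddCommMonoid T] (ι : T →+ P)
    (e : K → P) (h : Function.Bijective fun x : K × T => e x.1 + ι x.2) :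
    Flat (Spec.map (CommRingCat.ofHom (AddMonoidAlgebra.mapDomainRingHom ℂ ι))) := by
  rw [Flat.SpecMap_iff]
  let := (AddMonoidAlgebra.mapDomainRingHom ℂ ι).toAlgebra
  obtain ⟨b, -⟩ := exists_basis_single ι e h
  have := Module.Free.of_basis b
  change Module.Flat _ _
  infer_instance

/-! ### The models of X̄ and S̄ and their cartesian squares -/

namespace Setting

variable {n r N w : ℕ} (D : Setting n r N)

/-- The coordinate functions on `S̄`. -/
def coordS (i : Fin N) : AddMonoidAlgebra ℂ D.AS := mono D.AS (D.coord i) (D.coord_mem_AS i)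

/-- The exponents of the coordinate functions on `X̄`. -/
def exponentX (c : Fin w → Fin n → ℤ) : Fin w ⊕ Fin N → (Fin n → ℤ) × Module.Dual ℝ D.V :=
  Sum.elim (fun ν => (c ν, D.etaStar (c ν))) fun i => (0, D.coord i)

variable {c : Fin w → Fin n → ℤ}

lemma exponentX_mem_AX (hc : D.IsGenerating c) (i : Fin w ⊕ Fin N) : D.exponentX c i ∈ D.AX := by
  rw [D.AX_eq_closure hc]
  exact AddSubmonoid.subset_closure ⟨i, rfl⟩

/-- The coordinate functions on `X̄`. -/
def coordX (hc : D.IsGenerating c) (i : Fin w ⊕ Fin N) : AddMonoidAlgebra ℂ D.AX :=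
  mono D.AX (D.exponentX c i) (D.exponentX_mem_AX hc i)

lemma coordS_surjective : Function.Surjective (MvPolynomial.aeval (R := ℂ) D.coordS) :=
  aeval_mono_surjective D.AS D.coord rfl D.coord_mem_AS

lemma coordX_surjective (hc : D.IsGenerating c) :
    Function.Surjective (MvPolynomial.aeval (R := ℂ) (D.coordX hc)) :=
  aeval_mono_surjective D.AX (D.exponentX c) (D.AX_eq_closure hc) (D.exponentX_mem_AX hc)

lemma mapDomainRingHom_mono {G H : Type} [AddCommMonoid G] [AddCommMonoid H] (P : AddSubmonoid G)
    (P' : AddSubmonoid H) (j : P →+ P') (p : G) (hp : p ∈ P) (q : H) (hq : q ∈ P')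
    (h : (j ⟨p, hp⟩).1 = q) :
    AddMonoidAlgebra.mapDomainRingHom ℂ j (mono P p hp) = mono P' q hq := by
  rw [mono, mapDomainRingHom_single]
  subst h
  rfl

lemma mapS_eq : D.mapS =
    Spec.map (CommRingCat.ofHom (AddMonoidAlgebra.mapDomainRingHom ℂ D.inclS)) ≫
      toAffine D.coordS :=
  ((SpecMap_toAffine _ (mapDomainRingHom_algebraMap _) _).trans (congrArg toAffine
    (funext fun _ => mapDomainRingHom_mono _ _ _ _ _ _ _ rfl))).symm

lemma mapX_eq (hc : D.IsGenerating c) (hX : ∀ ν, (c ν, D.etaStar (c ν)) ∈ D.monX) :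
    D.mapX c (fun ν => D.etaStar (c ν)) hX =
      Spec.map (CommRingCat.ofHom (AddMonoidAlgebra.mapDomainRingHom ℂ D.inclX)) ≫
        toAffine (D.coordX hc) := by
  refine ((SpecMap_toAffine _ (mapDomainRingHom_algebraMap _) _).trans (congrArg toAffine
    (funext fun i => ?_))).symm
  cases i <;> exact mapDomainRingHom_mono _ _ _ _ _ _ _ rfl

lemma mapX'_eq (hc : D.IsGenerating c) (hΓ : ∀ ν, (c ν, D.etaStar (c ν)) ∈ D.Gamma) :
    D.mapX' c (fun ν => D.etaStar (c ν)) hΓ =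
      Spec.map (CommRingCat.ofHom (AddMonoidAlgebra.mapDomainRingHom ℂ D.inclX')) ≫
        toAffine (D.coordX hc) := by
  refine ((SpecMap_toAffine _ (mapDomainRingHom_algebraMap _) _).trans (congrArg toAffine
    (funext fun i => ?_))).symm
  cases i <;> exact mapDomainRingHom_mono _ _ _ _ _ _ _ rfl

lemma mapY_eq (hc : D.IsGenerating c) :
    D.mapY c hc =
      Spec.map (CommRingCat.ofHom (AddMonoidAlgebra.mapDomainRingHom ℂ D.specialize)) ≫
        toAffine (D.coordX hc) := by
  refine ((SpecMap_toAffine _ (mapDomainRingHom_algebraMap _) _).trans (congrArg toAffine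
    (funext fun i => ?_))).symm
  cases i with
  | inl ν =>
    exact mapDomainRingHom_mono _ _ _ _ _ _ _ (D.specialize_sectionX ⟨c ν, hc.mem ν⟩)
  | inr i =>
    refine mapDomainRingHom_mono _ _ _ _ _ _ _ ?_
    change 0 + ⌊D.coord i D.one⌋ • D.R = D.R
    rw [show D.coord i D.one = 1 from rfl, Int.floor_one, one_smul, zero_add]

lemma toAffine_proj (hc : D.IsGenerating c) : toAffine (D.coordX hc) ≫ proj w N =
    Spec.map (CommRingCat.ofHom (AddMonoidAlgebra.mapDomainRingHom ℂ D.inclBar)) ≫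
      toAffine D.coordS := by
  refine (SpecMap_toAffine _ (fun z => AlgHom.commutes _ z) _).trans
    (.trans ?_ (SpecMap_toAffine _ (mapDomainRingHom_algebraMap D.inclBar) _).symm)
  refine congrArg toAffine (funext fun i => ?_)
  refine .trans (MvPolynomial.aeval_X (D.coordX hc) (Sum.inr i)) ?_
  exact (mapDomainRingHom_mono D.AS D.AX D.inclBar _ _ _ _ rfl).symm

/-- The section `c ↦ [c, η^*(c)]` gives a basis of `ℂ[AX]` over `ℂ[AS]` and of `ℂ[Γ]` over the
coordinate ring of S. -/
lemma isPullback_inclX' :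
    IsPullback (Spec.map (CommRingCat.ofHom (AddMonoidAlgebra.mapDomainRingHom ℂ D.inclX')))
      D.piMap
      (Spec.map (CommRingCat.ofHom (AddMonoidAlgebra.mapDomainRingHom ℂ D.inclBar)))
      (Spec.map (CommRingCat.ofHom (AddMonoidAlgebra.mapDomainRingHom ℂ D.inclS))) :=
  isPullback_SpecMap_of_isPushout _ _ _ _ <|
    isPushout_semigroup D.inclBar D.inclGamma D.inclX' D.inclS rfl D.sectionX D.bijective_sectionX
      D.bijective_sectionX'

lemma isPullback_specialize :
    IsPullback (Spec.map (CommRingCat.ofHom (AddMonoidAlgebra.mapDomainRingHom ℂ D.specialize)))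
      (Spec.map (CommRingCat.ofHom (AddMonoidAlgebra.mapDomainRingHom ℂ D.multR)))
      (Spec.map (CommRingCat.ofHom (AddMonoidAlgebra.mapDomainRingHom ℂ D.inclBar)))
      (Spec.map (CommRingCat.ofHom (AddMonoidAlgebra.mapDomainRingHom ℂ D.degS))) :=
  isPullback_SpecMap_of_isPushout _ _ _ _ <|
    isPushout_semigroup D.inclBar D.multR D.specialize D.degS D.specialize_inclBar D.sectionX
      D.bijective_sectionX D.bijective_specialize

lemma isPullback_ell (hN : 0 < N) :
    IsPullback (Spec.map (CommRingCat.ofHom D.diagHom.toRingHom))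
      (Spec.map (CommRingCat.ofHom (algebraMap ℂ (AddMonoidAlgebra ℂ ℕ)))) D.ell D.zeroMap :=
  isPullback_SpecMap_of_isPushout _ _ _ _ (D.isPushout_ell ⟨0, hN⟩)

lemma Ystr_eq : D.Ystr =
    Spec.map (CommRingCat.ofHom (AddMonoidAlgebra.mapDomainRingHom ℂ D.multR)) ≫
      Spec.map (CommRingCat.ofHom (algebraMap ℂ (AddMonoidAlgebra ℂ ℕ))) := by
  refine .trans ?_ (Spec.map_comp _ _)
  refine congrArg Spec.map ?_
  rw [← CommRingCat.ofHom_comp]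
  exact congrArg CommRingCat.ofHom (RingHom.ext fun z => (mapDomainRingHom_algebraMap _ z).symm)

lemma flat_ell (hN : 0 < N) : Flat D.ell :=
  Flat.SpecMap_iff.2 (D.flat_ellHom ⟨0, hN⟩)

/-- The inclusion of `ℳ` in `S̄`, in terms of coordinate rings. -/
lemma exists_map_M : ∃ ψ : AddMonoidAlgebra ℂ D.AS →ₐ[ℂ] D.ringM,
    Spec.map (CommRingCat.ofHom ψ.toRingHom) ≫ toAffine D.coordS = D.mapM ∧
    Spec.map (CommRingCat.ofHom D.diagHom.toRingHom) ≫ Spec.map (CommRingCat.ofHom ψ.toRingHom) =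
      Spec.map (CommRingCat.ofHom (AddMonoidAlgebra.mapDomainRingHom ℂ D.degS)) := by
  obtain ⟨ψ, hψ⟩ : ∃ ψ : AddMonoidAlgebra ℂ D.AS →ₐ[ℂ] D.ringM,
      ∀ i, ψ (D.coordS i) = D.mkM (MvPolynomial.X i) := D.exists_retraction
  refine ⟨ψ, ?_, ?_⟩
  · refine (SpecMap_toAffine _ (fun z => AlgHom.commutes ψ z) _).trans
      (congrArg Spec.map (congrArg CommRingCat.ofHom ?_))
    have : MvPolynomial.aeval (R := ℂ) (fun i => ψ (D.coordS i)) = D.mkM :=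
      MvPolynomial.algHom_ext fun i => (MvPolynomial.aeval_X _ i).trans (hψ i)
    exact congrArg AlgHom.toRingHom this
  · refine (Spec.map_comp _ _).symm.trans (congrArg Spec.map ?_)
    rw [← CommRingCat.ofHom_comp]
    refine congrArg CommRingCat.ofHom (RingHom.ext fun x => ?_)
    obtain ⟨p, rfl⟩ := D.coordS_surjective x
    let δ : AddMonoidAlgebra ℂ D.AS →ₐ[ℂ] AddMonoidAlgebra ℂ ℕ :=
      { AddMonoidAlgebra.mapDomainRingHom ℂ D.degS with
        commutes' := mapDomainRingHom_algebraMap _ }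
    have : (D.diagHom.comp ψ).comp (MvPolynomial.aeval D.coordS) =
        δ.comp (MvPolynomial.aeval D.coordS) := by
      refine MvPolynomial.algHom_ext fun i => ?_
      rw [AlgHom.comp_apply, AlgHom.comp_apply, AlgHom.comp_apply, MvPolynomial.aeval_X, hψ,
        diagHom_X]
      refine (mapDomainRingHom_single _ _ _).trans ?_ |>.symm
      change AddMonoidAlgebra.single ⌊D.coord i D.one⌋₊ 1 = _
      rw [show D.coord i D.one = 1 from rfl, Nat.floor_one]
    exact AlgHom.congr_fun this p

end Setting

end ToricFlat

end

theorem theorem4p1 {n r N w : ℕ} (D : ToricFlat.Setting n r N) (hN : 0 < N)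
    (c : Fin w → Fin n → ℤ) (hc : D.IsGenerating c) :
    (∀ u ∈ D.dualTail, ∃! η, D.IsEtaStar u η) ∧
    ∀ (η : Fin w → Module.Dual ℝ D.V) (hη : ∀ ν, D.IsEtaStar (c ν) (η ν)),
    ∃ hX : ∀ ν, (c ν, η ν) ∈ D.monX,
      (ToricFlat.IsNormalization (D.mapX c η hX).toImage ∧
        ToricFlat.IsNormalization D.mapS.toImage) ∧
      ∃ piBar : (D.mapX c η hX).image ⟶ D.mapS.image,
        piBar ≫ D.mapS.imageι = (D.mapX c η hX).imageι ≫ ToricFlat.Setting.proj w N ∧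
        (∃ g : D.X' ⟶ (D.mapX c η hX).image,
          g ≫ (D.mapX c η hX).imageι = D.mapX' c η (D.mem_Gamma hc hη hX) ∧
          IsPullback g D.piMap piBar D.mapS.toImage) ∧
        ∃ j : D.M ⟶ D.mapS.image, j ≫ D.mapS.imageι = D.mapM ∧
          ToricFlat.FlatInBasePoint (pullback.snd piBar j ≫ D.ell) D.zeroPoint ∧
          ∃ i : D.Y ⟶ pullback piBar j,
            i ≫ pullback.fst piBar j ≫ (D.mapX c η hX).imageι = D.mapY c hc ∧
            IsPullback i D.Ystr (pullback.snd piBar j ≫ D.ell) D.zeroMap := by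
  refine ⟨fun u hu => ⟨D.etaStar u, (D.isEtaStar_iff hu).2 rfl,
    fun η h => (D.isEtaStar_iff hu).1 h⟩, fun η hη => ?_⟩
  obtain rfl : η = fun ν => D.etaStar (c ν) :=
    funext fun ν => (D.isEtaStar_iff (hc.mem ν)).1 (hη ν)
  have hX : ∀ ν, (c ν, D.etaStar (c ν)) ∈ D.monX := fun ν => D.etaStar_mem_monX (hc.mem ν)
  -- The coordinate monomials generate `ℂ[AS]` and `ℂ[AX]`, which inject into the coordinate rings
  -- of S and X. So the two images are the spectra of these algebras.
  obtain ⟨eS, hS, hS'⟩ := ToricFlat.exists_image_iso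
    (CommRingCat.ofHom (MvPolynomial.aeval (R := ℂ) D.coordS).toRingHom)
    (CommRingCat.ofHom (AddMonoidAlgebra.mapDomainRingHom ℂ D.inclS)) D.coordS_surjective
    (ToricFlat.mapDomainRingHom_injective D.inclS_injective) D.mapS D.mapS_eq
  obtain ⟨eX, hX1, hX2⟩ := ToricFlat.exists_image_iso
    (CommRingCat.ofHom (MvPolynomial.aeval (R := ℂ) (D.coordX hc)).toRingHom)
    (CommRingCat.ofHom (AddMonoidAlgebra.mapDomainRingHom ℂ D.inclX)) (D.coordX_surjective hc)
    (ToricFlat.mapDomainRingHom_injective D.inclX_injective) (D.mapX c _ hX) (D.mapX_eq hc hX)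
  obtain ⟨ψ, hψ, hψ'⟩ := D.exists_map_M
  exact ⟨hX, ToricFlat.exists_maps_of_image_iso eX eS hX1 hX2 hS hS' D.isNormalization_inclX
    D.isNormalization_inclS _
    (ToricFlat.flat_SpecMap_mapDomain D.inclBar D.sectionX D.bijective_sectionX)
    (D.toAffine_proj hc) _ D.isPullback_inclX' (D.flat_ell hN) _ hψ _ _ _
    D.isPullback_specialize _ hψ' _ (D.isPullback_ell hN) (D.mapY_eq hc)
    (D.mapX'_eq hc (D.mem_Gamma hc hη hX)) D.Ystr_eq _⟩
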